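/- Let $p$ be a prime, let $n\ge 3$ be an integer with $p\nmid n^2-n+1$, and let $\mathbb K$ be an algebraic closure of $\mathbb F_p$. Let $\mathcal H_n\subset\mathbb P^2(\mathbb K)$ be the smooth Hurwitz curve $XY^n+YZ^n+X^nZ=0$, with function field $\mathbb K(x,y)$, $x=X/Z$, $y=Y/Z$, $xy^n+y+x^n=0$. Put $P_1=(1:0:0)$, $P_2=(0:1:0)$, $P_3=(0:0:1)$. For $P\in\mathcal H_n$ let $j(P)$ be the intersection multiplicity at $P$ of $\mathcal H_n$ with its tangent line at $P$. Let $D_x^{(i)}$ be the $i$-th Hasse derivative with respect to $x$, and let $(0,1,\epsilon)$ be the order sequence of $\mathcal H_n$ for the morphism of lines, that is, $\epsilon$ is the least $i$ such that the vectors $\big(D^{(k)}_x1,D^{(k)}_xx,D^{(k)}_xy\big)$, $k=0,1,i$, are linearly independent over $\mathbb K(x,y)$. Let $$R=\operatorname{div}\big(D_x^{(\epsilon)}y\big)+(1+\epsilon)\operatorname{div}(dx)+3E,\qquad E=\sum_{P\in\mathcal H_n} e_PP,\quad e_P=-\min\{0,v_P(x),v_P(y)\},$$ be the ramification divisor of the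 morphism of lines, and let $$g(T)=(n-1)T^3+(n^3-3n^2+6n-2)T^2+(n^3-3n^2+3n+1)T-(n-1)\in\mathbb F_p[T].$$ If $n$ is not a power of $p$, then $$\operatorname{Supp}(R)=\{P_1,P_2,P_3\}\cup\mathcal W,$$ and if $n$ is a power of $p$, then $\operatorname{Supp}(R)=\mathcal W$, where $\mathcal W\subset\mathbb P^2(\mathbb K)$ is the following set ($\lambda,t$ range over $\mathbb K$). 1. If $p\mid n$, write $n=p^rm$ with $r\ge1$ and $p\nmid m$. Then $$\mathcal W=\{(\lambda:t^n:t^{n-1})\ :\ t^{n^2-n+1}=\lambda^{n-p^r-1},\ \lambda^{p^r+1}+\lambda+1=0\},$$ and $j(P)=p^r+1$ for all $P\in\mathcal W$. 2. If $p\nmid n$: (i) Case $p=2$. If $n\equiv1\pmod 4$, then $\mathcal W=\emptyset$. Otherwise $$\mathcal W=\{(\lambda:t^n:t^{n-1})\ :\ t^{n^2-n+1}=\lambda^{n-3},\ \lambda^3+\lambda+1=0\},$$ and $j(P)=3$ for all $P\in\mathcal W$. (ii) Case $p>2$. If $p\mid n-1$, then $\mathcal W=\emptyset$. If $p\nmid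 n-1$, then: (a) if $p\mid n^2-4n+7$, then $$\mathcal W=\{(t:\lambda t^n:1)\ :\ t^{n^2-n+1}=\lambda^{2(n+1)},\ g(\lambda)=0\},$$ and $j(P)=5$ for all $P\in\mathcal W$; (b) if $p\nmid n^2-4n+7$, then $$\mathcal W=\{(t:\lambda t^n:1)\ :\ t^{n^2-n+1}=-(\lambda+1)\lambda^{-n},\ g(\lambda)=0\},$$ and $j(P)=3$ for all $P\in\mathcal W$. -/

import Mathlib

/-! The Hurwitz curve `X Y^n + Y Z^n + X^n Z = 0`, its function field, the ramification divisor of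
its morphism of lines, and tangent orders. -/

noncomputable section

namespace Hurwitz

/-! ### Plane curves, tangent lines, intersection multiplicities with lines -/

/-- The points of the projective plane over `K`; coordinates `0, 1, 2` are `X, Y, Z`. -/
abbrev Plane (K : Type*) [Field K] : Type _ := Projectivization K (Fin 3 → K)

/-- The zero locus in the projective plane of a homogeneous form `F`. -/
def zeroLocus {K : Type*} [Field K] (F : MvPolynomial (Fin 3) K) : Set (Plane K) :=
  {P | MvPolynomial.eval P.rep F = 0}

/-- The tangent line at `P` of the plane curve `F = 0`, as a linear subspace of `K³`:
the vectors `w` with `∑ i, (∂F/∂X_i)(P) * w_i = 0`. -/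
def tangentLine {K : Type*} [Field K] (F : MvPolynomial (Fin 3) K) (P : Plane K) :
    Submodule K (Fin 3 → K) :=
  LinearMap.ker (∑ i : Fin 3,
    MvPolynomial.eval P.rep (MvPolynomial.pderiv i F) • (LinearMap.proj i : (Fin 3 → K) →ₗ[K] K))

/-- The restriction of the form `F` to the line through the points `v` and `w`:
the polynomial `F (v + s w)` in the parameter `s`. -/
def restrictToLine {K : Type*} [Field K] (F : MvPolynomial (Fin 3) K) (v w : Fin 3 → K) :
    Polynomial K :=
  MvPolynomial.aeval (fun i => Polynomial.C (v i) + Polynomial.X * Polynomial.C (w i)) F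

/-- The intersection multiplicity at `P` of the curve `F = 0` with a line `L` through `P`: the order
of vanishing at `s = 0` of `F (v + s w)`, where `v` represents `P` and `w` is any vector of
`L` that is not proportional to `v`. All such `w` give the same order. The vectors `w`
proportional to `v` give `⊤` if `F` vanishes at `P`, so that they do not contribute to the infimum.
The value is `⊤` if the line is contained in the curve. -/
def lineIntersectionMultiplicity {K : Type*} [Field K] (F : MvPolynomial (Fin 3) K)
    (P : Plane K) (L : Submodule K (Fin 3 → K)) : ℕ∞ :=
  ⨅ w ∈ L, emultiplicity (Polynomial.X : Polynomial K) (restrictToLine F P.rep w)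

/-! ### The Hurwitz curve and its function field -/

/-- The form `X Y^n + Y Z^n + X^n Z`. -/
def form (K : Type*) [Field K] (n : ℕ) : MvPolynomial (Fin 3) K :=
  MvPolynomial.X 0 * MvPolynomial.X 1 ^ n + MvPolynomial.X 1 * MvPolynomial.X 2 ^ n
    + MvPolynomial.X 0 ^ n * MvPolynomial.X 2

/-- The points of the Hurwitz curve. -/
def curve (K : Type*) [Field K] (n : ℕ) : Set (Plane K) := zeroLocus (form K n)

/-- `j(P)`, the intersection multiplicity at `P` of the Hurwitz curve with its tangent line. -/
def tangentOrder (K : Type*) [Field K] (n : ℕ) (P : Plane K) : ℕ∞ :=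
  lineIntersectionMultiplicity (form K n) P (tangentLine (form K n) P)

/-- The affine equation `x y^n + y + x^n`, as a polynomial in `x` over `K[y]`: the variable `y` is
`Polynomial.C Polynomial.X`, the variable `x` is the outer `Polynomial.X`. -/
def affineEquation (K : Type*) [Field K] (n : ℕ) : Polynomial (Polynomial K) :=
  Polynomial.X * Polynomial.C Polynomial.X ^ n + Polynomial.C Polynomial.X + Polynomial.X ^ n

theorem affineEquation_natDegree (K : Type*) [Field K] {n : ℕ} (hn : 2 < n) :
    (affineEquation K n).natDegree = n := by
  unfold affineEquation
  rw [← Polynomial.C_pow]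
  compute_degree!
  · simp [show ¬ n = 1 by omega, show ¬ n = 0 by omega]
  · omega
  · omega

theorem affineEquation_irreducible (K : Type*) [Field K] {n : ℕ} (hn : 2 < n) :
    Irreducible (affineEquation K n) := by
  have hd := affineEquation_natDegree K hn
  have hc : ∀ k, (affineEquation K n).coeff k
      = (if k = 1 then Polynomial.X ^ n else 0) + (if k = 0 then Polynomial.X else 0)
        + (if k = n then 1 else 0) := by
    intro k
    unfold affineEquation
    rw [← Polynomial.C_pow]
    simp only [Polynomial.coeff_add, Polynomial.coeff_mul_C, Polynomial.coeff_X,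
      Polynomial.coeff_C, Polynomial.coeff_X_pow, ite_mul, one_mul, zero_mul, eq_comm]
  have hm : (affineEquation K n).Monic := by
    rw [Polynomial.Monic, Polynomial.leadingCoeff, hd, hc]
    simp [show ¬ n = 1 by omega, show ¬ n = 0 by omega]
  have h0 : (affineEquation K n).coeff 0 = Polynomial.X := by
    rw [hc]; simp [show ¬ 0 = n by omega]
  refine Polynomial.irreducible_of_eisenstein_criterion
    (P := Ideal.span {(Polynomial.X : Polynomial K)}) ?_ ?_ ?_ ?_ ?_ hm.isPrimitive
  · exact (Ideal.span_singleton_prime Polynomial.X_ne_zero).2 Polynomial.prime_X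
  · rw [hm.leadingCoeff]
    intro h
    exact Polynomial.prime_X.not_isUnit (isUnit_of_dvd_one (Ideal.mem_span_singleton.1 h))
  · intro k hk
    rw [Polynomial.degree_eq_natDegree hm.ne_zero, hd] at hk
    have hk' : k < n := by exact_mod_cast hk
    rw [hc, Ideal.mem_span_singleton, if_neg (show ¬ k = n by omega), add_zero]
    refine dvd_add ?_ ?_ <;> split_ifs
    · exact dvd_pow_self _ (by omega)
    · exact dvd_zero _
    · exact dvd_rfl
    · exact dvd_zero _
  · rw [Polynomial.degree_eq_natDegree hm.ne_zero, hd]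
    exact_mod_cast (by omega : 0 < n)
  · rw [h0, Ideal.span_singleton_pow, Ideal.mem_span_singleton]
    intro h
    rw [Polynomial.X_pow_dvd_iff] at h
    simpa using h 1 (by norm_num)

/-- The coordinate ring `K[x, y] / (x y^n + y + x^n)` of the affine part `Z ≠ 0`. -/
abbrev CoordinateRing (K : Type*) [Field K] (n : ℕ) : Type _ := AdjoinRoot (affineEquation K n)

instance (K : Type*) [Field K] (n : ℕ) [hn : Fact (2 < n)] : IsDomain (CoordinateRing K n) :=
  AdjoinRoot.isDomain_of_prime (affineEquation_irreducible K hn.out).prime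

/-- The function field `K(x, y)` of the Hurwitz curve. -/
abbrev FunctionField (K : Type*) [Field K] (n : ℕ) : Type _ := FractionRing (CoordinateRing K n)

variable (K : Type*) [Field K] (n : ℕ) [Fact (2 < n)]

/-- The function `x = X / Z`. -/
def x : FunctionField K n :=
  algebraMap (CoordinateRing K n) (FunctionField K n) (AdjoinRoot.root (affineEquation K n))

/-- The function `y = Y / Z`. -/
def y : FunctionField K n :=
  algebraMap (CoordinateRing K n) (FunctionField K n)
    (AdjoinRoot.of (affineEquation K n) Polynomial.X)

/-! ### Local rings, orders of functions and of differentials -/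

/-- The local ring of the curve at `P`, inside the function field: the functions `G / H` with `G`
and `H` forms of the same degree and `H(P) ≠ 0`. -/
def localRing (P : Plane K) : Subalgebra K (FunctionField K n) where
  carrier := {φ | ∃ (d : ℕ) (G H : MvPolynomial (Fin 3) K), G.IsHomogeneous d ∧
    H.IsHomogeneous d ∧ MvPolynomial.eval P.rep H ≠ 0 ∧
    φ * MvPolynomial.aeval ![x K n, y K n, 1] H = MvPolynomial.aeval ![x K n, y K n, 1] G}
  mul_mem' := by
    rintro a b ⟨d, G, H, hG, hH, h0, h⟩ ⟨d', G', H', hG', hH', h0', h'⟩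
    refine ⟨d + d', G * G', H * H', hG.mul hG', hH.mul hH', ?_, ?_⟩
    · rw [map_mul]; exact mul_ne_zero h0 h0'
    · rw [map_mul, map_mul, ← h, ← h']; ring
  add_mem' := by
    rintro a b ⟨d, G, H, hG, hH, h0, h⟩ ⟨d', G', H', hG', hH', h0', h'⟩
    refine ⟨d + d', G * H' + H * G', H * H', (hG.mul hH').add (hH.mul hG'), hH.mul hH', ?_, ?_⟩
    · rw [map_mul]; exact mul_ne_zero h0 h0'
    · rw [map_mul, map_add, map_mul, map_mul, ← h, ← h']; ring
  algebraMap_mem' := by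
    intro c
    refine ⟨0, MvPolynomial.C c, 1, MvPolynomial.isHomogeneous_C _ _,
      MvPolynomial.isHomogeneous_one _ _, by simp, by simp⟩

variable {K n}

/-- A local parameter at `P`: an irreducible element of the local ring at `P`. (At the points of a
smooth curve the local ring is a discrete valuation ring, whose irreducible elements are the
generators of the maximal ideal.) -/
def IsLocalParameter (P : Plane K) (t : FunctionField K n) : Prop :=
  ∃ h : t ∈ localRing K n P, Irreducible (⟨t, h⟩ : localRing K n P)

/-- `m` is the order at `P` of the function `φ`: one has `φ = u * t ^ m` with `t` a local parameter
and `u` a unit of the local ring. -/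
def HasOrder (P : Plane K) (φ : FunctionField K n) (m : ℤ) : Prop :=
  ∃ t u : FunctionField K n, IsLocalParameter P t ∧ u ≠ 0 ∧ u ∈ localRing K n P ∧
    u⁻¹ ∈ localRing K n P ∧ φ = u * t ^ m

open Classical in
/-- `v_P(φ)`, for `φ ≠ 0`: the order of `φ` at the point `P` of the curve. -/
def order (P : Plane K) (φ : FunctionField K n) : ℤ :=
  if h : ∃ m, HasOrder P φ m then h.choose else 0

/-- `m` is the order at `P` of the differential `ω`: one has `ω = g dt` with `t` a local parameter
and `m` the order of `g`. -/
def DifferentialHasOrder (P : Plane K) (ω : KaehlerDifferential K (FunctionField K n)) (m : ℤ) :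
    Prop :=
  ∃ t g : FunctionField K n, IsLocalParameter P t ∧
    ω = g • KaehlerDifferential.D K (FunctionField K n) t ∧ HasOrder P g m

open Classical in
/-- The coefficient at `P` of the divisor of a differential `ω ≠ 0`. -/
def differentialOrder (P : Plane K) (ω : KaehlerDifferential K (FunctionField K n)) : ℤ :=
  if h : ∃ m, DifferentialHasOrder P ω m then h.choose else 0

/-! ### Hasse derivatives and the ramification divisor -/

/-- `T` is the Taylor expansion with respect to `x`: a homomorphism of `K`-algebras from the
function field to its power series in one variable `s` that has constant term the identity and
sends `x` to `x + s`. When `x` is a separating variable, there is exactly one. -/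
def IsTaylorExpansion (T : FunctionField K n →ₐ[K] PowerSeries (FunctionField K n)) : Prop :=
  (∀ φ, PowerSeries.constantCoeff (T φ) = φ) ∧
    T (x K n) = PowerSeries.C (x K n) + PowerSeries.X

open Classical in
/-- The Hasse derivative `D_x^{(i)} φ`: the `i`-th coefficient of the Taylor expansion of `φ`
with respect to the separating variable `x`. -/
def hasseDeriv (i : ℕ) (φ : FunctionField K n) : FunctionField K n :=
  if h : ∃ T : FunctionField K n →ₐ[K] PowerSeries (FunctionField K n), IsTaylorExpansion T then
    PowerSeries.coeff i (h.choose φ)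
  else 0

variable (K n)

/-- The vector `(D_x^{(i)} 1, D_x^{(i)} x, D_x^{(i)} y)` of Hasse derivatives of the coordinate
functions `1, x, y` of the morphism of lines. -/
def hasseVector (i : ℕ) : Fin 3 → FunctionField K n :=
  ![hasseDeriv i 1, hasseDeriv i (x K n), hasseDeriv i (y K n)]

/-- The number `ε` of the order sequence `(0, 1, ε)` of the curve with respect to lines: the least
`i` for which the Hasse derivatives of orders `0`, `1`, `i` of `(1, x, y)` are linearly independent
over the function field. -/
def epsilon : ℕ :=
  sInf {i | LinearIndependent (FunctionField K n)
    ![hasseVector K n 0, hasseVector K n 1, hasseVector K n i]}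

/-- The coefficient `e_P = - min (0, v_P(x), v_P(y))` of the divisor `E`. -/
def poleOrder (P : Plane K) : ℤ := - min 0 (min (order P (x K n)) (order P (y K n)))

/-- The coefficient at `P` of the ramification divisor
`R = div (D_x^{(ε)} y) + (1 + ε) div (dx) + 3 E` of the morphism of lines. -/
def ramification (P : Plane K) : ℤ :=
  order P (hasseDeriv (epsilon K n) (y K n))
    + (1 + (epsilon K n : ℤ)) *
      differentialOrder P (KaehlerDifferential.D K (FunctionField K n) (x K n))
    + 3 * poleOrder K n P

/-- The support of the ramification divisor. -/
def ramificationSupport : Set (Plane K) := {P | P ∈ curve K n ∧ ramification K n P ≠ 0}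

/-- The set `{(1:0:0), (0:1:0), (0:0:1)}`. -/
def fundamentalPoints : Set (Plane K) :=
  {P | ∃ (i : Fin 3) (h : (Pi.single i 1 : Fin 3 → K) ≠ 0), P = Projectivization.mk K _ h}

/-- The polynomial
`(n-1) T³ + (n³ - 3n² + 6n - 2) T² + (n³ - 3n² + 3n + 1) T - (n-1)`. -/
def cubic (R : Type*) [CommRing R] (n : ℕ) : Polynomial R :=
  Polynomial.C ((n : R) - 1) * Polynomial.X ^ 3
    + Polynomial.C ((n : R) ^ 3 - 3 * (n : R) ^ 2 + 6 * (n : R) - 2) * Polynomial.X ^ 2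
    + Polynomial.C ((n : R) ^ 3 - 3 * (n : R) ^ 2 + 3 * (n : R) + 1) * Polynomial.X
    - Polynomial.C ((n : R) - 1)

end Hurwitz

end

/-!
The cyclic permutation of the coordinates acts on the curve and permutes the three fundamental
points, so that orders of functions at these points follow from those at the origin `(0 : 0 : 1)`,
where `x` is a local parameter and `y` has order `n` (`rotate`, `HasOrder.rotate`). All other points
have nonzero coordinates `(a : b : 1)`; the curve is smooth there because `n ^ 2 - n + 1` is not
zero in `K`, and one of `x - a`, `y - b` is a local parameter (`partial_ne_zero`,
`isRegularPoint_x`, `isRegularPoint_y`). The order of `dx` at such a point is the order of the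
derivative `∂F/∂y` of the equation `F = x y ^ n + y + x ^ n` (`differentialOrder_affinePoint`).

The Hasse derivatives of `y` are read off from the Taylor expansion of the equation.

* If `n = p ^ r * m` with `p ∤ m`, then `ε = p ^ r`, and the corresponding Hasse derivative is
  `m (x y ^ (n - p ^ r + n p ^ r) - x ^ (n - p ^ r))` (`hasseDeriv_y_of_dvd`). It has order
  `n - p ^ r` in the ramification divisor at the fundamental points, which is zero exactly when
  `m = 1`; the other ramification points are its zeros.
* If `p ∤ n`, the second Hasse derivative of `y` is `-H / (∂F/∂y) ^ 3`, where
  `H x ^ 2 y ^ 2 = Φ(x ^ n, y)` for a cubic form `Φ` with constant coefficients (`hessian_mul`).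
  The function `y / x ^ n` is transcendental, so `H` is not zero unless `Φ` is. Hence `ε = 2`, and
  the coefficient of the ramification divisor at an affine point is the order of `H`. The points
  with nonzero coordinates that ramify are those where `λ = b / a ^ n` is a zero of `Φ(1, T)`, which
  is `n / 2` times the polynomial `cubic` if `p ≠ 2`, and `T ^ 3 + T + 1` or `T (T + 1)` if `p = 2`
  (`two_mul_hessianForm`, `hessianForm_of_mod_four_eq_three`, `hessianForm_of_mod_four_eq_one`).
  At the fundamental points the weights of `x ^ n` and `y` show that the coefficient is positive
  (`ramification_fundamentalPoint_pos`).

For the tangent orders, the equation restricted to the line through `(a, b, 1)` with direction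
`(a ξ, b η, 0)` is, after division by `a ^ n`, the polynomial
`-(λ + 1) (1 + ξ s) (1 + η s) ^ n + λ (1 + η s) + (1 + ξ s) ^ n`, which depends on `λ` alone, and the
line is tangent for `(ξ : η) = (n + (n - 1) λ : n - 1 - λ)` (`tangentOrder_eq_emultiplicity`). Its
coefficient of `s ^ 2` is `Φ(1, λ)`. If `p ∣ n`, binomial coefficients modulo `p` give the first
nonzero coefficient at `s ^ (p ^ r + 1)`. If `p ∤ n` and `p ≠ 2`, the coefficients of `s ^ 2` and
`s ^ 3` have no common zero unless `n ^ 2 - 4 n + 7 = 0` in `K`; in that case `cubic` is a constant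
times the cube of a linear polynomial, its zero is a primitive cube root of unity, and the
coefficients of `s ^ 2`, `s ^ 3`, `s ^ 4` vanish while that of `s ^ 5` does not.
-/

noncomputable section

namespace Hurwitz

/-! ### The function field -/

section FunctionFieldBasics

variable {K : Type*} [Field K] {n : ℕ}

theorem affineEquation_monic (K : Type*) [Field K] {n : ℕ} (hn : 2 < n) :
    (affineEquation K n).Monic := by
  have hd := affineEquation_natDegree K hn
  rw [Polynomial.Monic, Polynomial.leadingCoeff, hd]
  unfold affineEquation
  rw [← Polynomial.C_pow]
  simp only [Polynomial.coeff_add, Polynomial.coeff_mul_C, Polynomial.coeff_X,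
    Polynomial.coeff_C, Polynomial.coeff_X_pow]
  simp [show ¬ 1 = n by omega, show ¬ n = 0 by omega]

theorem curve_equation : x K n * y K n ^ n + y K n + x K n ^ n = 0 := by
  have h : AdjoinRoot.mk (affineEquation K n) (Polynomial.X * Polynomial.C Polynomial.X ^ n
      + Polynomial.C Polynomial.X + Polynomial.X ^ n) = 0 := AdjoinRoot.mk_self
  rw [map_add, map_add, map_mul, map_pow, map_pow, AdjoinRoot.mk_C, AdjoinRoot.mk_X] at h
  have h2 := congrArg (algebraMap (CoordinateRing K n) (FunctionField K n)) h
  rw [map_add, map_add, map_mul, map_pow, map_pow, map_zero] at h2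
  exact h2

theorem aeval_y (c : Polynomial K) : Polynomial.aeval (y K n) c
    = algebraMap (CoordinateRing K n) (FunctionField K n)
      (AdjoinRoot.of (affineEquation K n) c) := by
  have : Polynomial.aeval (y K n) =
      ((IsScalarTower.toAlgHom K (CoordinateRing K n) (FunctionField K n)).comp
        (AdjoinRoot.ofAlgHom K (affineEquation K n))) := by
    ext
    simp [y]
  rw [this]; simp

/-- The homomorphism from the coordinate ring given by a solution `(a, b)` of the affine
equation. -/
def coordLift {S : Type*} [CommRing S] [Algebra K S] (a b : S) (h : a * b ^ n + b + a ^ n = 0) :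
    CoordinateRing K n →ₐ[K] S :=
  AdjoinRoot.liftAlgHom (affineEquation K n) (Polynomial.aeval b) a (by
    simpa [affineEquation, Polynomial.eval₂_add, Polynomial.eval₂_mul, Polynomial.eval₂_pow] using h)

theorem coordLift_root {S : Type*} [CommRing S] [Algebra K S] (a b : S)
    (h : a * b ^ n + b + a ^ n = 0) :
    coordLift a b h (AdjoinRoot.root (affineEquation K n)) = a := by
  simp [coordLift]

theorem coordLift_of {S : Type*} [CommRing S] [Algebra K S] (a b : S)
    (h : a * b ^ n + b + a ^ n = 0) (c : Polynomial K) :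
    coordLift a b h (AdjoinRoot.of (affineEquation K n) c) = Polynomial.aeval b c := by
  simp [coordLift]

/-- Homomorphisms out of the function field are determined by the images of `x` and `y`. -/
theorem functionField_algHom_ext {S : Type*} [CommRing S] [Algebra K S]
    {f g : FunctionField K n →ₐ[K] S} (hx : f (x K n) = g (x K n)) (hy : f (y K n) = g (y K n)) :
    f = g := by
  ext
  · exact hy
  · exact hx

/-- Over an algebraically closed field, only the constants are algebraic. -/
theorem eq_zero_of_aeval_eq_zero [IsAlgClosed K] {S : Type*} [Field S] [Algebra K S] {b : S}
    (hb : ∀ c : K, b ≠ algebraMap K S c) {q : Polynomial K} (hq : Polynomial.aeval b q = 0) :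
    q = 0 := by
  by_contra hq0
  have hi : IsIntegral K b := IsAlgebraic.isIntegral ⟨q, hq0, hq⟩
  obtain ⟨c, hc⟩ := minpoly.mem_range_of_degree_eq_one K b
    (IsAlgClosed.degree_eq_one_of_irreducible K (minpoly.irreducible hi))
  exact hb c hc.symm

variable [Fact (2 < n)]

/-- The functions `1` and `x` are linearly independent over `K[y]`. -/
theorem eq_zero_of_linear_relation {a b : Polynomial K}
    (h : Polynomial.aeval (y K n) a + Polynomial.aeval (y K n) b * x K n = 0) :
    a = 0 ∧ b = 0 := by
  have hn : 2 < n := Fact.out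
  rw [aeval_y, aeval_y, x, ← map_mul, ← map_add, FaithfulSMul.algebraMap_eq_zero_iff] at h
  have h2 : AdjoinRoot.mk (affineEquation K n)
      (Polynomial.C a + Polynomial.C b * Polynomial.X) = 0 := by
    rw [map_add, map_mul, AdjoinRoot.mk_C, AdjoinRoot.mk_C, AdjoinRoot.mk_X]; exact h
  have h3 : (Polynomial.C a + Polynomial.C b * Polynomial.X) = 0 := by
    by_contra h0
    refine AdjoinRoot.mk_ne_zero_of_natDegree_lt (affineEquation_monic K hn) h0 ?_ h2
    rw [affineEquation_natDegree K hn]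
    refine lt_of_le_of_lt (b := 1) ?_ (by omega)
    compute_degree
  constructor
  · simpa using congrArg (fun q => Polynomial.coeff q 0) h3
  · simpa using congrArg (fun q => Polynomial.coeff q 1) h3

theorem x_ne_zero : x K n ≠ 0 := by
  intro h
  have := (eq_zero_of_linear_relation (K := K) (n := n) (a := 0) (b := 1) (by simpa using h)).2
  exact one_ne_zero this

theorem y_ne_zero : y K n ≠ 0 := by
  intro h
  have := (eq_zero_of_linear_relation (K := K) (n := n) (a := Polynomial.X) (b := 0)
    (by simpa using h)).1
  exact Polynomial.X_ne_zero this

theorem y_ne_algebraMap (c : K) : y K n ≠ algebraMap K _ c := by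
  intro h
  have := (eq_zero_of_linear_relation (K := K) (n := n) (a := Polynomial.X - Polynomial.C c)
    (b := 0) (by simp [h])).1
  exact Polynomial.X_sub_C_ne_zero c this

theorem x_ne_algebraMap (c : K) : x K n ≠ algebraMap K _ c := by
  intro h
  have := (eq_zero_of_linear_relation (K := K) (n := n) (a := - Polynomial.C c)
    (b := 1) (by simp [h])).2
  exact one_ne_zero this

/-- A solution of the affine equation with nonconstant second coordinate gives an injective
homomorphism: a nonzero kernel would contain a nonzero polynomial in `y`, by integrality. -/
theorem coordLift_injective [IsAlgClosed K] {S : Type*} [Field S] [Algebra K S] (a b : S)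
    (h : a * b ^ n + b + a ^ n = 0) (hb : ∀ c : K, b ≠ algebraMap K S c) :
    Function.Injective (coordLift (K := K) (n := n) a b h) := by
  have hn : 2 < n := Fact.out
  have hfin : Module.Finite (Polynomial K) (CoordinateRing K n) :=
    (affineEquation_monic K hn).finite_adjoinRoot
  have hint : Algebra.IsIntegral (Polynomial K) (CoordinateRing K n) := inferInstance
  rw [injective_iff_map_eq_zero]
  intro r hr
  by_contra hr0
  have hne := Ideal.comap_ne_bot_of_integral_mem
    (I := RingHom.ker (coordLift (K := K) (n := n) a b h)) hr0 (by simpa using hr) (hint.isIntegral r)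
  obtain ⟨c, hc, hc0⟩ := Submodule.exists_mem_ne_zero_of_ne_bot hne
  have hc' : Polynomial.aeval b c = 0 := by
    rw [← coordLift_of (n := n) a b h]; simpa using hc
  exact hc0 (eq_zero_of_aeval_eq_zero hb hc')

/-- Induction on the elements of the function field, which is generated by `x` and `y` as a field. -/
theorem functionField_induction {p : FunctionField K n → Prop}
    (hc : ∀ c : K, p (algebraMap K _ c)) (hx : p (x K n)) (hy : p (y K n))
    (hadd : ∀ a b, p a → p b → p (a + b)) (hmul : ∀ a b, p a → p b → p (a * b))
    (hinv : ∀ a, p a → p a⁻¹) (φ : FunctionField K n) : p φ := by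
  have hA : ∀ r : CoordinateRing K n, p (algebraMap _ _ r) := by
    intro r
    have hofc : ∀ c : Polynomial K, p (algebraMap _ _ (AdjoinRoot.of (affineEquation K n) c)) := by
      intro c
      rw [← aeval_y]
      induction c using Polynomial.induction_on' with
      | add a b ha hb => rw [map_add]; exact hadd _ _ ha hb
      | monomial k c =>
        rw [Polynomial.aeval_monomial]
        refine hmul _ _ (hc c) ?_
        induction k with
        | zero => simpa using hc 1
        | succ k ih => rw [pow_succ]; exact hmul _ _ ih hy
    obtain ⟨q, rfl⟩ := AdjoinRoot.mk_surjective r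
    induction q using Polynomial.induction_on' with
    | add a b ha hb => rw [map_add, map_add]; exact hadd _ _ ha hb
    | monomial k c =>
      rw [← Polynomial.C_mul_X_pow_eq_monomial, map_mul, map_mul, AdjoinRoot.mk_C, map_pow, map_pow,
        AdjoinRoot.mk_X]
      refine hmul _ _ (hofc c) ?_
      induction k with
      | zero => simpa using hc 1
      | succ k ih => rw [pow_succ]; exact hmul _ _ ih hx
  obtain ⟨a, b, -, rfl⟩ := IsFractionRing.div_surjective (A := CoordinateRing K n) φ
  rw [div_eq_mul_inv]
  exact hmul _ _ (hA a) (hinv _ (hA b))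

/-! ### The cyclic automorphism -/

/-- The affine equation is invariant under the cyclic permutation of the homogeneous coordinates. -/
theorem rotated_equation :
    y K n / x K n * (1 / x K n) ^ n + 1 / x K n + (y K n / x K n) ^ n = 0 := by
  have hx := x_ne_zero (K := K) (n := n)
  have h := curve_equation (K := K) (n := n)
  have h2 : x K n ^ n ≠ 0 := pow_ne_zero _ hx
  rw [div_pow, div_pow, one_pow]
  field_simp
  linear_combination h

theorem rotated_injective [IsAlgClosed K] :
    Function.Injective
      (coordLift (K := K) (n := n) (y K n / x K n) (1 / x K n) rotated_equation) := by
  refine coordLift_injective _ _ _ fun c hc => ?_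
  apply x_ne_algebraMap (n := n) c⁻¹
  rw [map_inv₀, ← hc]
  simp

/-- The endomorphism `x ↦ y / x`, `y ↦ 1 / x` of the function field. -/
def rotateHom (K : Type*) [Field K] (n : ℕ) [Fact (2 < n)] [IsAlgClosed K] :
    FunctionField K n →ₐ[K] FunctionField K n :=
  IsFractionRing.liftAlgHom (A := CoordinateRing K n) rotated_injective

theorem rotateHom_x [IsAlgClosed K] : rotateHom K n (x K n) = y K n / x K n :=
  (IsFractionRing.lift_algebraMap (rotated_injective (K := K) (n := n)) _).trans
    (coordLift_root _ _ _)

theorem rotateHom_y [IsAlgClosed K] : rotateHom K n (y K n) = 1 / x K n :=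
  (IsFractionRing.lift_algebraMap (rotated_injective (K := K) (n := n)) _).trans
    ((coordLift_of _ _ _ _).trans (by simp))

/-- The automorphism of the function field induced by the cyclic permutation of the coordinates:
`x ↦ y / x`, `y ↦ 1 / x`. -/
def rotate (K : Type*) [Field K] (n : ℕ) [Fact (2 < n)] [IsAlgClosed K] :
    FunctionField K n ≃ₐ[K] FunctionField K n :=
  AlgEquiv.ofAlgHom (rotateHom K n) ((rotateHom K n).comp (rotateHom K n))
    (by
      have hx := x_ne_zero (K := K) (n := n)
      have hy := y_ne_zero (K := K) (n := n)
      apply functionField_algHom_ext <;>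
        simp [rotateHom_x, rotateHom_y, map_div₀] <;> field_simp)
    (by
      have hx := x_ne_zero (K := K) (n := n)
      have hy := y_ne_zero (K := K) (n := n)
      apply functionField_algHom_ext <;>
        simp [rotateHom_x, rotateHom_y, map_div₀] <;> field_simp)

theorem rotate_x [IsAlgClosed K] : rotate K n (x K n) = y K n / x K n := rotateHom_x

theorem rotate_y [IsAlgClosed K] : rotate K n (y K n) = 1 / x K n := rotateHom_y

end FunctionFieldBasics

/-! ### Local rings and the cyclic automorphism -/

section LocalRings

variable {K : Type*} [Field K] {n : ℕ}

/-- A form of degree `d` is multiplied by `r ^ d` when its arguments are multiplied by `r`. -/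
theorem aeval_mul_of_isHomogeneous {S : Type*} [CommRing S] [Algebra K S]
    {G : MvPolynomial (Fin 3) K} {d : ℕ} (hG : G.IsHomogeneous d) (r : S) (f : Fin 3 → S) :
    MvPolynomial.aeval (fun i => r * f i) G = r ^ d * MvPolynomial.aeval f G := by
  rw [MvPolynomial.aeval_def, MvPolynomial.aeval_def, MvPolynomial.eval₂_eq',
    MvPolynomial.eval₂_eq', Finset.mul_sum]
  refine Finset.sum_congr rfl fun e he => ?_
  have h1 : ∑ i, e i = d := by
    have := hG (MvPolynomial.mem_support_iff.1 he)
    rw [← this, Finsupp.weight_apply, Finsupp.sum_fintype _ _ (by simp)]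
    simp
  simp_rw [mul_pow]
  rw [Finset.prod_mul_distrib, Finset.prod_pow_eq_pow_sum, h1]
  ring

theorem eval_smul_of_isHomogeneous {G : MvPolynomial (Fin 3) K} {d : ℕ} (hG : G.IsHomogeneous d)
    (r : K) (f : Fin 3 → K) :
    MvPolynomial.eval (r • f) G = r ^ d * MvPolynomial.eval f G := by
  have h : MvPolynomial.eval (fun i => r * f i) G = r ^ d * MvPolynomial.eval f G := by
    simpa [MvPolynomial.aeval_def, MvPolynomial.eval₂_id, Algebra.algebraMap_self] using
      aeval_mul_of_isHomogeneous hG r f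
  exact h

/-- Nonvanishing of a form at a point does not depend on the representative of the point. -/
theorem eval_rep_ne_zero_iff {G : MvPolynomial (Fin 3) K} {d : ℕ} (hG : G.IsHomogeneous d)
    {v : Fin 3 → K} (hv : v ≠ 0) :
    MvPolynomial.eval (Projectivization.mk K v hv).rep G ≠ 0 ↔ MvPolynomial.eval v G ≠ 0 := by
  obtain ⟨c, hc⟩ := Projectivization.exists_smul_eq_mk_rep K v hv
  rw [← hc, Units.smul_def, eval_smul_of_isHomogeneous hG]
  simp

theorem form_isHomogeneous (K : Type*) [Field K] (n : ℕ) : (form K n).IsHomogeneous (n + 1) := by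
  have h := fun i : Fin 3 => MvPolynomial.isHomogeneous_X K i
  unfold form
  refine MvPolynomial.IsHomogeneous.add (MvPolynomial.IsHomogeneous.add ?_ ?_) ?_
  · have := (h 0).mul ((h 1).pow n)
    convert this using 1; ring
  · have := (h 1).mul ((h 2).pow n)
    convert this using 1; ring
  · have := ((h 0).pow n).mul (h 2)
    convert this using 1; ring

theorem mk_mem_curve_iff {v : Fin 3 → K} (hv : v ≠ 0) :
    Projectivization.mk K v hv ∈ curve K n ↔
      v 0 * v 1 ^ n + v 1 * v 2 ^ n + v 0 ^ n * v 2 = 0 := by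
  have := eval_rep_ne_zero_iff (form_isHomogeneous K n) hv
  rw [not_iff_not] at this
  refine this.trans ?_
  simp [form]

theorem mem_localRing_mk {v : Fin 3 → K} (hv : v ≠ 0) (φ : FunctionField K n) :
    φ ∈ localRing K n (Projectivization.mk K v hv) ↔
      ∃ (d : ℕ) (G H : MvPolynomial (Fin 3) K), G.IsHomogeneous d ∧
        H.IsHomogeneous d ∧ MvPolynomial.eval v H ≠ 0 ∧
        φ * MvPolynomial.aeval ![x K n, y K n, 1] H = MvPolynomial.aeval ![x K n, y K n, 1] G := by
  constructor
  · rintro ⟨d, G, H, hG, hH, h0, h⟩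
    exact ⟨d, G, H, hG, hH, (eval_rep_ne_zero_iff hH hv).1 h0, h⟩
  · rintro ⟨d, G, H, hG, hH, h0, h⟩
    exact ⟨d, G, H, hG, hH, (eval_rep_ne_zero_iff hH hv).2 h0, h⟩

section Rotation

variable [Fact (2 < n)] [IsAlgClosed K]

theorem rotate_rotate_rotate (φ : FunctionField K n) :
    rotate K n (rotate K n (rotate K n φ)) = φ :=
  (rotate K n).symm_apply_apply φ

theorem rotate_mem_localRing {a b c : K} (h : ![a, b, c] ≠ 0) (h' : ![c, a, b] ≠ 0)
    {φ : FunctionField K n} (hφ : φ ∈ localRing K n (Projectivization.mk K _ h)) :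
    rotate K n φ ∈ localRing K n (Projectivization.mk K _ h') := by
  rw [mem_localRing_mk] at hφ ⊢
  obtain ⟨d, G, H, hG, hH, h0, h⟩ := hφ
  have hx := x_ne_zero (K := K) (n := n)
  let s : Fin 3 → Fin 3 := ![1, 2, 0]
  have key : ∀ Q : MvPolynomial (Fin 3) K, Q.IsHomogeneous d →
      rotate K n (MvPolynomial.aeval ![x K n, y K n, 1] Q) =
        (1 / x K n) ^ d * MvPolynomial.aeval ![x K n, y K n, 1] (MvPolynomial.rename s Q) := by
    intro Q hQ
    rw [MvPolynomial.aeval_rename, ← aeval_mul_of_isHomogeneous hQ]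
    have := MvPolynomial.comp_aeval_apply ![x K n, y K n, 1]
      (rotate K n : FunctionField K n →ₐ[K] FunctionField K n) Q
    refine this.trans ?_
    congr 2
    ext i
    fin_cases i
    · simp [s, rotate_x, div_eq_inv_mul]
    · simp [s, rotate_y]
    · simp [s, hx]
  refine ⟨d, MvPolynomial.rename s G, MvPolynomial.rename s H, hG.rename_isHomogeneous,
    hH.rename_isHomogeneous, ?_, ?_⟩
  · rw [MvPolynomial.eval_rename]
    convert h0 using 3
    ext i; fin_cases i <;> simp [s]
  · have := congrArg (rotate K n) h
    rw [map_mul, key _ hH, key _ hG] at this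
    have hx' : (1 / x K n) ^ d ≠ 0 := pow_ne_zero _ (by simpa using hx)
    apply mul_left_cancel₀ hx'
    rw [← this]; ring

theorem rotate_mem_localRing_iff {a b c : K} (h : ![a, b, c] ≠ 0) (h' : ![c, a, b] ≠ 0)
    {φ : FunctionField K n} :
    rotate K n φ ∈ localRing K n (Projectivization.mk K _ h') ↔
      φ ∈ localRing K n (Projectivization.mk K _ h) := by
  refine ⟨fun hφ => ?_, rotate_mem_localRing h h'⟩
  have h'' : ![b, c, a] ≠ 0 := by
    intro h0
    apply h
    ext i
    fin_cases i
    · exact congrFun h0 2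
    · exact congrFun h0 0
    · exact congrFun h0 1
  have := rotate_mem_localRing h'' h (rotate_mem_localRing h' h'' hφ)
  rwa [rotate_rotate_rotate] at this

/-- The rotation of coordinates identifies the local rings at corresponding points. -/
def rotateLocalRing {a b c : K} (h : ![a, b, c] ≠ 0) (h' : ![c, a, b] ≠ 0) :
    localRing K n (Projectivization.mk K _ h) ≃+* localRing K n (Projectivization.mk K _ h') where
  toFun φ := ⟨rotate K n φ, rotate_mem_localRing h h' φ.2⟩
  invFun φ := ⟨(rotate K n).symm φ, (rotate_mem_localRing_iff h h').1 (by
    rw [AlgEquiv.apply_symm_apply]; exact φ.2)⟩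
  left_inv φ := by ext; simp
  right_inv φ := by ext; simp
  map_mul' φ ψ := by ext; simp
  map_add' φ ψ := by ext; simp

end Rotation

end LocalRings

/-! ### Local rings at affine points -/

section AffineLocalRings

variable {K : Type*} [Field K] {n : ℕ}

theorem affine_ne_zero (a b : K) : ![a, b, 1] ≠ 0 := fun h => one_ne_zero (congrFun h 2)

/-- The point `(a : b : 1)` of the projective plane. -/
def affinePoint (a b : K) : Plane K := Projectivization.mk K ![a, b, 1] (affine_ne_zero a b)

theorem affinePoint_mem_curve_iff {a b : K} :
    affinePoint a b ∈ curve K n ↔ a * b ^ n + b + a ^ n = 0 := by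
  rw [affinePoint, mk_mem_curve_iff]
  simp

theorem x_mem_localRing (a b : K) : x K n ∈ localRing K n (affinePoint a b) := by
  rw [affinePoint, mem_localRing_mk]
  exact ⟨1, MvPolynomial.X 0, MvPolynomial.X 2, MvPolynomial.isHomogeneous_X _ _,
    MvPolynomial.isHomogeneous_X _ _, by simp, by simp⟩

theorem y_mem_localRing (a b : K) : y K n ∈ localRing K n (affinePoint a b) := by
  rw [affinePoint, mem_localRing_mk]
  exact ⟨1, MvPolynomial.X 1, MvPolynomial.X 2, MvPolynomial.isHomogeneous_X _ _,
    MvPolynomial.isHomogeneous_X _ _, by simp, by simp⟩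

/-- Induction on the elements of the coordinate ring, which is generated by `x` and `y`. -/
theorem coordinateRing_induction {p : CoordinateRing K n → Prop}
    (hc : ∀ c : K, p (algebraMap K _ c)) (hx : p (AdjoinRoot.root _))
    (hy : p (AdjoinRoot.of _ Polynomial.X))
    (hadd : ∀ a b, p a → p b → p (a + b)) (hmul : ∀ a b, p a → p b → p (a * b))
    (r : CoordinateRing K n) : p r := by
  have hpow : ∀ r, p r → ∀ k : ℕ, p (r ^ k) := by
    intro r hr k
    induction k with
    | zero => simpa using hc 1
    | succ k ih => rw [pow_succ]; exact hmul _ _ ih hr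
  have hof : ∀ c : Polynomial K, p (AdjoinRoot.of (affineEquation K n) c) := by
    intro c
    induction c using Polynomial.induction_on' with
    | add a b ha hb => rw [map_add]; exact hadd _ _ ha hb
    | monomial k c =>
      rw [← Polynomial.C_mul_X_pow_eq_monomial, map_mul, map_pow]
      exact hmul _ _ (hc c) (hpow _ hy k)
  obtain ⟨q, rfl⟩ := AdjoinRoot.mk_surjective r
  induction q using Polynomial.induction_on' with
  | add a b ha hb => rw [map_add]; exact hadd _ _ ha hb
  | monomial k c =>
    rw [← Polynomial.C_mul_X_pow_eq_monomial, map_mul, AdjoinRoot.mk_C, map_pow, AdjoinRoot.mk_X]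
    exact hmul _ _ (hof c) (hpow _ hx k)

theorem algebraMap_mem_localRing (a b : K) (r : CoordinateRing K n) :
    algebraMap _ (FunctionField K n) r ∈ localRing K n (affinePoint a b) := by
  induction r using coordinateRing_induction with
  | hc c =>
    rw [← IsScalarTower.algebraMap_apply]
    exact algebraMap_mem _ c
  | hx => exact x_mem_localRing a b
  | hy => exact y_mem_localRing a b
  | hadd r s hr hs => rw [map_add]; exact add_mem hr hs
  | hmul r s hr hs => rw [map_mul]; exact mul_mem hr hs

/-- The value at the point `(a, b)` of the elements of the coordinate ring. -/
abbrev evalPoint {a b : K} (h : a * b ^ n + b + a ^ n = 0) : CoordinateRing K n →ₐ[K] K :=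
  coordLift a b h

theorem coordinateRing_algHom_ext {S : Type*} [CommRing S] [Algebra K S]
    {f g : CoordinateRing K n →ₐ[K] S}
    (hx : f (AdjoinRoot.root _) = g (AdjoinRoot.root _))
    (hy : f (AdjoinRoot.of _ Polynomial.X) = g (AdjoinRoot.of _ Polynomial.X)) : f = g := by
  ext
  · exact hy
  · exact hx

/-- The maximal ideal of an affine point. -/
theorem mem_ker_evalPoint {a b : K} (h : a * b ^ n + b + a ^ n = 0) :
    RingHom.ker (evalPoint (n := n) h) = Ideal.span
      {AdjoinRoot.root (affineEquation K n) - algebraMap K _ a,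
        AdjoinRoot.of (affineEquation K n) Polynomial.X - algebraMap K _ b} := by
  set I := Ideal.span
      {AdjoinRoot.root (affineEquation K n) - algebraMap K _ a,
        AdjoinRoot.of (affineEquation K n) Polynomial.X - algebraMap K _ b} with hI
  apply le_antisymm
  · intro r hr
    have h1 : Ideal.Quotient.mkₐ K I = (Algebra.ofId K _).comp (evalPoint (n := n) h) := by
      apply coordinateRing_algHom_ext
      · rw [AlgHom.comp_apply, coordLift_root]
        exact Ideal.Quotient.eq.2 (Ideal.subset_span (Set.mem_insert _ _))
      · rw [AlgHom.comp_apply, coordLift_of, Polynomial.aeval_X]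
        exact Ideal.Quotient.eq.2 (Ideal.subset_span (Set.mem_insert_of_mem _ rfl))
    have h2 := congrArg (fun f => f r) h1
    rw [← Ideal.Quotient.eq_zero_iff_mem]
    refine h2.trans ?_
    have h3 : evalPoint (n := n) h r = 0 := hr
    rw [AlgHom.comp_apply, h3, map_zero]
  · rw [hI, Ideal.span_le]
    rintro r (rfl | rfl)
    · simp [RingHom.mem_ker, coordLift_root]
    · simp [RingHom.mem_ker, coordLift_of]

theorem algebraMap_aeval (G : MvPolynomial (Fin 3) K) :
    algebraMap (CoordinateRing K n) (FunctionField K n)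
      (MvPolynomial.aeval ![AdjoinRoot.root _, AdjoinRoot.of _ Polynomial.X, 1] G)
      = MvPolynomial.aeval ![x K n, y K n, 1] G := by
  have := MvPolynomial.comp_aeval_apply
    ![AdjoinRoot.root (affineEquation K n), AdjoinRoot.of _ Polynomial.X, 1]
    (IsScalarTower.toAlgHom K (CoordinateRing K n) (FunctionField K n)) G
  refine this.trans ?_
  congr 2
  ext i
  fin_cases i
  · rfl
  · rfl
  · simp

theorem evalPoint_aeval {a b : K} (h : a * b ^ n + b + a ^ n = 0) (G : MvPolynomial (Fin 3) K) :
    evalPoint h (MvPolynomial.aeval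
      ![AdjoinRoot.root (affineEquation K n), AdjoinRoot.of _ Polynomial.X, 1] G)
      = MvPolynomial.eval ![a, b, 1] G := by
  refine (MvPolynomial.comp_aeval_apply _ _ G).trans ?_
  rw [MvPolynomial.aeval_eq_eval]
  congr 2
  ext i
  fin_cases i
  · simp [coordLift_root]
  · simp [coordLift_of]
  · simp

/-- Elements of the coordinate ring, as elements of the local ring. -/
def toLocalRing (a b : K) : CoordinateRing K n →+* localRing K n (affinePoint a b) :=
  (algebraMap (CoordinateRing K n) (FunctionField K n)).codRestrict _
    (algebraMap_mem_localRing a b)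

variable [Fact (2 < n)]

/-- The local ring at an affine point consists of the quotients of elements of the coordinate ring
with denominator not vanishing at the point. -/
theorem mem_localRing_affinePoint {a b : K} (h : a * b ^ n + b + a ^ n = 0)
    (φ : FunctionField K n) : φ ∈ localRing K n (affinePoint a b) ↔
      ∃ r s : CoordinateRing K n, evalPoint h s ≠ 0 ∧
        φ * algebraMap _ _ s = algebraMap _ _ r := by
  constructor
  · intro hφ
    rw [affinePoint, mem_localRing_mk] at hφ
    obtain ⟨d, G, H, hG, hH, h0, h1⟩ := hφ
    refine ⟨MvPolynomial.aeval ![AdjoinRoot.root _, AdjoinRoot.of _ Polynomial.X, 1] G,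
      MvPolynomial.aeval ![AdjoinRoot.root _, AdjoinRoot.of _ Polynomial.X, 1] H, ?_, ?_⟩
    · rw [evalPoint_aeval]; exact h0
    · rw [algebraMap_aeval, algebraMap_aeval, h1]
  · rintro ⟨r, s, hs, h1⟩
    have hs0 : s ≠ 0 := by rintro rfl; simp at hs
    have hs1 : algebraMap _ (FunctionField K n) s ≠ 0 := by simpa using hs0
    have h2 := algebraMap_mem_localRing a b s
    have h3 : (algebraMap _ (FunctionField K n) s)⁻¹ ∈ localRing K n (affinePoint a b) := by
      rw [affinePoint, mem_localRing_mk] at h2 ⊢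
      obtain ⟨d, G, H, hG, hH, h0, h4⟩ := h2
      refine ⟨d, H, G, hH, hG, ?_, ?_⟩
      · rw [← algebraMap_aeval, ← algebraMap_aeval, ← map_mul] at h4
        have h5 := congrArg (evalPoint h) (IsFractionRing.injective _ _ h4)
        rw [map_mul, evalPoint_aeval, evalPoint_aeval] at h5
        rw [← h5]
        exact mul_ne_zero hs h0
      · rw [← h4, inv_mul_cancel_left₀ hs1]
    have : φ = algebraMap _ (FunctionField K n) r * (algebraMap _ (FunctionField K n) s)⁻¹ := by
      rw [← h1, mul_inv_cancel_right₀ hs1]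
    rw [this]
    exact mul_mem (algebraMap_mem_localRing a b r) h3

theorem isLocalization_localRing {a b : K} (h : a * b ^ n + b + a ^ n = 0)
    [(RingHom.ker (evalPoint (n := n) h)).IsPrime] :
    letI := (toLocalRing (n := n) a b).toAlgebra
    IsLocalization.AtPrime (localRing K n (affinePoint a b))
      (RingHom.ker (evalPoint (n := n) h)) := by
  let := (toLocalRing (n := n) a b).toAlgebra
  refine ⟨?_, ?_, ?_⟩
  · rintro ⟨s, hs⟩
    have hs : evalPoint h s ≠ 0 := hs
    have hs0 : s ≠ 0 := by rintro rfl; simp at hs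
    have hs1 : algebraMap _ (FunctionField K n) s ≠ 0 := by simpa using hs0
    refine IsUnit.of_mul_eq_one ⟨(algebraMap _ (FunctionField K n) s)⁻¹,
      (mem_localRing_affinePoint h _).2 ⟨1, s, hs, ?_⟩⟩ ?_
    · rw [inv_mul_cancel₀ hs1, map_one]
    · ext
      exact mul_inv_cancel₀ hs1
  · rintro ⟨φ, hφ⟩
    obtain ⟨r, s, hs, h1⟩ := (mem_localRing_affinePoint h _).1 hφ
    exact ⟨⟨r, ⟨s, hs⟩⟩, Subtype.ext h1⟩
  · intro r s hrs
    refine ⟨1, ?_⟩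
    have := congrArg (Subtype.val) hrs
    simpa using IsFractionRing.injective _ (FunctionField K n) this

theorem isLocalRing_localRing {a b : K} (h : a * b ^ n + b + a ^ n = 0) :
    IsLocalRing (localRing K n (affinePoint a b)) := by
  have := RingHom.ker_isPrime (evalPoint (n := n) h)
  let := (toLocalRing (n := n) a b).toAlgebra
  have := isLocalization_localRing h
  exact IsLocalization.AtPrime.isLocalRing _ (RingHom.ker (evalPoint (n := n) h))

theorem isNoetherianRing_localRing {a b : K} (h : a * b ^ n + b + a ^ n = 0) :
    IsNoetherianRing (localRing K n (affinePoint a b)) := by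
  have := RingHom.ker_isPrime (evalPoint (n := n) h)
  let := (toLocalRing (n := n) a b).toAlgebra
  have := isLocalization_localRing h
  exact IsLocalization.isNoetherianRing (RingHom.ker (evalPoint (n := n) h)).primeCompl _
    inferInstance

theorem maximalIdeal_localRing {a b : K} (h : a * b ^ n + b + a ^ n = 0)
    [IsLocalRing (localRing K n (affinePoint a b))] :
    IsLocalRing.maximalIdeal (localRing K n (affinePoint a b)) = Ideal.span
      {⟨x K n - algebraMap K _ a, sub_mem (x_mem_localRing a b) (algebraMap_mem _ a)⟩,
        ⟨y K n - algebraMap K _ b, sub_mem (y_mem_localRing a b) (algebraMap_mem _ b)⟩} := by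
  have := RingHom.ker_isPrime (evalPoint (n := n) h)
  let := (toLocalRing (n := n) a b).toAlgebra
  have := isLocalization_localRing h
  have := IsLocalization.AtPrime.map_eq_maximalIdeal (RingHom.ker (evalPoint (n := n) h))
    (localRing K n (affinePoint a b))
  rw [← this, mem_ker_evalPoint h, Ideal.map_span, Set.image_pair]
  congr 2
  · exact Subtype.ext (map_sub _ _ _)
  · exact congrArg _ (Subtype.ext (map_sub _ _ _))

theorem isUnit_toLocalRing_iff {a b : K} (h : a * b ^ n + b + a ^ n = 0) (r : CoordinateRing K n) :
    IsUnit (toLocalRing a b r) ↔ evalPoint h r ≠ 0 := by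
  have := RingHom.ker_isPrime (evalPoint (n := n) h)
  let := (toLocalRing (n := n) a b).toAlgebra
  have := isLocalization_localRing h
  exact IsLocalization.AtPrime.isUnit_to_map_iff _ (RingHom.ker (evalPoint (n := n) h)) r

end AffineLocalRings

/-! ### Regular points -/

section RegularPoints

variable {K : Type*} [Field K] {n : ℕ}

/-- The affine part of the curve is smooth. -/
theorem partial_ne_zero [Fact (2 < n)] (hN : (n : K) ^ 2 - n + 1 ≠ 0) {a b : K}
    (h : a * b ^ n + b + a ^ n = 0) :
    b ^ n + n * a ^ (n - 1) ≠ 0 ∨ 1 + n * a * b ^ (n - 1) ≠ 0 := by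
  have hn : 2 < n := Fact.out
  by_contra! hc
  obtain ⟨h1, h2⟩ := hc
  have ha : a * a ^ (n - 1) = a ^ n := mul_pow_sub_one (by omega) a
  have hb : b * b ^ (n - 1) = b ^ n := mul_pow_sub_one (by omega) b
  have h3 : ((n : K) ^ 2 - n + 1) * a ^ n = 0 := by
    linear_combination h - b * h2 + n * a * hb - (1 - (n : K)) * a * h1 + (1 - (n : K)) * n * ha
  rcases mul_eq_zero.1 h3 with h4 | h4
  · exact hN h4
  · have : a = 0 := pow_eq_zero_iff (by omega) |>.1 h4
    rw [this] at h2
    simp at h2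

/-- The divided difference form of the affine equation at a point `(a, b)` of the curve: its
coefficients are functions whose values at the point are the two partial derivatives. -/
theorem divided_difference {a b : K} (h : a * b ^ n + b + a ^ n = 0) :
    ∃ U V : CoordinateRing K n,
      (AdjoinRoot.root _ - algebraMap K _ a) * U
        + (AdjoinRoot.of _ Polynomial.X - algebraMap K _ b) * V = 0 ∧
      evalPoint h U = b ^ n + n * a ^ (n - 1) ∧
      evalPoint h V = 1 + n * a * b ^ (n - 1) := by
  set X := AdjoinRoot.root (affineEquation K n) with hX
  set Y := AdjoinRoot.of (affineEquation K n) Polynomial.X with hY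
  have hXY : X * Y ^ n + Y + X ^ n = 0 := by
    have h : AdjoinRoot.mk (affineEquation K n) (Polynomial.X * Polynomial.C Polynomial.X ^ n
      + Polynomial.C Polynomial.X + Polynomial.X ^ n) = 0 := AdjoinRoot.mk_self
    rw [map_add, map_add, map_mul, map_pow, map_pow, AdjoinRoot.mk_C, AdjoinRoot.mk_X] at h
    exact h
  have hab := congrArg (algebraMap K (CoordinateRing K n)) h
  simp only [map_add, map_mul, map_pow, map_zero] at hab
  have gx := geom_sum₂_mul X (algebraMap K _ a) n
  have gy := geom_sum₂_mul Y (algebraMap K _ b) n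
  have eX : evalPoint h X = a := coordLift_root _ _ _
  have eY : evalPoint h Y = b := by rw [hY, coordLift_of, Polynomial.aeval_X]
  have geom : ∀ c : K, ∑ i ∈ Finset.range n, c ^ i * c ^ (n - 1 - i) = n * c ^ (n - 1) := by
    intro c
    rw [Finset.sum_congr rfl (g := fun _ => c ^ (n - 1)), Finset.sum_const, Finset.card_range,
      nsmul_eq_mul]
    intro i hi
    rw [← pow_add]
    congr 1
    have := Finset.mem_range.1 hi
    omega
  refine ⟨Y ^ n + ∑ i ∈ Finset.range n, X ^ i * (algebraMap K _ a) ^ (n - 1 - i),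
    1 + algebraMap K _ a * ∑ i ∈ Finset.range n, Y ^ i * (algebraMap K _ b) ^ (n - 1 - i),
    ?_, ?_, ?_⟩
  · linear_combination hXY - hab + gx + algebraMap K _ a * gy
  · simp only [map_add, map_pow, map_sum, map_mul, eX, eY, AlgHom.commutes, Algebra.algebraMap_self,
      RingHom.id_apply, geom]
  · simp only [map_add, map_pow, map_sum, map_mul, map_one, eY, AlgHom.commutes,
      Algebra.algebraMap_self, RingHom.id_apply, geom]
    ring

theorem divided_difference_functionField {a b : K} {U V : CoordinateRing K n}
    (h : (AdjoinRoot.root _ - algebraMap K _ a) * U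
      + (AdjoinRoot.of _ Polynomial.X - algebraMap K _ b) * V = 0) :
    (x K n - algebraMap K _ a) * algebraMap _ (FunctionField K n) U
      + (y K n - algebraMap K _ b) * algebraMap _ (FunctionField K n) V = 0 := by
  have h1 := congrArg (algebraMap _ (FunctionField K n)) h
  rw [map_add, map_mul, map_mul, map_sub, map_sub, map_zero, ← IsScalarTower.algebraMap_apply,
    ← IsScalarTower.algebraMap_apply] at h1
  exact h1

/-- Differentiating the affine equation. -/
theorem derivation_relation {M : Type*} [AddCommGroup M] [Module K M] [Module (FunctionField K n) M]
    [IsScalarTower K (FunctionField K n) M] (D : Derivation K (FunctionField K n) M) :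
    (y K n ^ n + n * x K n ^ (n - 1)) • D (x K n)
      + (1 + n * x K n * y K n ^ (n - 1)) • D (y K n) = 0 := by
  have h := congrArg D (curve_equation (K := K) (n := n))
  rw [map_zero, map_add, map_add, D.leibniz, D.leibniz_pow, D.leibniz_pow] at h
  rw [← h]
  simp only [← Nat.cast_smul_eq_nsmul (FunctionField K n), smul_smul, add_smul, one_smul]
  rw [show (n : FunctionField K n) * x K n * y K n ^ (n - 1)
    = x K n * (n * y K n ^ (n - 1)) by ring]
  abel

theorem exists_partials {a b : K} (h : a * b ^ n + b + a ^ n = 0) :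
    ∃ U V : CoordinateRing K n,
      algebraMap _ (FunctionField K n) U = y K n ^ n + n * x K n ^ (n - 1) ∧
      algebraMap _ (FunctionField K n) V = 1 + n * x K n * y K n ^ (n - 1) ∧
      evalPoint h U = b ^ n + n * a ^ (n - 1) ∧
      evalPoint h V = 1 + n * a * b ^ (n - 1) := by
  set X := AdjoinRoot.root (affineEquation K n) with hX
  set Y := AdjoinRoot.of (affineEquation K n) Polynomial.X with hY
  have eX : evalPoint h X = a := coordLift_root _ _ _
  have eY : evalPoint h Y = b := by rw [hY, coordLift_of, Polynomial.aeval_X]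
  refine ⟨Y ^ n + n * X ^ (n - 1), 1 + n * X * Y ^ (n - 1), ?_, ?_, ?_, ?_⟩
  · simp [hX, hY, x, y]
  · simp [hX, hY, x, y]
  · simp only [map_add, map_mul, map_pow, map_natCast, eX, eY]
  · simp only [map_add, map_mul, map_pow, map_natCast, eX, eY, map_one]

variable [Fact (2 < n)]

theorem inv_mem_localRing {a b : K} (h : a * b ^ n + b + a ^ n = 0) {s : CoordinateRing K n}
    (hs : evalPoint h s ≠ 0) :
    (algebraMap _ (FunctionField K n) s)⁻¹ ∈ localRing K n (affinePoint a b) := by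
  have hs0 : s ≠ 0 := by rintro rfl; simp at hs
  have hs1 : algebraMap _ (FunctionField K n) s ≠ 0 := by simpa using hs0
  exact (mem_localRing_affinePoint h _).2 ⟨1, s, hs, by rw [inv_mul_cancel₀ hs1, map_one]⟩

/-- The point `P` is regular, with local parameter `t`: the local ring is a discrete valuation ring
with fraction field the function field, `t` is a uniformizer, and every derivation of the function
field is, up to the factor `D t`, a derivation of the local ring. -/
structure IsRegularPoint (P : Plane K) (t : FunctionField K n) : Prop where
  dvr : IsDiscreteValuationRing (localRing K n P)
  mem_or_inv_mem : ∀ φ : FunctionField K n, φ ∈ localRing K n P ∨ φ⁻¹ ∈ localRing K n P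
  isLocalParameter : IsLocalParameter P t
  derivation : ∀ (D : Derivation K (FunctionField K n) (FunctionField K n)),
    ∀ φ ∈ localRing K n P, ∃ c ∈ localRing K n P, D φ = c * D t

theorem isRegularPoint_of_maximalIdeal {a b : K} (h : a * b ^ n + b + a ^ n = 0)
    [IsLocalRing (localRing K n (affinePoint a b))]
    (t : localRing K n (affinePoint a b)) (ht0 : t ≠ 0)
    (ht : IsLocalRing.maximalIdeal (localRing K n (affinePoint a b)) = Ideal.span {t})
    (hx : ∀ D : Derivation K (FunctionField K n) (FunctionField K n),
      ∃ c ∈ localRing K n (affinePoint a b), D (x K n) = c * D t)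
    (hy : ∀ D : Derivation K (FunctionField K n) (FunctionField K n),
      ∃ c ∈ localRing K n (affinePoint a b), D (y K n) = c * D t) :
    IsRegularPoint (affinePoint a b) (t : FunctionField K n) := by
  have := isNoetherianRing_localRing h
  have hirr := IsDiscreteValuationRing.irreducible_of_span_eq_maximalIdeal t ht0 ht
  have hf : ¬ IsField (localRing K n (affinePoint a b)) := by
    rw [IsLocalRing.isField_iff_maximalIdeal_eq, ht, Ideal.span_singleton_eq_bot]
    exact ht0
  have hpr : (IsLocalRing.maximalIdeal (localRing K n (affinePoint a b))).IsPrincipal := ⟨t, ht⟩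
  have hdvr : IsDiscreteValuationRing (localRing K n (affinePoint a b)) :=
    ((IsDiscreteValuationRing.TFAE _ hf).out 4 0).1 hpr
  refine ⟨hdvr, ?_, ⟨t.2, hirr⟩, ?_⟩
  · intro φ
    obtain ⟨r, s, hs, rfl⟩ := IsFractionRing.div_surjective (A := CoordinateRing K n) φ
    have hs1 : algebraMap _ (FunctionField K n) s ≠ 0 := by
      simpa using nonZeroDivisors.ne_zero hs
    obtain ⟨c, hc⟩ := ValuationRing.cond (toLocalRing a b r) (toLocalRing a b s)
    rcases hc with hc | hc
    · right
      have hc := congrArg Subtype.val hc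
      have hc : algebraMap _ (FunctionField K n) r * c = algebraMap _ _ s := hc
      by_cases hr : algebraMap _ (FunctionField K n) r = 0
      · rw [hr]; simp
      · rw [inv_div, ← hc, mul_div_cancel_left₀ _ hr]; exact c.2
    · left
      have hc := congrArg Subtype.val hc
      have hc : algebraMap _ (FunctionField K n) s * c = algebraMap _ _ r := hc
      rw [← hc, mul_div_cancel_left₀ _ hs1]; exact c.2
  · intro D φ hφ
    have hA : ∀ r : CoordinateRing K n, ∃ c ∈ localRing K n (affinePoint a b),
        D (algebraMap _ _ r) = c * D t := by
      intro r
      induction r using coordinateRing_induction with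
      | hc c =>
        refine ⟨0, zero_mem _, ?_⟩
        rw [← IsScalarTower.algebraMap_apply, D.map_algebraMap, zero_mul]
      | hx => exact hx D
      | hy => exact hy D
      | hadd r s hr hs =>
        obtain ⟨c, hc, hc'⟩ := hr
        obtain ⟨d, hd, hd'⟩ := hs
        refine ⟨c + d, add_mem hc hd, ?_⟩
        rw [map_add, map_add, hc', hd', add_mul]
      | hmul r s hr hs =>
        obtain ⟨c, hc, hc'⟩ := hr
        obtain ⟨d, hd, hd'⟩ := hs
        refine ⟨algebraMap _ _ r * d + algebraMap _ _ s * c,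
          add_mem (mul_mem (algebraMap_mem_localRing a b r) hd)
            (mul_mem (algebraMap_mem_localRing a b s) hc), ?_⟩
        rw [map_mul, D.leibniz, hc', hd', smul_eq_mul, smul_eq_mul]
        ring
    obtain ⟨r, s, hs, h1⟩ := (mem_localRing_affinePoint h φ).1 hφ
    have hs0 : s ≠ 0 := by rintro rfl; simp at hs
    have hs1 : algebraMap _ (FunctionField K n) s ≠ 0 := by simpa using hs0
    have hs2 := inv_mem_localRing h hs
    obtain ⟨c, hc, hc'⟩ := hA r
    obtain ⟨d, hd, hd'⟩ := hA s
    refine ⟨(c - φ * d) * (algebraMap _ (FunctionField K n) s)⁻¹,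
      mul_mem (sub_mem hc (mul_mem hφ hd)) hs2, ?_⟩
    have h2 := congrArg D h1
    rw [D.leibniz, smul_eq_mul, smul_eq_mul, hc', hd'] at h2
    field_simp
    linear_combination h2

/-- Where the derivative of the equation with respect to `y` is not zero, `x - a` is a local
parameter. -/
theorem isRegularPoint_x {a b : K} (h : a * b ^ n + b + a ^ n = 0)
    (hfy : 1 + n * a * b ^ (n - 1) ≠ 0) :
    IsRegularPoint (n := n) (affinePoint a b) (x K n - algebraMap K _ a) := by
  have := isLocalRing_localRing (n := n) h
  obtain ⟨U, V, hUV, -, hV⟩ := divided_difference (n := n) h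
  refine isRegularPoint_of_maximalIdeal h
    ⟨x K n - algebraMap K _ a, sub_mem (x_mem_localRing a b) (algebraMap_mem _ a)⟩ ?_ ?_ ?_ ?_
  · intro h0
    exact x_ne_algebraMap a (sub_eq_zero.1 (congrArg Subtype.val h0))
  · rw [maximalIdeal_localRing h]
    apply le_antisymm
    · rw [Ideal.span_le]
      rintro r (rfl | rfl)
      · exact Ideal.mem_span_singleton_self _
      · have hu : IsUnit (toLocalRing a b V) := by
          rw [isUnit_toLocalRing_iff h, hV]; exact hfy
        have h1 := divided_difference_functionField hUV
        rw [SetLike.mem_coe, ← Ideal.mul_unit_mem_iff_mem _ hu, Ideal.mem_span_singleton]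
        refine ⟨- toLocalRing a b U, Subtype.ext ?_⟩
        change (y K n - algebraMap K _ b) * algebraMap _ _ V
          = (x K n - algebraMap K _ a) * -(algebraMap _ _ U)
        linear_combination h1
    · exact Ideal.span_mono (by simp)
  · intro D
    exact ⟨1, one_mem _, by simp⟩
  · intro D
    have hrel := derivation_relation D
    obtain ⟨S, T, hS, hT, -, hT'⟩ := exists_partials (n := n) h
    have hT0 : evalPoint h T ≠ 0 := by rw [hT']; exact hfy
    have hT1 : algebraMap _ (FunctionField K n) T ≠ 0 := by
      intro h0
      rw [FaithfulSMul.algebraMap_eq_zero_iff] at h0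
      rw [h0] at hT0
      simp at hT0
    rw [smul_eq_mul, smul_eq_mul, ← hS, ← hT] at hrel
    refine ⟨- (algebraMap _ _ S * (algebraMap _ _ T)⁻¹),
      neg_mem (mul_mem (algebraMap_mem_localRing a b S) (inv_mem_localRing h hT0)), ?_⟩
    rw [map_sub, D.map_algebraMap, sub_zero]
    field_simp
    linear_combination hrel

/-- Where the derivative of the equation with respect to `x` is not zero, `y - b` is a local
parameter. -/
theorem isRegularPoint_y {a b : K} (h : a * b ^ n + b + a ^ n = 0)
    (hfx : b ^ n + n * a ^ (n - 1) ≠ 0) :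
    IsRegularPoint (n := n) (affinePoint a b) (y K n - algebraMap K _ b) := by
  have := isLocalRing_localRing (n := n) h
  obtain ⟨U, V, hUV, hU, -⟩ := divided_difference (n := n) h
  refine isRegularPoint_of_maximalIdeal h
    ⟨y K n - algebraMap K _ b, sub_mem (y_mem_localRing a b) (algebraMap_mem _ b)⟩ ?_ ?_ ?_ ?_
  · intro h0
    exact y_ne_algebraMap b (sub_eq_zero.1 (congrArg Subtype.val h0))
  · rw [maximalIdeal_localRing h]
    apply le_antisymm
    · rw [Ideal.span_le]
      rintro r (rfl | rfl)
      · have hu : IsUnit (toLocalRing a b U) := by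
          rw [isUnit_toLocalRing_iff h, hU]; exact hfx
        have h1 := divided_difference_functionField hUV
        rw [SetLike.mem_coe, ← Ideal.mul_unit_mem_iff_mem _ hu, Ideal.mem_span_singleton]
        refine ⟨- toLocalRing a b V, Subtype.ext ?_⟩
        change (x K n - algebraMap K _ a) * algebraMap _ _ U
          = (y K n - algebraMap K _ b) * -(algebraMap _ _ V)
        linear_combination h1
      · exact Ideal.mem_span_singleton_self _
    · exact Ideal.span_mono (by simp)
  · intro D
    have hrel := derivation_relation D
    obtain ⟨S, T, hS, hT, hS', -⟩ := exists_partials (n := n) h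
    have hS0 : evalPoint h S ≠ 0 := by rw [hS']; exact hfx
    have hS1 : algebraMap _ (FunctionField K n) S ≠ 0 := by
      intro h0
      rw [FaithfulSMul.algebraMap_eq_zero_iff] at h0
      rw [h0] at hS0
      simp at hS0
    rw [smul_eq_mul, smul_eq_mul, ← hS, ← hT] at hrel
    refine ⟨- (algebraMap _ _ T * (algebraMap _ _ S)⁻¹),
      neg_mem (mul_mem (algebraMap_mem_localRing a b T) (inv_mem_localRing h hS0)), ?_⟩
    rw [map_sub, D.map_algebraMap, sub_zero]
    field_simp
    linear_combination hrel
  · intro D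
    exact ⟨1, one_mem _, by simp⟩

theorem exists_isRegularPoint_affinePoint (hN : (n : K) ^ 2 - n + 1 ≠ 0) {a b : K}
    (h : a * b ^ n + b + a ^ n = 0) :
    ∃ t : FunctionField K n, IsRegularPoint (affinePoint a b) t := by
  rcases partial_ne_zero hN h with h1 | h1
  · exact ⟨_, isRegularPoint_y h h1⟩
  · exact ⟨_, isRegularPoint_x h h1⟩

/-- The rotation of coordinates maps regular points to regular points. -/
theorem IsRegularPoint.rotate [IsAlgClosed K] {a b c : K} (h : ![a, b, c] ≠ 0)
    (h' : ![c, a, b] ≠ 0) {t : FunctionField K n}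
    (H : IsRegularPoint (Projectivization.mk K _ h) t) :
    IsRegularPoint (Projectivization.mk K _ h') (rotate K n t) := by
  have := H.dvr
  refine ⟨IsDiscreteValuationRing.RingEquivClass.isDiscreteValuationRing
    (rotateLocalRing (n := n) h h'), ?_, ?_, ?_⟩
  · intro φ
    obtain ⟨ψ, rfl⟩ := (Hurwitz.rotate K n).surjective φ
    rw [← map_inv₀, rotate_mem_localRing_iff h h', rotate_mem_localRing_iff h h']
    exact H.mem_or_inv_mem ψ
  · obtain ⟨h1, h2⟩ := H.isLocalParameter
    refine ⟨rotate_mem_localRing h h' h1, ?_⟩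
    have h3 : Irreducible (rotateLocalRing h h' ⟨t, h1⟩) :=
      (MulEquiv.irreducible_iff (rotateLocalRing h h')).2 h2
    exact h3
  · intro D φ hφ
    obtain ⟨ψ, rfl⟩ := (Hurwitz.rotate K n).surjective φ
    rw [rotate_mem_localRing_iff h h'] at hφ
    let D' : Derivation K (FunctionField K n) (FunctionField K n) :=
      Derivation.mk' (((Hurwitz.rotate K n).symm.toLinearMap ∘ₗ D.toLinearMap) ∘ₗ
        (Hurwitz.rotate K n).toLinearMap) (by
          intro u v
          simp [D.leibniz])
    obtain ⟨c, hc, hc'⟩ := H.derivation D' ψ hφ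
    refine ⟨Hurwitz.rotate K n c, rotate_mem_localRing h h' hc, ?_⟩
    have hD' : ∀ u, D' u = (Hurwitz.rotate K n).symm (D (Hurwitz.rotate K n u)) := fun _ => rfl
    rw [hD', hD'] at hc'
    have := congrArg (Hurwitz.rotate K n) hc'
    rwa [map_mul, AlgEquiv.apply_symm_apply, AlgEquiv.apply_symm_apply] at this

end RegularPoints

/-! ### Orders of functions -/

section Orders

variable {K : Type*} [Field K] {n : ℕ} [Fact (2 < n)] {P : Plane K} {t : FunctionField K n}

theorem HasOrder.ne_zero {φ : FunctionField K n} {m : ℤ}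
    (h : HasOrder P φ m) : φ ≠ 0 := by
  obtain ⟨s, u, ⟨hs, hirr⟩, hu, -, -, rfl⟩ := h
  refine mul_ne_zero hu (zpow_ne_zero _ ?_)
  rintro rfl
  exact hirr.ne_zero rfl

/-- Units of the local ring, as elements of the function field. -/
theorem hasOrder_zero_iff (H : IsRegularPoint P t) {φ : FunctionField K n} :
    HasOrder P φ 0 ↔ φ ≠ 0 ∧ φ ∈ localRing K n P ∧ φ⁻¹ ∈ localRing K n P := by
  constructor
  · rintro ⟨s, u, -, hu, hu1, hu2, rfl⟩
    simpa using ⟨hu, hu1, hu2⟩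
  · rintro ⟨h1, h2, h3⟩
    exact ⟨t, φ, H.isLocalParameter, h1, h2, h3, by simp⟩

/-- The order may be computed with any given local parameter. -/
theorem IsRegularPoint.hasOrder_iff (H : IsRegularPoint P t) {φ : FunctionField K n} {m : ℤ} :
    HasOrder P φ m ↔ ∃ u, HasOrder P u 0 ∧ φ = u * t ^ m := by
  have := H.dvr
  constructor
  · rintro ⟨s, u, ⟨hs, hirr⟩, hu, hu1, hu2, rfl⟩
    obtain ⟨ht, htirr⟩ := H.isLocalParameter
    obtain ⟨e, he⟩ := IsDiscreteValuationRing.associated_of_irreducible _ htirr hirr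
    have he' : t * ((e : localRing K n P) : FunctionField K n) = s := congrArg Subtype.val he
    have hee : ((e : localRing K n P) : FunctionField K n) *
        ((e⁻¹ : (localRing K n P)ˣ) : localRing K n P) = 1 := congrArg Subtype.val e.mul_inv
    have he0 : HasOrder P ((e : localRing K n P) : FunctionField K n) 0 := by
      rw [hasOrder_zero_iff H]
      refine ⟨left_ne_zero_of_mul_eq_one hee, (e : localRing K n P).2, ?_⟩
      rw [inv_eq_of_mul_eq_one_right hee]
      exact ((e⁻¹ : (localRing K n P)ˣ) : localRing K n P).2
    refine ⟨u * ((e : localRing K n P) : FunctionField K n) ^ m, ?_, ?_⟩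
    · rw [hasOrder_zero_iff H] at he0 ⊢
      refine ⟨mul_ne_zero hu (zpow_ne_zero _ he0.1), ?_, ?_⟩
      · refine mul_mem hu1 ?_
        obtain ⟨k, rfl | rfl⟩ := m.eq_nat_or_neg
        · rw [zpow_natCast]; exact pow_mem he0.2.1 k
        · rw [zpow_neg, zpow_natCast, ← inv_pow]; exact pow_mem he0.2.2 k
      · rw [mul_inv]
        refine mul_mem hu2 ?_
        obtain ⟨k, rfl | rfl⟩ := m.eq_nat_or_neg
        · rw [zpow_natCast, ← inv_pow]; exact pow_mem he0.2.2 k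
        · rw [zpow_neg, zpow_natCast, inv_inv]; exact pow_mem he0.2.1 k
    · rw [← he', mul_zpow]; ring
  · rintro ⟨u, hu, rfl⟩
    obtain ⟨h1, h2, h3⟩ := (hasOrder_zero_iff H).1 hu
    exact ⟨t, u, H.isLocalParameter, h1, h2, h3, rfl⟩

theorem IsRegularPoint.ne_zero (H : IsRegularPoint P t) : t ≠ 0 := by
  obtain ⟨ht, htirr⟩ := H.isLocalParameter
  rintro rfl
  exact htirr.ne_zero rfl

theorem HasOrder.mul (H : IsRegularPoint P t) {φ ψ : FunctionField K n} {k m : ℤ}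
    (h : HasOrder P φ k) (h' : HasOrder P ψ m) : HasOrder P (φ * ψ) (k + m) := by
  obtain ⟨u, hu, rfl⟩ := H.hasOrder_iff.1 h
  obtain ⟨v, hv, rfl⟩ := H.hasOrder_iff.1 h'
  refine H.hasOrder_iff.2 ⟨u * v, ?_, ?_⟩
  · rw [hasOrder_zero_iff H] at hu hv ⊢
    refine ⟨mul_ne_zero hu.1 hv.1, mul_mem hu.2.1 hv.2.1, ?_⟩
    rw [mul_inv]; exact mul_mem hu.2.2 hv.2.2
  · rw [zpow_add₀ H.ne_zero]; ring

theorem HasOrder.inv (H : IsRegularPoint P t) {φ : FunctionField K n} {k : ℤ}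
    (h : HasOrder P φ k) : HasOrder P φ⁻¹ (-k) := by
  obtain ⟨u, hu, rfl⟩ := H.hasOrder_iff.1 h
  refine H.hasOrder_iff.2 ⟨u⁻¹, ?_, ?_⟩
  · rw [hasOrder_zero_iff H] at hu ⊢
    refine ⟨inv_ne_zero hu.1, hu.2.2, ?_⟩
    rw [inv_inv]; exact hu.2.1
  · rw [zpow_neg, mul_inv]

theorem hasOrder_algebraMap (H : IsRegularPoint P t) {c : K} (hc : c ≠ 0) :
    HasOrder P (algebraMap K (FunctionField K n) c) 0 := by
  rw [hasOrder_zero_iff H]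
  refine ⟨by simpa using hc, algebraMap_mem _ c, ?_⟩
  rw [← map_inv₀]; exact algebraMap_mem _ _

theorem HasOrder.pow (H : IsRegularPoint P t) {φ : FunctionField K n} {k : ℤ}
    (h : HasOrder P φ k) (j : ℕ) : HasOrder P (φ ^ j) (j * k) := by
  induction j with
  | zero => simpa using hasOrder_algebraMap H one_ne_zero
  | succ j ih =>
    rw [pow_succ]
    convert HasOrder.mul H ih h using 1
    push_cast; ring

theorem HasOrder.div (H : IsRegularPoint P t) {φ ψ : FunctionField K n} {k m : ℤ}
    (h : HasOrder P φ k) (h' : HasOrder P ψ m) : HasOrder P (φ / ψ) (k - m) := by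
  rw [div_eq_mul_inv, sub_eq_add_neg]
  exact HasOrder.mul H h (HasOrder.inv H h')

theorem HasOrder.neg (H : IsRegularPoint P t) {φ : FunctionField K n} {k : ℤ}
    (h : HasOrder P φ k) : HasOrder P (-φ) k := by
  have h1 := HasOrder.mul H (hasOrder_algebraMap H (neg_ne_zero.2 (one_ne_zero (α := K)))) h
  simpa using h1

theorem HasOrder.mem_localRing (H : IsRegularPoint P t) {φ : FunctionField K n} {k : ℤ}
    (h : HasOrder P φ k) (hk : 0 ≤ k) : φ ∈ localRing K n P := by
  obtain ⟨u, hu, rfl⟩ := H.hasOrder_iff.1 h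
  rw [hasOrder_zero_iff H] at hu
  obtain ⟨j, rfl⟩ := Int.eq_ofNat_of_zero_le hk
  obtain ⟨ht, -⟩ := H.isLocalParameter
  rw [zpow_natCast]
  exact mul_mem hu.2.1 (pow_mem ht j)

theorem HasOrder.nonneg (H : IsRegularPoint P t) {φ : FunctionField K n} {k : ℤ}
    (h : HasOrder P φ k) (hφ : φ ∈ localRing K n P) : 0 ≤ k := by
  by_contra! hk
  obtain ⟨u, hu, rfl⟩ := H.hasOrder_iff.1 h
  rw [hasOrder_zero_iff H] at hu
  obtain ⟨j, hj⟩ : ∃ j : ℕ, -k = j + 1 := ⟨(-k - 1).toNat, by omega⟩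
  obtain ⟨ht, htirr⟩ := H.isLocalParameter
  have ht0 := H.ne_zero
  apply htirr.not_isUnit
  refine IsUnit.of_mul_eq_one ⟨(u * t ^ k) * u⁻¹ * t ^ j, mul_mem (mul_mem hφ hu.2.2)
    (pow_mem ht j)⟩ (Subtype.ext ?_)
  change t * ((u * t ^ k) * u⁻¹ * t ^ j) = 1
  have : k = -((j : ℤ) + 1) := by omega
  have hu0 := hu.1
  rw [this, zpow_neg, zpow_add₀ ht0, zpow_one, zpow_natCast]
  field_simp

theorem HasOrder.unique (H : IsRegularPoint P t) {φ : FunctionField K n} {k m : ℤ}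
    (h : HasOrder P φ k) (h' : HasOrder P φ m) : k = m := by
  have h1 := HasOrder.div H h h'
  have h2 := HasOrder.div H h' h
  rw [div_self (h.ne_zero)] at h1 h2
  have := HasOrder.nonneg H h1 (one_mem _)
  have := HasOrder.nonneg H h2 (one_mem _)
  omega

theorem HasOrder.order_eq (H : IsRegularPoint P t) {φ : FunctionField K n} {k : ℤ}
    (h : HasOrder P φ k) : order P φ = k := by
  have hex : ∃ m, HasOrder P φ m := ⟨k, h⟩
  rw [order, dif_pos hex]
  exact HasOrder.unique H hex.choose_spec h

theorem exists_hasOrder (H : IsRegularPoint P t) {φ : FunctionField K n} (hφ : φ ≠ 0) :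
    ∃ m, HasOrder P φ m := by
  have := H.dvr
  have key : ∀ ψ : FunctionField K n, ψ ≠ 0 → ψ ∈ localRing K n P → ∃ m, HasOrder P ψ m := by
    intro ψ hψ hmem
    obtain ⟨ht, htirr⟩ := H.isLocalParameter
    have h0 : (⟨ψ, hmem⟩ : localRing K n P) ≠ 0 := fun h => hψ (congrArg Subtype.val h)
    obtain ⟨j, e, he⟩ := IsDiscreteValuationRing.eq_unit_mul_pow_irreducible h0 htirr
    have hee : ((e : localRing K n P) : FunctionField K n) *
        ((e⁻¹ : (localRing K n P)ˣ) : localRing K n P) = 1 := congrArg Subtype.val e.mul_inv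
    have he' : ψ = ((e : localRing K n P) : FunctionField K n) * t ^ j := congrArg Subtype.val he
    refine ⟨j, H.hasOrder_iff.2 ⟨(e : localRing K n P), ?_, ?_⟩⟩
    · rw [hasOrder_zero_iff H]
      refine ⟨left_ne_zero_of_mul_eq_one hee, (e : localRing K n P).2, ?_⟩
      rw [inv_eq_of_mul_eq_one_right hee]
      exact ((e⁻¹ : (localRing K n P)ˣ) : localRing K n P).2
    · rw [zpow_natCast]; exact he'
  rcases H.mem_or_inv_mem φ with h | h
  · exact key φ hφ h
  · obtain ⟨m, hm⟩ := key φ⁻¹ (inv_ne_zero hφ) h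
    exact ⟨-m, by simpa using HasOrder.inv H hm⟩

theorem hasOrder_order (H : IsRegularPoint P t) {φ : FunctionField K n} (hφ : φ ≠ 0) :
    HasOrder P φ (order P φ) := by
  obtain ⟨m, hm⟩ := exists_hasOrder H hφ
  rwa [HasOrder.order_eq H hm]

/-- The local parameters are the functions of order one. -/
theorem isLocalParameter_iff_hasOrder_one (H : IsRegularPoint P t) {s : FunctionField K n} :
    IsLocalParameter P s ↔ HasOrder P s 1 := by
  have := H.dvr
  constructor
  · intro h
    refine ⟨s, 1, h, one_ne_zero, one_mem _, ?_, by simp⟩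
    rw [inv_one]; exact one_mem _
  · intro h
    obtain ⟨u, hu, rfl⟩ := H.hasOrder_iff.1 h
    rw [hasOrder_zero_iff H] at hu
    obtain ⟨ht, htirr⟩ := H.isLocalParameter
    rw [zpow_one]
    refine ⟨mul_mem hu.2.1 ht, ?_⟩
    let e : (localRing K n P)ˣ := ⟨⟨u, hu.2.1⟩, ⟨u⁻¹, hu.2.2⟩,
      Subtype.ext (mul_inv_cancel₀ hu.1), Subtype.ext (inv_mul_cancel₀ hu.1)⟩
    exact (irreducible_units_mul e).2 htirr

theorem HasOrder.add_of_lt (H : IsRegularPoint P t) {φ ψ : FunctionField K n} {k m : ℤ}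
    (h : HasOrder P φ k) (h' : HasOrder P ψ m) (hkm : k < m) : HasOrder P (φ + ψ) k := by
  have hφ0 := h.ne_zero
  have h1 := HasOrder.div H h' h
  -- If `1 + ψ / φ` had positive order, then so would `1 = (1 + ψ / φ) - ψ / φ`.
  have h2 : HasOrder P (1 + ψ / φ) 0 := by
    have hne : 1 + ψ / φ ≠ 0 := by
      intro h0
      have h3 : HasOrder P (ψ / φ) 0 := by
        rw [eq_neg_of_add_eq_zero_right h0]
        simpa using hasOrder_algebraMap H (neg_ne_zero.2 (one_ne_zero (α := K)))
      have := HasOrder.unique H h1 h3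
      omega
    obtain ⟨j, hj⟩ := exists_hasOrder H hne
    have hj0 : 0 ≤ j := HasOrder.nonneg H hj
      (add_mem (one_mem _) (HasOrder.mem_localRing H h1 (by omega)))
    rcases hj0.eq_or_lt with hj0 | hj0
    · rwa [← hj0] at hj
    · exfalso
      have h4 : (1 + ψ / φ) / t ∈ localRing K n P := HasOrder.mem_localRing H
        (HasOrder.div H hj ((isLocalParameter_iff_hasOrder_one H).1 H.isLocalParameter)) (by omega)
      have h5 : (ψ / φ) / t ∈ localRing K n P := HasOrder.mem_localRing H
        (HasOrder.div H h1 ((isLocalParameter_iff_hasOrder_one H).1 H.isLocalParameter)) (by omega)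
      have h6 := sub_mem h4 h5
      rw [← sub_div, add_sub_cancel_right] at h6
      have := HasOrder.nonneg H (HasOrder.div H (hasOrder_algebraMap H (one_ne_zero (α := K)))
        ((isLocalParameter_iff_hasOrder_one H).1 H.isLocalParameter)) (by simpa using h6)
      omega
  have h3 := HasOrder.mul H h h2
  rw [add_zero] at h3
  convert h3 using 1
  field_simp

theorem HasOrder.add_smul_of_lt (H : IsRegularPoint P t)
    {φ ψ : FunctionField K n} {k m : ℤ} (h : HasOrder P φ k) (h' : HasOrder P ψ m) (hkm : k < m)
    (c : K) : HasOrder P (φ + algebraMap K _ c * ψ) k := by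
  by_cases hc : c = 0
  · simpa [hc] using h
  · exact h.add_of_lt H ((hasOrder_algebraMap H hc).mul H h') (by omega)

/-- The rotation of coordinates preserves orders. -/
theorem HasOrder.rotate [IsAlgClosed K] {a b c : K} (h : ![a, b, c] ≠ 0)
    (h' : ![c, a, b] ≠ 0) {t : FunctionField K n}
    (H : IsRegularPoint (Projectivization.mk K _ h) t) {φ : FunctionField K n} {m : ℤ}
    (hφ : HasOrder (Projectivization.mk K _ h) φ m) :
    HasOrder (Projectivization.mk K _ h') (rotate K n φ) m := by
  obtain ⟨u, hu, rfl⟩ := H.hasOrder_iff.1 hφ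
  rw [hasOrder_zero_iff H] at hu
  have H' := H.rotate h h'
  refine H'.hasOrder_iff.2 ⟨Hurwitz.rotate K n u, ?_, ?_⟩
  · rw [hasOrder_zero_iff H', ← map_inv₀]
    refine ⟨?_, rotate_mem_localRing h h' hu.2.1, rotate_mem_localRing h h' hu.2.2⟩
    simpa using hu.1
  · rw [map_mul, map_zpow₀]

end Orders

/-! ### Taylor expansions and differentials -/

section Taylor

variable {K : Type*} [Field K] {n : ℕ}

/-- The partial derivative `∂/∂x (x y ^ n + y + x ^ n)`, as a function on the curve. -/
def partialX (K : Type*) [Field K] (n : ℕ) : FunctionField K n :=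
  y K n ^ n + n * x K n ^ (n - 1)

/-- The partial derivative `∂/∂y (x y ^ n + y + x ^ n)`, as a function on the curve. -/
def partialY (K : Type*) [Field K] (n : ℕ) : FunctionField K n :=
  1 + n * x K n * y K n ^ (n - 1)

variable [Fact (2 < n)]

theorem partialY_ne_zero : partialY K n ≠ 0 := by
  intro h
  have := (eq_zero_of_linear_relation (K := K) (n := n) (a := 1)
    (b := (n : Polynomial K) * Polynomial.X ^ (n - 1)) (by
      rw [← h, partialY]; simp; ring)).1
  exact one_ne_zero this

/-- The expansion of `y` in powers of `s`, where `x` is replaced by `x + s`, exists by Hensel's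
lemma. The equation is first divided by the leading coefficient `x + s` in `y`. -/
theorem exists_root_powerSeries : ∃ Y : PowerSeries (FunctionField K n),
    PowerSeries.constantCoeff Y = y K n ∧
    (PowerSeries.C (x K n) + PowerSeries.X) * Y ^ n + Y
      + (PowerSeries.C (x K n) + PowerSeries.X) ^ n = 0 := by
  have hn : 2 < n := Fact.out
  set ξ : PowerSeries (FunctionField K n) := PowerSeries.C (x K n) + PowerSeries.X with hξ
  have hx := x_ne_zero (K := K) (n := n)
  have hξ0 : PowerSeries.constantCoeff ξ = x K n := by simp [hξ]
  have hξu : ξ * ξ⁻¹ = 1 := PowerSeries.mul_inv_cancel _ (by rw [hξ0]; exact hx)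
  have hξi : PowerSeries.constantCoeff ξ⁻¹ = (x K n)⁻¹ := by
    rw [PowerSeries.constantCoeff_inv, hξ0]
  let f : Polynomial (PowerSeries (FunctionField K n)) :=
    Polynomial.X ^ n + (Polynomial.C ξ⁻¹ * Polynomial.X + Polynomial.C (ξ⁻¹ * ξ ^ n))
  have hf : f.Monic := by
    refine Polynomial.monic_X_pow_add ?_
    refine lt_of_le_of_lt (Polynomial.degree_linear_le) ?_
    exact_mod_cast (by omega : 1 < n)
  have hhens := (IsAdicComplete.henselianRing (PowerSeries (FunctionField K n))
    (Ideal.span {PowerSeries.X})).is_henselian f hf (PowerSeries.C (y K n))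
  obtain ⟨Y, hY, hY'⟩ := hhens (by
      rw [Ideal.mem_span_singleton, PowerSeries.X_dvd_iff]
      simp only [f, Polynomial.eval_add, Polynomial.eval_pow, Polynomial.eval_X,
        Polynomial.eval_mul, Polynomial.eval_C, map_add, map_pow, map_mul, hξ0, hξi,
        PowerSeries.constantCoeff_C]
      field_simp
      linear_combination curve_equation (K := K) (n := n)) (by
      refine IsUnit.map _ ?_
      rw [PowerSeries.isUnit_iff_constantCoeff, isUnit_iff_ne_zero]
      have hder : f.derivative
          = Polynomial.C (n : PowerSeries (FunctionField K n)) * Polynomial.X ^ (n - 1)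
            + Polynomial.C ξ⁻¹ := by
        rw [Polynomial.derivative_add, Polynomial.derivative_add, Polynomial.derivative_X_pow,
          Polynomial.derivative_C_mul, Polynomial.derivative_X, Polynomial.derivative_C, mul_one,
          add_zero]
      simp only [hder, Polynomial.eval_add, Polynomial.eval_pow, Polynomial.eval_X,
        Polynomial.eval_mul, Polynomial.eval_C, map_add, map_pow, map_mul, hξi,
        PowerSeries.constantCoeff_C, map_natCast, Polynomial.eval_natCast]
      intro h0
      apply partialY_ne_zero (K := K) (n := n)
      have h1 := congrArg (fun z => x K n * z) h0
      simp only [mul_add, mul_zero, mul_inv_cancel₀ hx] at h1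
      rw [partialY, ← h1]; ring)
  refine ⟨Y, ?_, ?_⟩
  · rw [Ideal.mem_span_singleton, PowerSeries.X_dvd_iff, map_sub, PowerSeries.constantCoeff_C] at hY'
    exact sub_eq_zero.1 hY'
  · have hY : Y ^ n + (ξ⁻¹ * Y + ξ⁻¹ * ξ ^ n) = 0 := by simpa [f] using hY
    have h1 := congrArg (fun z => ξ * z) hY
    simp only [mul_zero] at h1
    linear_combination h1 - (Y + ξ ^ n) * hξu

/-- The Taylor expansion with respect to `x` exists. -/
theorem exists_isTaylorExpansion :
    ∃ T : FunctionField K n →ₐ[K] PowerSeries (FunctionField K n), IsTaylorExpansion T := by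
  obtain ⟨Y, hY0, hY⟩ := exists_root_powerSeries (K := K) (n := n)
  set T₀ : CoordinateRing K n →ₐ[K] PowerSeries (FunctionField K n) :=
    coordLift (PowerSeries.C (x K n) + PowerSeries.X) Y hY with hT₀
  have hx0 : T₀ (AdjoinRoot.root _) = PowerSeries.C (x K n) + PowerSeries.X := coordLift_root _ _ _
  have hy0 : T₀ (AdjoinRoot.of _ Polynomial.X) = Y := by
    rw [hT₀, coordLift_of, Polynomial.aeval_X]
  have hconst : ∀ r : CoordinateRing K n, PowerSeries.constantCoeff (T₀ r) = algebraMap _ _ r := by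
    intro r
    induction r using coordinateRing_induction with
    | hc c =>
      rw [AlgHom.commutes, ← IsScalarTower.algebraMap_apply]
      simp [PowerSeries.algebraMap_apply]
    | hx => rw [hx0]; simp [x]
    | hy => rw [hy0, hY0]; rfl
    | hadd r s hr hs => rw [map_add, map_add, map_add, hr, hs]
    | hmul r s hr hs => rw [map_mul, map_mul, map_mul, hr, hs]
  have hunit : ∀ s : nonZeroDivisors (CoordinateRing K n), IsUnit (T₀ s) := by
    rintro ⟨s, hs⟩
    rw [PowerSeries.isUnit_iff_constantCoeff, hconst, isUnit_iff_ne_zero]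
    simpa using nonZeroDivisors.ne_zero hs
  let T : FunctionField K n →ₐ[K] PowerSeries (FunctionField K n) :=
    IsLocalization.liftAlgHom (M := nonZeroDivisors (CoordinateRing K n)) (f := T₀) hunit
  have hT : ∀ r : CoordinateRing K n, T (algebraMap _ _ r) = T₀ r := fun r =>
    IsLocalization.lift_eq _ _
  refine ⟨T, ?_, ?_⟩
  · intro φ
    obtain ⟨r, s, hs, rfl⟩ := IsFractionRing.div_surjective (A := CoordinateRing K n) φ
    have hs1 : algebraMap _ (FunctionField K n) s ≠ 0 := by
      simpa using nonZeroDivisors.ne_zero hs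
    have h1 : T (algebraMap _ _ r / algebraMap _ _ s) * T (algebraMap _ _ s)
        = T (algebraMap _ _ r) := by rw [← map_mul, div_mul_cancel₀ _ hs1]
    have h2 := congrArg PowerSeries.constantCoeff h1
    rw [map_mul, hT, hT, hconst, hconst] at h2
    rwa [eq_div_iff hs1]
  · exact (hT _).trans hx0

/-- A Taylor expansion with respect to `x`, chosen as in the definition of the Hasse derivatives. -/
def taylor (K : Type*) [Field K] (n : ℕ) [Fact (2 < n)] :
    FunctionField K n →ₐ[K] PowerSeries (FunctionField K n) :=
  (exists_isTaylorExpansion (K := K) (n := n)).choose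

theorem isTaylorExpansion_taylor : IsTaylorExpansion (taylor K n) :=
  (exists_isTaylorExpansion (K := K) (n := n)).choose_spec

theorem hasseDeriv_eq (i : ℕ) (φ : FunctionField K n) :
    hasseDeriv i φ = PowerSeries.coeff i (taylor K n φ) := by
  rw [hasseDeriv, dif_pos exists_isTaylorExpansion]
  rfl

theorem hasseDeriv_zero (φ : FunctionField K n) : hasseDeriv 0 φ = φ := by
  rw [hasseDeriv_eq, PowerSeries.coeff_zero_eq_constantCoeff_apply]
  exact isTaylorExpansion_taylor.1 φ

theorem taylor_x : taylor K n (x K n) = PowerSeries.C (x K n) + PowerSeries.X :=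
  isTaylorExpansion_taylor.2

theorem taylor_equation :
    (PowerSeries.C (x K n) + PowerSeries.X) * taylor K n (y K n) ^ n + taylor K n (y K n)
      + (PowerSeries.C (x K n) + PowerSeries.X) ^ n = 0 := by
  have h := congrArg (taylor K n) (curve_equation (K := K) (n := n))
  rw [map_add, map_add, map_mul, map_pow, map_pow, taylor_x, map_zero] at h
  exact h

/-- The first Hasse derivative is the derivation `d / dx`. -/
def derivX (K : Type*) [Field K] (n : ℕ) [Fact (2 < n)] :
    Derivation K (FunctionField K n) (FunctionField K n) :=
  Derivation.mk' ((PowerSeries.coeff (R := FunctionField K n) 1).restrictScalars K ∘ₗ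
      (taylor K n).toLinearMap) (by
    intro φ ψ
    have h0 : ∀ φ, PowerSeries.coeff 0 (taylor K n φ) = φ := fun φ => by
      rw [← hasseDeriv_eq, hasseDeriv_zero]
    simp only [LinearMap.comp_apply, AlgHom.toLinearMap_apply, map_mul,
      LinearMap.restrictScalars_apply, smul_eq_mul]
    rw [PowerSeries.coeff_mul, Finset.Nat.antidiagonal_succ]
    simp [h0]
    ring)

theorem derivX_apply (φ : FunctionField K n) : derivX K n φ = hasseDeriv 1 φ := by
  rw [hasseDeriv_eq]; rfl

theorem derivX_x : derivX K n (x K n) = 1 := by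
  rw [derivX_apply, hasseDeriv_eq, taylor_x]
  simp

theorem partialY_mul_derivX_y : partialY K n * derivX K n (y K n) = - partialX K n := by
  have h := derivation_relation (derivX K n)
  rw [derivX_x] at h
  simp only [smul_eq_mul] at h
  rw [partialX, partialY]
  linear_combination h

/-- The differentials form a one-dimensional space, spanned by `dx`. -/
theorem differential_eq (φ : FunctionField K n) :
    KaehlerDifferential.D K (FunctionField K n) φ
      = derivX K n φ • KaehlerDifferential.D K (FunctionField K n) (x K n) := by
  set d := KaehlerDifferential.D K (FunctionField K n) with hd
  induction φ using functionField_induction with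
  | hc c => rw [d.map_algebraMap, (derivX K n).map_algebraMap, zero_smul]
  | hx => rw [derivX_x, one_smul]
  | hy =>
    have h := derivation_relation d
    have h2 := partialY_mul_derivX_y (K := K) (n := n)
    have h3 := partialY_ne_zero (K := K) (n := n)
    rw [← partialX, ← partialY] at h
    have h4 : partialY K n • d (y K n)
        = partialY K n • (derivX K n (y K n) • d (x K n)) := by
      rw [smul_smul, h2, neg_smul]
      exact eq_neg_of_add_eq_zero_right h
    have h5 := congrArg ((partialY K n)⁻¹ • ·) h4
    simpa only [smul_smul, inv_mul_cancel_left₀ h3, inv_mul_cancel₀ h3, one_smul] using h5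
  | hadd a b ha hb => rw [map_add, map_add, ha, hb, add_smul]
  | hmul a b ha hb =>
    rw [d.leibniz, (derivX K n).leibniz, ha, hb, add_smul, smul_smul, smul_smul, smul_eq_mul,
      smul_eq_mul]
  | hinv a ha =>
    rw [d.leibniz_inv, (derivX K n).leibniz_inv, ha, smul_smul, smul_eq_mul]

/-- The order of `dx` is the opposite of the order of the derivative of any local parameter. -/
theorem differentialOrder_dx {P : Plane K} {t : FunctionField K n} (H : IsRegularPoint P t)
    {s : FunctionField K n} (hs : HasOrder P s 1) {m : ℤ} (hm : HasOrder P (derivX K n s) m) :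
    differentialOrder P (KaehlerDifferential.D K (FunctionField K n) (x K n)) = -m := by
  have hts : HasOrder P t 1 := (isLocalParameter_iff_hasOrder_one H).1 H.isLocalParameter
  -- The order of `D s` is the same for all local parameters `s`.
  have horder : ∀ s', HasOrder P s' 1 → ∀ m', HasOrder P (derivX K n s') m' →
      ∀ k, HasOrder P (derivX K n t) k → m' = k := by
    intro s' hs' m' hm' k hk
    obtain ⟨u, hu, rfl⟩ := H.hasOrder_iff.1 hs'
    have hu' := (hasOrder_zero_iff H).1 hu
    obtain ⟨c, hc, hc'⟩ := H.derivation (derivX K n) u hu'.2.1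
    rw [zpow_one] at hm' hs'
    rw [(derivX K n).leibniz, hc', smul_eq_mul, smul_eq_mul,
      show u * derivX K n t + t * (c * derivX K n t) = (u + t * c) * derivX K n t by ring] at hm'
    have h1 : HasOrder P (u + t * c) 0 := by
      by_cases hc0 : c = 0
      · simpa [hc0] using hu
      · obtain ⟨j, hj⟩ := exists_hasOrder H hc0
        have hj0 := hj.nonneg H hc
        exact hu.add_of_lt H (hts.mul H hj) (by omega)
    have := hm'.unique H (h1.mul H hk)
    omega
  have ht0 : derivX K n t ≠ 0 := by
    intro h0
    obtain ⟨u, hu, hsu⟩ := H.hasOrder_iff.1 hs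
    have hu' := (hasOrder_zero_iff H).1 hu
    obtain ⟨c, hc, hc'⟩ := H.derivation (derivX K n) u hu'.2.1
    apply hm.ne_zero
    rw [hsu, zpow_one, (derivX K n).leibniz, hc', h0]
    simp
  obtain ⟨k, hk⟩ := exists_hasOrder H ht0
  have hex : ∃ j, DifferentialHasOrder P
      (KaehlerDifferential.D K (FunctionField K n) (x K n)) j := by
    refine ⟨-k, t, (derivX K n t)⁻¹, H.isLocalParameter, ?_, hk.inv H⟩
    rw [differential_eq t, smul_smul, inv_mul_cancel₀ ht0, one_smul]
  rw [differentialOrder, dif_pos hex]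
  obtain ⟨s', g, hs', hg, hg'⟩ := hex.choose_spec
  have h1 := congrArg (derivX K n).liftKaehlerDifferential hg
  rw [map_smul, Derivation.liftKaehlerDifferential_comp_D,
    Derivation.liftKaehlerDifferential_comp_D, derivX_x, smul_eq_mul] at h1
  have h2 : derivX K n s' = g⁻¹ := eq_inv_of_mul_eq_one_right h1.symm
  have h3 := horder s' ((isLocalParameter_iff_hasOrder_one H).1 hs') _
    (by rw [h2]; exact hg'.inv H) k hk
  have h4 := horder s hs m hm k hk
  omega

end Taylor

section Points

variable {K : Type*} [Field K] {n : ℕ} [Fact (2 < n)]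

/-! ### Orders at affine points -/

theorem hasOrder_zero_algebraMap {a b : K} (h : a * b ^ n + b + a ^ n = 0)
    {t : FunctionField K n} (H : IsRegularPoint (affinePoint a b) t)
    {r : CoordinateRing K n} (hr : evalPoint h r ≠ 0) :
    HasOrder (affinePoint a b) (algebraMap _ (FunctionField K n) r) 0 := by
  rw [hasOrder_zero_iff H]
  refine ⟨?_, algebraMap_mem_localRing a b r, inv_mem_localRing h hr⟩
  rw [Ne, FaithfulSMul.algebraMap_eq_zero_iff]
  rintro rfl
  simp at hr

theorem hasOrder_algebraMap_pos {a b : K} (h : a * b ^ n + b + a ^ n = 0)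
    {t : FunctionField K n} (H : IsRegularPoint (affinePoint a b) t)
    {r : CoordinateRing K n} (hr : evalPoint h r = 0) {m : ℤ}
    (hm : HasOrder (affinePoint a b) (algebraMap _ (FunctionField K n) r) m) : 0 < m := by
  rcases (hm.nonneg H (algebraMap_mem_localRing a b r)).eq_or_lt with h0 | h0
  · exfalso
    rw [← h0, hasOrder_zero_iff H] at hm
    have hu : IsUnit (toLocalRing (n := n) a b r) :=
      IsUnit.of_mul_eq_one ⟨_, hm.2.2⟩ (Subtype.ext (mul_inv_cancel₀ hm.1))
    rw [isUnit_toLocalRing_iff h] at hu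
    exact hu hr
  · exact h0

theorem poleOrder_affinePoint {a b : K} {t : FunctionField K n}
    (H : IsRegularPoint (affinePoint a b) t) : poleOrder K n (affinePoint a b) = 0 := by
  have h1 := (hasOrder_order H x_ne_zero).nonneg H (x_mem_localRing a b)
  have h2 := (hasOrder_order H y_ne_zero).nonneg H (y_mem_localRing a b)
  rw [poleOrder]
  omega

theorem derivX_y : derivX K n (y K n) = - partialX K n / partialY K n := by
  rw [eq_div_iff partialY_ne_zero, mul_comm, partialY_mul_derivX_y]

/-- At an affine point, `dx / (∂/∂y)` is a regular differential without zeros. -/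
theorem differentialOrder_affinePoint (hN : (n : K) ^ 2 - n + 1 ≠ 0) {a b : K}
    (h : a * b ^ n + b + a ^ n = 0) {m : ℤ} (hm : HasOrder (affinePoint a b) (partialY K n) m) :
    differentialOrder (affinePoint a b) (KaehlerDifferential.D K (FunctionField K n) (x K n))
      = m := by
  obtain ⟨U, V, hU, hV, hU', hV'⟩ := exists_partials (n := n) h
  rw [← partialX] at hU
  rw [← partialY] at hV
  rcases partial_ne_zero hN h with h1 | h1
  · have H := isRegularPoint_y h h1
    have hs : HasOrder (affinePoint a b) (y K n - algebraMap K _ b) 1 :=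
      (isLocalParameter_iff_hasOrder_one H).1 H.isLocalParameter
    have hx : HasOrder (affinePoint a b) (partialX K n) 0 := by
      rw [← hU]
      exact hasOrder_zero_algebraMap h H (by rw [hU']; exact h1)
    rw [differentialOrder_dx H hs (m := 0 - m), zero_sub, neg_neg]
    rw [map_sub, Derivation.map_algebraMap, sub_zero, derivX_y]
    exact (hx.neg H).div H hm
  · have H := isRegularPoint_x h h1
    have hs : HasOrder (affinePoint a b) (x K n - algebraMap K _ a) 1 :=
      (isLocalParameter_iff_hasOrder_one H).1 H.isLocalParameter
    have hy : HasOrder (affinePoint a b) (partialY K n) 0 := by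
      rw [← hV]
      exact hasOrder_zero_algebraMap h H (by rw [hV']; exact h1)
    rw [hm.unique H hy, differentialOrder_dx H hs (m := 0), neg_zero]
    rw [map_sub, Derivation.map_algebraMap, sub_zero, derivX_x]
    simpa using hasOrder_algebraMap H (one_ne_zero (α := K))

/-! ### Orders at the fundamental points -/

theorem origin_equation : (0 : K) * 0 ^ n + 0 + 0 ^ n = 0 := by
  have hn : 2 < n := Fact.out
  simp [show n ≠ 0 by omega]

theorem isRegularPoint_origin : IsRegularPoint (n := n) (affinePoint (0 : K) 0) (x K n) := by
  have h := isRegularPoint_x (n := n) (origin_equation (K := K)) (by simp)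
  simpa using h

theorem hasOrder_origin_x : HasOrder (n := n) (affinePoint (0 : K) 0) (x K n) 1 :=
  (isLocalParameter_iff_hasOrder_one isRegularPoint_origin).1 isRegularPoint_origin.isLocalParameter

theorem hasOrder_origin_y : HasOrder (n := n) (affinePoint (0 : K) 0) (y K n) n := by
  have hn : 2 < n := Fact.out
  have H := isRegularPoint_origin (K := K) (n := n)
  have hy : y K n * y K n ^ (n - 1) = y K n ^ n := mul_pow_sub_one (by omega) _
  set V : CoordinateRing K n :=
    1 + AdjoinRoot.root _ * AdjoinRoot.of (affineEquation K n) Polynomial.X ^ (n - 1) with hV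
  have h1 : HasOrder (affinePoint (0 : K) 0) (algebraMap _ (FunctionField K n) V) 0 := by
    refine hasOrder_zero_algebraMap origin_equation H ?_
    rw [hV, map_add, map_mul, map_one, coordLift_root]
    simp
  have h2 : algebraMap _ (FunctionField K n) V = 1 + x K n * y K n ^ (n - 1) := by
    simp [hV, x, y]
  have h3 : y K n = - x K n ^ n / algebraMap _ (FunctionField K n) V := by
    rw [eq_div_iff h1.ne_zero, h2]
    linear_combination curve_equation (K := K) (n := n) + x K n * hy
  rw [h3]
  convert ((hasOrder_origin_x.pow H n).neg H).div H h1 using 1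
  ring

theorem ne_zero_of_apply {v : Fin 3 → K} (i : Fin 3) (h : v i = 1) : v ≠ 0 := by
  rintro rfl
  exact zero_ne_one h

/-- The point `(1 : 0 : 0)`. -/
def pointX (K : Type*) [Field K] : Plane K :=
  Projectivization.mk K ![1, 0, 0] (ne_zero_of_apply 0 rfl)

/-- The point `(0 : 1 : 0)`. -/
def pointY (K : Type*) [Field K] : Plane K :=
  Projectivization.mk K ![0, 1, 0] (ne_zero_of_apply 1 rfl)

theorem mem_fundamentalPoints_iff {P : Plane K} :
    P ∈ fundamentalPoints K ↔ P = pointX K ∨ P = pointY K ∨ P = affinePoint 0 0 := by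
  have h0 : (Pi.single 0 1 : Fin 3 → K) = ![1, 0, 0] := by ext i; fin_cases i <;> simp
  have h1 : (Pi.single 1 1 : Fin 3 → K) = ![0, 1, 0] := by ext i; fin_cases i <;> simp
  have h2 : (Pi.single 2 1 : Fin 3 → K) = ![0, 0, 1] := by ext i; fin_cases i <;> simp
  constructor
  · rintro ⟨i, h, rfl⟩
    fin_cases i
    · left; simp only [pointX, ← h0]; rfl
    · right; left; simp only [pointY, ← h1]; rfl
    · right; right; simp only [affinePoint, ← h2]; rfl
  · rintro (rfl | rfl | rfl)
    · exact ⟨0, by simp, by simp only [pointX, h0]⟩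
    · exact ⟨1, by simp, by simp only [pointY, h1]⟩
    · exact ⟨2, by simp, by simp only [affinePoint, h2]⟩

theorem fundamentalPoints_subset_curve : fundamentalPoints K ⊆ curve K n := by
  have hn : 2 < n := Fact.out
  intro P hP
  rcases mem_fundamentalPoints_iff.1 hP with rfl | rfl | rfl
  · rw [pointX, mk_mem_curve_iff]; simp [show n ≠ 0 by omega]
  · rw [pointY, mk_mem_curve_iff]; simp [show n ≠ 0 by omega]
  · exact affinePoint_mem_curve_iff.2 origin_equation

/-- The points of the curve other than the fundamental points lie off the coordinate lines. -/
theorem mem_curve_cases {P : Plane K} (hP : P ∈ curve K n) : P ∈ fundamentalPoints K ∨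
    ∃ a b : K, a ≠ 0 ∧ b ≠ 0 ∧ a * b ^ n + b + a ^ n = 0 ∧ P = affinePoint a b := by
  have hn : 2 < n := Fact.out
  rw [mem_fundamentalPoints_iff]
  induction P using Projectivization.ind with
  | h v hv =>
  have hP' := (mk_mem_curve_iff hv).1 hP
  by_cases h2 : v 2 = 0
  · rw [h2, zero_pow (by omega), mul_zero, mul_zero, add_zero, add_zero] at hP'
    left
    rcases mul_eq_zero.1 hP' with h0 | h1
    · right; left
      rw [pointY, Projectivization.mk_eq_mk_iff']
      exact ⟨v 1, by ext i; fin_cases i <;> simp [h0, h2]⟩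
    · have h1 : v 1 = 0 := pow_eq_zero_iff (by omega) |>.1 h1
      left
      rw [pointX, Projectivization.mk_eq_mk_iff']
      exact ⟨v 0, by ext i; fin_cases i <;> simp [h1, h2]⟩
  · have hPa : Projectivization.mk K v hv = affinePoint (v 0 / v 2) (v 1 / v 2) := by
      rw [affinePoint, Projectivization.mk_eq_mk_iff']
      exact ⟨v 2, by ext i; fin_cases i <;> simp [mul_div_cancel₀, h2]⟩
    rw [hPa] at hP ⊢
    have heq := affinePoint_mem_curve_iff.1 hP
    by_cases ha : v 0 / v 2 = 0
    · have hb : v 1 / v 2 = 0 := by simpa [ha, show n ≠ 0 by omega] using heq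
      left; right; right
      rw [ha, hb]
    · by_cases hb : v 1 / v 2 = 0
      · exfalso
        rw [hb, zero_pow (by omega), mul_zero, zero_add, zero_add] at heq
        exact ha (pow_eq_zero_iff (by omega) |>.1 heq)
      · exact Or.inr ⟨_, _, ha, hb, heq, rfl⟩

/-- Euler's identity for the form of degree `n + 1`, up to the derivative with respect to `Z`. -/
theorem x_mul_partialX_add : x K n * partialX K n + y K n * partialY K n
    = - (x K n ^ n + n * y K n) := by
  have hn : 2 < n := Fact.out
  have hx : x K n * x K n ^ (n - 1) = x K n ^ n := mul_pow_sub_one (by omega) _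
  have hy : y K n * y K n ^ (n - 1) = y K n ^ n := mul_pow_sub_one (by omega) _
  rw [partialX, partialY]
  linear_combination (n + 1 : FunctionField K n) * curve_equation (K := K) (n := n) + n * hx
    + n * x K n * hy

theorem x_mul_partialX : x K n * partialX K n = (n - 1) * x K n ^ n - y K n := by
  have hn : 2 < n := Fact.out
  have hx : x K n * x K n ^ (n - 1) = x K n ^ n := mul_pow_sub_one (by omega) _
  rw [partialX]
  linear_combination curve_equation (K := K) (n := n) + n * hx

theorem y_mul_partialY : y K n * partialY K n = - (n - 1) * y K n - n * x K n ^ n := by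
  linear_combination x_mul_partialX_add (K := K) (n := n) - x_mul_partialX (K := K) (n := n)

section AlgClosed

variable [IsAlgClosed K]

theorem isRegularPoint_pointX : IsRegularPoint (pointX K) (y K n / x K n) := by
  have h := IsRegularPoint.rotate (affine_ne_zero (0 : K) 0) (ne_zero_of_apply 0 rfl)
    (isRegularPoint_origin (K := K) (n := n))
  rwa [rotate_x] at h

theorem hasOrder_pointX_div : HasOrder (pointX K) (y K n / x K n) 1 :=
  (isLocalParameter_iff_hasOrder_one isRegularPoint_pointX).1 isRegularPoint_pointX.isLocalParameter

theorem hasOrder_pointX_inv : HasOrder (pointX K) (1 / x K n) n := by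
  have h := HasOrder.rotate (affine_ne_zero (0 : K) 0) (ne_zero_of_apply 0 rfl)
    isRegularPoint_origin (hasOrder_origin_y (K := K) (n := n))
  rwa [rotate_y] at h

theorem hasOrder_pointX_x : HasOrder (pointX K) (x K n) (-n) := by
  have h := (hasOrder_pointX_inv (K := K) (n := n)).inv isRegularPoint_pointX
  simpa using h

theorem hasOrder_pointX_y : HasOrder (pointX K) (y K n) (1 - n) := by
  have h := (hasOrder_pointX_div (K := K) (n := n)).mul isRegularPoint_pointX hasOrder_pointX_x
  rwa [div_mul_cancel₀ _ x_ne_zero] at h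

theorem isRegularPoint_pointY : IsRegularPoint (pointY K) (1 / y K n) := by
  have h := IsRegularPoint.rotate (ne_zero_of_apply 0 rfl) (ne_zero_of_apply 1 rfl)
    (isRegularPoint_pointX (K := K) (n := n))
  rwa [map_div₀, rotate_x, rotate_y, div_div_div_cancel_right₀ x_ne_zero] at h

theorem hasOrder_pointY_inv : HasOrder (pointY K) (1 / y K n) 1 :=
  (isLocalParameter_iff_hasOrder_one isRegularPoint_pointY).1 isRegularPoint_pointY.isLocalParameter

theorem hasOrder_pointY_y : HasOrder (pointY K) (y K n) (-1) := by
  have h := (hasOrder_pointY_inv (K := K) (n := n)).inv isRegularPoint_pointY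
  simpa using h

theorem hasOrder_pointY_x : HasOrder (pointY K) (x K n) (n - 1) := by
  have h := HasOrder.rotate (ne_zero_of_apply 0 rfl) (ne_zero_of_apply 1 rfl)
    isRegularPoint_pointX (hasOrder_pointX_inv (K := K) (n := n))
  rw [map_div₀, rotate_x, map_one, one_div_div] at h
  have h2 := h.mul isRegularPoint_pointY hasOrder_pointY_y
  rw [div_mul_cancel₀ _ y_ne_zero] at h2
  exact h2

theorem poleOrder_pointX : poleOrder K n (pointX K) = n := by
  have hn : 2 < n := Fact.out
  rw [poleOrder, hasOrder_pointX_x.order_eq isRegularPoint_pointX,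
    hasOrder_pointX_y.order_eq isRegularPoint_pointX]
  omega

theorem poleOrder_pointY : poleOrder K n (pointY K) = 1 := by
  have hn : 2 < n := Fact.out
  rw [poleOrder, hasOrder_pointY_x.order_eq isRegularPoint_pointY,
    hasOrder_pointY_y.order_eq isRegularPoint_pointY]
  omega

theorem differentialOrder_pointX {m : ℤ} (hm : HasOrder (pointX K) (partialY K n) m) :
    differentialOrder (pointX K) (KaehlerDifferential.D K (FunctionField K n) (x K n))
      = n * (n - 2) + m := by
  have hn : 2 < n := Fact.out
  have H := isRegularPoint_pointX (K := K) (n := n)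
  have hx := x_ne_zero (K := K) (n := n)
  have hy := y_ne_zero (K := K) (n := n)
  have hfy := partialY_ne_zero (K := K) (n := n)
  have h1 : derivX K n (y K n / x K n)
      = (x K n ^ n + algebraMap K _ (n : K) * y K n) / (x K n ^ 2 * partialY K n) := by
    have h2 := congrArg (derivX K n) (div_mul_cancel₀ (y K n) hx)
    rw [Derivation.leibniz, derivX_x, derivX_y, smul_eq_mul, smul_eq_mul] at h2
    rw [eq_div_iff (mul_ne_zero (pow_ne_zero _ hx) hfy), map_natCast]
    field_simp at h2
    linear_combination h2 - x_mul_partialX_add (K := K) (n := n)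
  have hlt : (n : ℤ) * (-n) < 1 - n := by nlinarith
  have h3 := ((hasOrder_pointX_x (K := K) (n := n)).pow H n).add_smul_of_lt H hasOrder_pointX_y
    hlt (n : K)
  have h4 := h3.div H ((hasOrder_pointX_x.pow H 2).mul H hm)
  rw [← h1] at h4
  rw [differentialOrder_dx H hasOrder_pointX_div h4]
  push_cast; ring

theorem hasOrder_pointY_partialX : HasOrder (pointY K) (partialX K n) (-n) := by
  have hn : 2 < n := Fact.out
  have H := isRegularPoint_pointY (K := K) (n := n)
  have hx := x_ne_zero (K := K) (n := n)
  have hlt : (-1 : ℤ) < n * (n - 1) := by nlinarith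
  have h1 := (hasOrder_pointY_y (K := K) (n := n)).neg H |>.add_smul_of_lt H
    (hasOrder_pointY_x.pow H n) hlt (n - 1 : K)
  have h2 : -y K n + algebraMap K _ (n - 1 : K) * x K n ^ n = x K n * partialX K n := by
    rw [x_mul_partialX, map_sub, map_natCast, map_one]; ring
  rw [h2] at h1
  have h3 := h1.div H hasOrder_pointY_x
  rw [mul_div_cancel_left₀ _ hx] at h3
  convert h3 using 1
  ring

theorem differentialOrder_pointY {m : ℤ} (hm : HasOrder (pointY K) (partialY K n) m) :
    differentialOrder (pointY K) (KaehlerDifferential.D K (FunctionField K n) (x K n))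
      = n - 2 + m := by
  have H := isRegularPoint_pointY (K := K) (n := n)
  have hy := y_ne_zero (K := K) (n := n)
  have hfy := partialY_ne_zero (K := K) (n := n)
  have h1 : derivX K n (1 / y K n) = partialX K n / (y K n ^ 2 * partialY K n) := by
    rw [one_div, Derivation.leibniz_inv, derivX_y, smul_eq_mul]
    field_simp
  have h4 := hasOrder_pointY_partialX.div H ((hasOrder_pointY_y.pow H 2).mul H hm)
  rw [← h1] at h4
  rw [differentialOrder_dx H hasOrder_pointY_inv h4]
  push_cast; ring

end AlgClosed

end Points

/-! ### The order sequence -/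

section OrderSequence

variable {K : Type*} [Field K] {n : ℕ} [Fact (2 < n)]

/-- The Hasse derivatives of `1` and `x` are `1, 0, 0, …` and `x, 1, 0, …`, so that only those of `y`
matter. -/
theorem linearIndependent_hasseVector_iff (i : ℕ) : LinearIndependent (FunctionField K n)
    ![hasseVector K n 0, hasseVector K n 1, hasseVector K n i] ↔
      2 ≤ i ∧ hasseDeriv i (y K n) ≠ 0 := by
  have h1 : ∀ k, hasseDeriv k (1 : FunctionField K n) = if k = 0 then 1 else 0 := by
    intro k
    rw [hasseDeriv_eq, map_one, PowerSeries.coeff_one]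
  have hx : ∀ k, hasseDeriv k (x K n) = if k = 0 then x K n else if k = 1 then 1 else 0 := by
    intro k
    rw [hasseDeriv_eq, taylor_x, map_add, PowerSeries.coeff_C, PowerSeries.coeff_X]
    rcases k with _ | _ | k <;> simp
  change LinearIndependent _ (Matrix.of ![hasseVector K n 0, hasseVector K n 1,
    hasseVector K n i]).row ↔ _
  rw [Matrix.linearIndependent_rows_iff_isUnit, Matrix.isUnit_iff_isUnit_det, isUnit_iff_ne_zero,
    Matrix.det_fin_three]
  rcases i with _ | _ | i
  · simp [hasseVector, h1, hx]; ring
  · simp [hasseVector, h1, hx]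
  · simp [hasseVector, h1, hx]

theorem epsilon_eq {e : ℕ} (he : 2 ≤ e) (h : hasseDeriv e (y K n) ≠ 0)
    (h' : ∀ i, 2 ≤ i → i < e → hasseDeriv i (y K n) = 0) : epsilon K n = e := by
  refine IsLeast.csInf_eq ⟨(linearIndependent_hasseVector_iff e).2 ⟨he, h⟩, ?_⟩
  intro i hi
  obtain ⟨h1, h2⟩ := (linearIndependent_hasseVector_iff i).1 hi
  by_contra! h3
  exact h2 (h' i h1 h3)

theorem coeff_one_pow {R : Type*} [CommRing R] (φ : PowerSeries R) (j : ℕ) :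
    PowerSeries.coeff 1 (φ ^ j)
      = j * PowerSeries.coeff 0 φ ^ (j - 1) * PowerSeries.coeff 1 φ := by
  induction j with
  | zero => simp [PowerSeries.coeff_one]
  | succ j ih =>
    rw [pow_succ, PowerSeries.coeff_mul, Finset.Nat.sum_antidiagonal_eq_sum_range_succ_mk,
      Finset.sum_range_succ, Finset.sum_range_one]
    simp only [ih]
    simp only [PowerSeries.coeff_zero_eq_constantCoeff, map_pow, Nat.sub_zero, Nat.sub_self]
    rcases j with _ | j
    · simp
    · simp only [Nat.add_sub_cancel]
      push_cast; ring

theorem coeff_two_pow {R : Type*} [CommRing R] (φ : PowerSeries R) (j : ℕ) :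
    PowerSeries.coeff 2 (φ ^ j)
      = j * PowerSeries.coeff 0 φ ^ (j - 1) * PowerSeries.coeff 2 φ
        + j.choose 2 * PowerSeries.coeff 0 φ ^ (j - 2) * PowerSeries.coeff 1 φ ^ 2 := by
  induction j with
  | zero => simp [PowerSeries.coeff_one]
  | succ j ih =>
    have hc : (j + 1).choose 2 = j + j.choose 2 := by
      rw [Nat.choose_succ_succ' j 1, Nat.choose_one_right]
    rw [pow_succ, PowerSeries.coeff_mul, Finset.Nat.sum_antidiagonal_eq_sum_range_succ_mk,
      Finset.sum_range_succ, Finset.sum_range_succ, Finset.sum_range_one]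
    simp only [ih, coeff_one_pow, hc]
    simp only [PowerSeries.coeff_zero_eq_constantCoeff, map_pow, Nat.sub_zero, Nat.sub_self,
      Nat.reduceSub]
    rcases j with _ | _ | j
    · simp
    · simp; ring
    · simp only [Nat.add_sub_cancel, show j + 1 + 1 - 1 = j + 1 by omega,
        show j + 1 + 1 - 2 = j by omega, show j + 1 + 1 + 1 - 2 = j + 1 by omega]
      push_cast; ring

/-- The numerator of the second Hasse derivative of `y`, up to sign: that derivative is
`-hessian / partialY ^ 3`. -/
def hessian (K : Type*) [Field K] (n : ℕ) : FunctionField K n :=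
  n.choose 2 * x K n ^ (n - 2) * partialY K n ^ 2
    - n * y K n ^ (n - 1) * partialX K n * partialY K n
    + n.choose 2 * x K n * y K n ^ (n - 2) * partialX K n ^ 2

/-- The coefficient of `s ^ 2` in the Taylor expansion of the affine equation. -/
theorem partialY_pow_mul_hasseDeriv_two :
    partialY K n ^ 3 * hasseDeriv 2 (y K n) = - hessian K n := by
  have h := congrArg (PowerSeries.coeff 2) (taylor_equation (K := K) (n := n))
  have hx0 : PowerSeries.coeff 0 (PowerSeries.C (x K n) + PowerSeries.X) = x K n := by simp
  have hx1 : PowerSeries.coeff 1 (PowerSeries.C (x K n) + PowerSeries.X) = 1 := by simp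
  have hx2 : PowerSeries.coeff 2 (PowerSeries.C (x K n) + PowerSeries.X) = 0 := by
    simp [PowerSeries.coeff_X]
  rw [map_add, map_add, coeff_two_pow, PowerSeries.coeff_mul,
    Finset.Nat.sum_antidiagonal_eq_sum_range_succ_mk,
    Finset.sum_range_succ, Finset.sum_range_succ, Finset.sum_range_one] at h
  simp only [Nat.sub_zero, Nat.sub_self, Nat.reduceSub, coeff_one_pow, coeff_two_pow, hx0, hx1, hx2,
    ← hasseDeriv_eq, hasseDeriv_zero, map_zero, zero_mul, add_zero, mul_zero, one_mul, zero_add,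
    one_pow, mul_one] at h
  rw [← derivX_apply] at h
  have h1 := partialY_mul_derivX_y (K := K) (n := n)
  have h2 : partialY K n = 1 + n * x K n * y K n ^ (n - 1) := rfl
  rw [hessian]
  generalize hasseDeriv 2 (y K n) = D2 at *
  generalize derivX K n (y K n) = D1 at *
  generalize partialY K n = fy at *
  generalize partialX K n = fx at *
  have h3 : fy * D2 + n.choose 2 * x K n * y K n ^ (n - 2) * D1 ^ 2 + n * y K n ^ (n - 1) * D1
      + n.choose 2 * x K n ^ (n - 2) = 0 := by
    rw [← h, h2]; ring
  linear_combination fy ^ 2 * h3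
    - (n.choose 2 * x K n * y K n ^ (n - 2) * (fy * D1 - fx) + n * y K n ^ (n - 1) * fy) * h1

end OrderSequence

section CharacteristicDividing

variable {R : Type*} [CommRing R] {p : ℕ} [CharP R p]

theorem natCast_eq_zero_of_eq {n r m : ℕ} (hr : 1 ≤ r) (hn : n = p ^ r * m) : (n : R) = 0 := by
  rw [CharP.cast_eq_zero_iff R p, hn]
  exact dvd_mul_of_dvd_left (dvd_pow_self p (by omega)) m

variable [Fact p.Prime]

/-- In characteristic `p`, the expansion of a power with exponent `p ^ r * m` begins with the terms
of degrees `0` and `p ^ r`. -/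
theorem exists_pow_expansion {r m : ℕ} (φ : PowerSeries R) :
    ∃ E : PowerSeries R, φ ^ (p ^ r * m)
        = PowerSeries.C (PowerSeries.coeff 0 φ ^ (p ^ r * m)) + PowerSeries.X ^ p ^ r * E ∧
      PowerSeries.constantCoeff E
        = m * PowerSeries.coeff 0 φ ^ (p ^ r * (m - 1)) * PowerSeries.coeff 1 φ ^ p ^ r := by
  have hp : 0 < p ^ r := pow_pos (Fact.out (p := p.Prime)).pos r
  have hC : CharP (PowerSeries R) p :=
    charP_of_injective_algebraMap (R := R) (A := PowerSeries R) PowerSeries.C_injective p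
  obtain ⟨ψ, hψ⟩ : PowerSeries.X ∣ φ - PowerSeries.C (PowerSeries.coeff 0 φ) := by
    rw [PowerSeries.X_dvd_iff]; simp
  have hφ : φ = PowerSeries.C (PowerSeries.coeff 0 φ) + PowerSeries.X * ψ := by
    rw [← hψ]; ring
  have hψ0 : PowerSeries.constantCoeff ψ = PowerSeries.coeff 1 φ := by
    conv_rhs => rw [hφ]
    simp
  have hq : φ ^ p ^ r = PowerSeries.C (PowerSeries.coeff 0 φ ^ p ^ r)
      + PowerSeries.X ^ p ^ r * ψ ^ p ^ r := by
    conv_lhs => rw [hφ]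
    rw [add_pow_char_pow, mul_pow, map_pow]
  obtain ⟨k, hk⟩ := Polynomial.powAddExpansion (PowerSeries.C (PowerSeries.coeff 0 φ ^ p ^ r))
    (PowerSeries.X ^ p ^ r * ψ ^ p ^ r) m
  refine ⟨(m : PowerSeries R) * PowerSeries.C (PowerSeries.coeff 0 φ ^ p ^ r) ^ (m - 1) * ψ ^ p ^ r
    + k * PowerSeries.X ^ p ^ r * ψ ^ p ^ r * ψ ^ p ^ r, ?_, ?_⟩
  · rw [pow_mul φ, hq, hk, ← map_pow, ← pow_mul]; ring
  · simp [hψ0, pow_mul, zero_pow hp.ne']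

end CharacteristicDividing

section HasseDerivativesDvd

variable {K : Type*} [Field K] {n : ℕ} [Fact (2 < n)] {p : ℕ} [Fact p.Prime] [CharP K p]

/-- If `n = p ^ r * m`, then the Taylor expansion of `y` is affine linear in `s` up to terms of degree
`p ^ r`, because `x ^ n` and `y ^ n` are `p ^ r`-th powers. -/
theorem hasseDeriv_y_of_dvd {r m : ℕ} (hr : 1 ≤ r) (hn : n = p ^ r * m) :
    (∀ i, 2 ≤ i → i < p ^ r → hasseDeriv i (y K n) = 0) ∧
    hasseDeriv (p ^ r) (y K n)
      = m * (x K n * y K n ^ (n - p ^ r + n * p ^ r) - x K n ^ (n - p ^ r)) := by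
  have hC : CharP (FunctionField K n) p := charP_of_injective_algebraMap
    (algebraMap K (FunctionField K n)).injective p
  have hp2 : 2 ≤ p ^ r := (Fact.out (p := p.Prime)).two_le.trans (Nat.le_self_pow (by omega) p)
  have hn0 : (n : FunctionField K n) = 0 := natCast_eq_zero_of_eq hr hn
  have hexp : p ^ r * (m - 1) = n - p ^ r := by rw [Nat.mul_sub, mul_one, ← hn]
  obtain ⟨E, hE, hE0⟩ := exists_pow_expansion (p := p) (r := r) (m := m) (taylor K n (y K n))
  obtain ⟨F, hF, hF0⟩ := exists_pow_expansion (p := p) (r := r) (m := m)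
    (PowerSeries.C (x K n) + PowerSeries.X)
  rw [← hn] at hE hF
  rw [hexp] at hE0 hF0
  have hy1 : hasseDeriv 1 (y K n) = - y K n ^ n := by
    rw [← derivX_apply, derivX_y, partialX, partialY, hn0]; simp
  have heq := taylor_equation (K := K) (n := n)
  rw [hE, hF] at heq
  simp only [← hasseDeriv_eq, hasseDeriv_zero, hy1] at hE hE0 hF0 heq
  have hx0 : PowerSeries.coeff 0 (PowerSeries.C (x K n) + PowerSeries.X) = x K n := by simp
  have hx1 : PowerSeries.coeff 1 (PowerSeries.C (x K n) + PowerSeries.X) = 1 := by simp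
  rw [hx0] at heq hF0
  rw [hx1] at hF0
  have hT : taylor K n (y K n) = PowerSeries.C (- (x K n * y K n ^ n + x K n ^ n))
      + PowerSeries.C (- y K n ^ n) * PowerSeries.X
      + PowerSeries.X ^ p ^ r * (- (PowerSeries.C (x K n) * E + F) - PowerSeries.X * E) := by
    simp only [map_neg, map_add, map_mul] at heq ⊢
    linear_combination heq
  constructor
  · intro i hi hi'
    rw [hasseDeriv_eq, hT, map_add, map_add, PowerSeries.coeff_X_pow_mul', if_neg (by omega),
      PowerSeries.coeff_C_mul, PowerSeries.coeff_X, PowerSeries.coeff_C, if_neg (by omega),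
      if_neg (by omega)]
    simp
  · rw [hasseDeriv_eq, hT, map_add, map_add, PowerSeries.coeff_X_pow_mul', if_pos le_rfl,
      PowerSeries.coeff_C_mul, PowerSeries.coeff_X, PowerSeries.coeff_C, if_neg (by omega),
      if_neg (by omega), Nat.sub_self, PowerSeries.coeff_zero_eq_constantCoeff_apply]
    simp only [map_sub, map_neg, map_add, map_mul, PowerSeries.constantCoeff_C, hE0, hF0,
      PowerSeries.constantCoeff_X]
    rw [neg_pow, neg_one_pow_char_pow (FunctionField K n) p r, pow_add, pow_mul]
    ring

end HasseDerivativesDvd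

/-! ### Ramification when `p` divides `n` -/

section RamificationDvd

variable {K : Type*} [Field K] {n : ℕ} {p : ℕ} {r m : ℕ}

theorem two_le_pow (p : ℕ) [Fact p.Prime] {r : ℕ} (hr : 1 ≤ r) : 2 ≤ p ^ r :=
  (Fact.out (p := p.Prime)).two_le.trans (Nat.le_self_pow (by omega) p)

theorem pow_le_of_eq [Fact (2 < n)] (hn : n = p ^ r * m) : p ^ r ≤ n := by
  have h2 : 2 < n := Fact.out
  exact Nat.le_of_dvd (by omega) ⟨m, hn⟩

theorem hasOrder_origin_of_dvd [Fact p.Prime] [Fact (2 < n)] (hr : 1 ≤ r) (hn : n = p ^ r * m) :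
    HasOrder (affinePoint (0 : K) 0)
      (x K n * y K n ^ (n - p ^ r + n * p ^ r) - x K n ^ (n - p ^ r)) (n - p ^ r) := by
  have h2 : 2 < n := Fact.out
  have hq := pow_le_of_eq (r := r) (m := m) hn
  have hq2 := two_le_pow p hr
  have H := isRegularPoint_origin (K := K) (n := n)
  have h1 := (hasOrder_origin_x.pow H (n - p ^ r)).neg H
  have h3 := hasOrder_origin_x.mul H (hasOrder_origin_y.pow H (n - p ^ r + n * p ^ r))
  have hle : ((n - p ^ r : ℕ) : ℤ) * 1 < 1 + ((n - p ^ r + n * p ^ r : ℕ) : ℤ) * n := by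
    have : n - p ^ r ≤ (n - p ^ r + n * p ^ r) * n :=
      (Nat.le_add_right _ _).trans (Nat.le_mul_of_pos_right _ (by omega))
    have : ((n - p ^ r : ℕ) : ℤ) ≤ ((n - p ^ r + n * p ^ r : ℕ) : ℤ) * n := by exact_mod_cast this
    omega
  have h4 := h1.add_of_lt H h3 hle
  convert h4 using 1
  · ring
  · push_cast [hq]; ring

variable [CharP K p]

theorem cast_ne_zero_of_not_dvd (hm : ¬ p ∣ m) : (m : K) ≠ 0 := by
  rwa [Ne, CharP.cast_eq_zero_iff K p]

theorem partialY_of_dvd (hr : 1 ≤ r) (hn : n = p ^ r * m) : partialY K n = 1 := by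
  have hn0 : (n : K) = 0 := natCast_eq_zero_of_eq hr hn
  have : (n : FunctionField K n) = 0 := by
    rw [← map_natCast (algebraMap K (FunctionField K n)), hn0, map_zero]
  rw [partialY, this]; ring

theorem hasOrder_partialY_of_dvd [Fact (2 < n)] (hr : 1 ≤ r) (hn : n = p ^ r * m)
    {P : Plane K} {t : FunctionField K n} (H : IsRegularPoint P t) :
    HasOrder P (partialY K n) 0 := by
  rw [partialY_of_dvd hr hn]
  simpa using hasOrder_algebraMap H (one_ne_zero (α := K))

variable [Fact p.Prime] [Fact (2 < n)]

/-- The order of the Hasse derivative of `y` that enters the ramification divisor, when `p ∣ n`. -/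
theorem hasOrder_hasseDeriv_of_dvd (hr : 1 ≤ r) (hm : ¬ p ∣ m) (hn : n = p ^ r * m)
    {P : Plane K} {t : FunctionField K n} (H : IsRegularPoint P t) {k : ℤ}
    (hk : HasOrder P (x K n * y K n ^ (n - p ^ r + n * p ^ r) - x K n ^ (n - p ^ r)) k) :
    HasOrder P (hasseDeriv (p ^ r) (y K n)) k := by
  rw [(hasseDeriv_y_of_dvd hr hn).2]
  have h := (hasOrder_algebraMap H (cast_ne_zero_of_not_dvd (K := K) hm)).mul H hk
  rwa [map_natCast, zero_add] at h

theorem hasseDeriv_ne_zero_of_dvd (hr : 1 ≤ r) (hm : ¬ p ∣ m) (hn : n = p ^ r * m) :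
    hasseDeriv (p ^ r) (y K n) ≠ 0 :=
  (hasOrder_hasseDeriv_of_dvd hr hm hn isRegularPoint_origin
    (hasOrder_origin_of_dvd (K := K) hr hn)).ne_zero

theorem epsilon_of_dvd (hr : 1 ≤ r) (hm : ¬ p ∣ m) (hn : n = p ^ r * m) :
    epsilon K n = p ^ r :=
  epsilon_eq (two_le_pow p hr) (hasseDeriv_ne_zero_of_dvd hr hm hn) (hasseDeriv_y_of_dvd hr hn).1

theorem ramification_affinePoint_of_dvd (hr : 1 ≤ r) (hm : ¬ p ∣ m) (hn : n = p ^ r * m)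
    {a b : K} (h : a * b ^ n + b + a ^ n = 0) {k : ℤ}
    (hk : HasOrder (affinePoint a b)
      (x K n * y K n ^ (n - p ^ r + n * p ^ r) - x K n ^ (n - p ^ r)) k) :
    ramification K n (affinePoint a b) = k := by
  have hn0 : (n : K) = 0 := natCast_eq_zero_of_eq hr hn
  have hN : (n : K) ^ 2 - n + 1 ≠ 0 := by rw [hn0]; simp
  obtain ⟨t, H⟩ := exists_isRegularPoint_affinePoint hN h
  rw [ramification, epsilon_of_dvd hr hm hn,
    (hasOrder_hasseDeriv_of_dvd hr hm hn H hk).order_eq H,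
    differentialOrder_affinePoint hN h (hasOrder_partialY_of_dvd hr hn H),
    poleOrder_affinePoint H]
  ring

theorem ramification_origin_of_dvd (hr : 1 ≤ r) (hm : ¬ p ∣ m) (hn : n = p ^ r * m) :
    ramification K n (affinePoint 0 0) = n - p ^ r :=
  ramification_affinePoint_of_dvd hr hm hn origin_equation (hasOrder_origin_of_dvd hr hn)

/-- The Hasse derivative of order `ε = p ^ r` is a polynomial in `x` and `y`, whose zeros are the
ramification points of the affine part. -/
theorem ramification_affinePoint_ne_zero_iff_of_dvd (hr : 1 ≤ r) (hm : ¬ p ∣ m)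
    (hn : n = p ^ r * m) {a b : K} (h : a * b ^ n + b + a ^ n = 0) :
    ramification K n (affinePoint a b) ≠ 0 ↔
      a * b ^ (n - p ^ r + n * p ^ r) - a ^ (n - p ^ r) = 0 := by
  have hn0 : (n : K) = 0 := natCast_eq_zero_of_eq hr hn
  have hN : (n : K) ^ 2 - n + 1 ≠ 0 := by rw [hn0]; simp
  obtain ⟨t, H⟩ := exists_isRegularPoint_affinePoint hN h
  set X := AdjoinRoot.root (affineEquation K n) with hX
  set Y := AdjoinRoot.of (affineEquation K n) Polynomial.X with hY
  have eX : evalPoint h X = a := coordLift_root _ _ _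
  have eY : evalPoint h Y = b := by rw [hY, coordLift_of, Polynomial.aeval_X]
  set s : CoordinateRing K n := X * Y ^ (n - p ^ r + n * p ^ r) - X ^ (n - p ^ r) with hs
  have hs1 : algebraMap _ (FunctionField K n) s
      = x K n * y K n ^ (n - p ^ r + n * p ^ r) - x K n ^ (n - p ^ r) := by
    simp [hs, hX, hY, x, y]
  have hs2 : evalPoint h s = a * b ^ (n - p ^ r + n * p ^ r) - a ^ (n - p ^ r) := by
    rw [hs, map_sub, map_mul, map_pow, map_pow, eX, eY]
  have hs0 := (hasOrder_origin_of_dvd (K := K) hr hn).ne_zero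
  obtain ⟨k, hk⟩ := exists_hasOrder H hs0
  rw [ramification_affinePoint_of_dvd hr hm hn h hk, ← hs2]
  rw [← hs1] at hk
  constructor
  · intro hk0
    by_contra h1
    exact hk0 (hk.unique H (hasOrder_zero_algebraMap h H h1))
  · intro h1
    exact (hasOrder_algebraMap_pos h H h1 hk).ne'

variable [IsAlgClosed K]

theorem ramification_pointX_of_dvd (hr : 1 ≤ r) (hm : ¬ p ∣ m) (hn : n = p ^ r * m) :
    ramification K n (pointX K) = n - p ^ r := by
  have h2 : 2 < n := Fact.out
  have hq := pow_le_of_eq (r := r) (m := m) hn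
  have hq2 := two_le_pow p hr
  have H := isRegularPoint_pointX (K := K) (n := n)
  have h1 := (hasOrder_pointX_x.pow H (n - p ^ r)).neg H
  have h3 := hasOrder_pointX_x.mul H (hasOrder_pointX_y.pow H (n - p ^ r + n * p ^ r))
  have hle : -(n : ℤ) + ((n - p ^ r + n * p ^ r : ℕ) : ℤ) * (1 - n)
      < ((n - p ^ r : ℕ) : ℤ) * (-n) := by
    push_cast [hq]
    have : (2 : ℤ) ≤ (p : ℤ) ^ r := by exact_mod_cast hq2
    have h2' : (2 : ℤ) < n := by exact_mod_cast h2
    nlinarith [mul_pos (show (0 : ℤ) < (p : ℤ) ^ r by linarith)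
      (show (0 : ℤ) < (n : ℤ) ^ 2 - n + 1 by nlinarith)]
  have h4 := h3.add_of_lt H h1 hle
  rw [← sub_eq_add_neg] at h4
  rw [ramification, epsilon_of_dvd hr hm hn,
    (hasOrder_hasseDeriv_of_dvd hr hm hn H h4).order_eq H,
    differentialOrder_pointX (hasOrder_partialY_of_dvd hr hn H), poleOrder_pointX]
  push_cast [hq]; ring

theorem ramification_pointY_of_dvd (hr : 1 ≤ r) (hm : ¬ p ∣ m) (hn : n = p ^ r * m) :
    ramification K n (pointY K) = n - p ^ r := by
  have h2 : 2 < n := Fact.out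
  have hq := pow_le_of_eq (r := r) (m := m) hn
  have hq2 := two_le_pow p hr
  have H := isRegularPoint_pointY (K := K) (n := n)
  have h1 := (hasOrder_pointY_x.pow H (n - p ^ r)).neg H
  have h3 := hasOrder_pointY_x.mul H (hasOrder_pointY_y.pow H (n - p ^ r + n * p ^ r))
  have hle : (n : ℤ) - 1 + ((n - p ^ r + n * p ^ r : ℕ) : ℤ) * (-1)
      < ((n - p ^ r : ℕ) : ℤ) * (n - 1) := by
    have h5 : (0 : ℤ) ≤ ((n - p ^ r : ℕ) : ℤ) * (n - 1) :=
      mul_nonneg (by positivity) (by omega)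
    have : (2 : ℤ) ≤ (p : ℤ) ^ r := by exact_mod_cast hq2
    have h2' : (2 : ℤ) < n := by exact_mod_cast h2
    refine lt_of_lt_of_le ?_ h5
    push_cast [hq]
    nlinarith
  have h4 := h3.add_of_lt H h1 hle
  rw [← sub_eq_add_neg] at h4
  rw [ramification, epsilon_of_dvd hr hm hn,
    (hasOrder_hasseDeriv_of_dvd hr hm hn H h4).order_eq H,
    differentialOrder_pointY (hasOrder_partialY_of_dvd hr hn H), poleOrder_pointY]
  push_cast [hq]; ring

theorem ramification_fundamentalPoint_of_dvd (hr : 1 ≤ r) (hm : ¬ p ∣ m) (hn : n = p ^ r * m)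
    {P : Plane K} (hP : P ∈ fundamentalPoints K) : ramification K n P = n - p ^ r := by
  rcases mem_fundamentalPoints_iff.1 hP with rfl | rfl | rfl
  · exact ramification_pointX_of_dvd hr hm hn
  · exact ramification_pointY_of_dvd hr hm hn
  · exact ramification_origin_of_dvd hr hm hn

end RamificationDvd

/-! ### Ramification when the Hessian is not zero -/

section RamificationHessian

variable {K : Type*} [Field K] {n : ℕ} [Fact (2 < n)]

/-- The cubic form whose value at `u = x ^ n`, `v = y` is `hessian * (x ^ 2 * y ^ 2)`. -/
def hessianForm {R : Type*} [CommRing R] (n : ℕ) (u v : R) : R :=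
  n.choose 2 * u * ((n - 1) * v + n * u) ^ 2
    - n * (v + u) * ((n - 1) * u - v) * ((n - 1) * v + n * u)
    - n.choose 2 * (v + u) * ((n - 1) * u - v) ^ 2

theorem hessianForm_mul {R : Type*} [CommRing R] (n : ℕ) (s u v : R) :
    hessianForm n (s * u) (s * v) = s ^ 3 * hessianForm n u v := by
  simp only [hessianForm]; ring

theorem map_hessianForm {R S : Type*} [CommRing R] [CommRing S] (f : R →+* S) (n : ℕ) (u v : R) :
    f (hessianForm n u v) = hessianForm n (f u) (f v) := by
  simp [hessianForm]

theorem hessian_mul : hessian K n * (x K n ^ 2 * y K n ^ 2)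
    = hessianForm n (x K n ^ n) (y K n) := by
  have h2 : 2 < n := Fact.out
  have hxx : x K n ^ (n - 2) * x K n ^ 2 = x K n ^ n := pow_sub_mul_pow _ (by omega)
  have hyy : y K n ^ (n - 2) * y K n ^ 2 = y K n ^ n := pow_sub_mul_pow _ (by omega)
  have hy1 : y K n * y K n ^ (n - 1) = y K n ^ n := mul_pow_sub_one (by omega) _
  have hx := x_mul_partialX (K := K) (n := n)
  have hy := y_mul_partialY (K := K) (n := n)
  have hc := curve_equation (K := K) (n := n)
  rw [hessian, hessianForm]
  have e1 : x K n * y K n ^ n = - (y K n + x K n ^ n) := by linear_combination hc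
  have e2 : (n - 1) * x K n ^ n - y K n = x K n * partialX K n := hx.symm
  have e3 : (n - 1) * y K n + n * x K n ^ n = - (y K n * partialY K n) := by
    rw [hy]; ring
  rw [e2, e3, ← neg_neg (y K n + x K n ^ n), ← e1, ← hxx, ← hyy]
  linear_combination (- (n : FunctionField K n) * x K n ^ 2 * partialX K n * partialY K n * y K n)
    * (hy1 - hyy)

/-- The identity `hessian_mul` at a point of the curve. -/
theorem hessianForm_point {a b : K} (h : a * b ^ n + b + a ^ n = 0) :
    (n.choose 2 * a ^ (n - 2) * (1 + n * a * b ^ (n - 1)) ^ 2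
      - n * b ^ (n - 1) * (b ^ n + n * a ^ (n - 1)) * (1 + n * a * b ^ (n - 1))
      + n.choose 2 * a * b ^ (n - 2) * (b ^ n + n * a ^ (n - 1)) ^ 2) * (a ^ 2 * b ^ 2)
      = hessianForm n (a ^ n) b := by
  have h2 : 2 < n := Fact.out
  have hxx : a ^ (n - 2) * a ^ 2 = a ^ n := pow_sub_mul_pow _ (by omega)
  have hyy : b ^ (n - 2) * b ^ 2 = b ^ n := pow_sub_mul_pow _ (by omega)
  have hy1 : b * b ^ (n - 1) = b ^ n := mul_pow_sub_one (by omega) _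
  have hx1 : a * a ^ (n - 1) = a ^ n := mul_pow_sub_one (by omega) _
  have e1 : a * b ^ n = - (b + a ^ n) := by linear_combination h
  have e2 : (n - 1) * a ^ n - b = a * (b ^ n + n * a ^ (n - 1)) := by
    linear_combination - (n : K) * hx1 - h
  have e3 : (n - 1) * b + n * a ^ n = - (b * (1 + n * a * b ^ (n - 1))) := by
    linear_combination (n : K) * a * hy1 + n * h
  rw [hessianForm, e2, e3, ← neg_neg (b + a ^ n), ← e1]
  generalize 1 + n * a * b ^ (n - 1) = fy
  generalize b ^ n + n * a ^ (n - 1) = fx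
  rw [← hxx, ← hyy]
  linear_combination (- (n : K) * a ^ 2 * fx * fy * b) * (hy1 - hyy)

theorem div_ne_algebraMap (c : K) : y K n / x K n ^ n ≠ algebraMap K _ c := by
  intro h
  have hx : x K n ^ n ≠ 0 := pow_ne_zero _ x_ne_zero
  rw [div_eq_iff hx] at h
  obtain ⟨h1, h2⟩ := eq_zero_of_linear_relation (K := K) (n := n)
    (a := Polynomial.C (1 + c) * Polynomial.X) (b := Polynomial.C c * Polynomial.X ^ n) (by
      simp only [map_mul, map_pow, Polynomial.aeval_C, Polynomial.aeval_X, map_add, map_one]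
      linear_combination h + algebraMap K (FunctionField K n) c * curve_equation (K := K) (n := n))
  have h3 : c = 0 := by simpa using h2
  simp [h3] at h1

theorem hasseDeriv_two : hasseDeriv 2 (y K n) = - hessian K n / partialY K n ^ 3 := by
  rw [eq_div_iff (pow_ne_zero _ partialY_ne_zero), mul_comm, partialY_pow_mul_hasseDeriv_two]

/-- The function `hessian` vanishes only if the cubic form does, because `y / x ^ n` is
transcendental over `K`. -/
theorem hessian_ne_zero [IsAlgClosed K] (c : K) (hc : hessianForm n 1 c ≠ 0) : hessian K n ≠ 0 := by
  have hx : x K n ^ n ≠ 0 := pow_ne_zero _ x_ne_zero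
  intro h0
  have h1 := hessian_mul (K := K) (n := n)
  rw [h0, zero_mul] at h1
  have h2 : hessianForm n (x K n ^ n) (y K n)
      = (x K n ^ n) ^ 3 * hessianForm n 1 (y K n / x K n ^ n) := by
    rw [← hessianForm_mul, mul_one, mul_div_cancel₀ _ hx]
  rw [h2, eq_comm, mul_eq_zero, or_iff_right (pow_ne_zero _ hx)] at h1
  have h3 : Polynomial.aeval (y K n / x K n ^ n)
      (hessianForm n 1 (Polynomial.X : Polynomial K)) = 0 := by
    have := map_hessianForm (Polynomial.aeval (R := K) (y K n / x K n ^ n)).toRingHom n 1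
      Polynomial.X
    refine this.trans ?_
    simpa using h1
  have h4 := eq_zero_of_aeval_eq_zero div_ne_algebraMap h3
  have h5 := map_hessianForm (Polynomial.evalRingHom c) n 1 (Polynomial.X : Polynomial K)
  rw [h4, map_zero] at h5
  apply hc
  rw [h5]
  simp

theorem epsilon_of_hessian (hH : hessian K n ≠ 0) : epsilon K n = 2 := by
  refine epsilon_eq le_rfl ?_ (by omega)
  rw [hasseDeriv_two]
  exact div_ne_zero (neg_ne_zero.2 hH) (pow_ne_zero _ partialY_ne_zero)

theorem order_hasseDeriv_two {P : Plane K} {t : FunctionField K n} (H : IsRegularPoint P t)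
    {k m : ℤ} (hk : HasOrder P (hessian K n) k) (hm : HasOrder P (partialY K n) m) :
    order P (hasseDeriv 2 (y K n)) = k - 3 * m := by
  rw [hasseDeriv_two]
  have := (hk.neg H).div H (hm.pow H 3)
  exact_mod_cast this.order_eq H

theorem ramification_affinePoint_of_hessian (hH : hessian K n ≠ 0)
    (hN : (n : K) ^ 2 - n + 1 ≠ 0) {a b : K} (h : a * b ^ n + b + a ^ n = 0) {k : ℤ}
    (hk : HasOrder (affinePoint a b) (hessian K n) k) :
    ramification K n (affinePoint a b) = k := by
  obtain ⟨t, H⟩ := exists_isRegularPoint_affinePoint hN h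
  obtain ⟨m, hm⟩ := exists_hasOrder H (partialY_ne_zero (K := K) (n := n))
  rw [ramification, epsilon_of_hessian hH, order_hasseDeriv_two H hk hm,
    differentialOrder_affinePoint hN h hm, poleOrder_affinePoint H]
  push_cast; ring

/-- At a point with nonzero coordinates, ramification is the vanishing of the cubic form. -/
theorem ramification_affinePoint_ne_zero_iff (hH : hessian K n ≠ 0)
    (hN : (n : K) ^ 2 - n + 1 ≠ 0) {a b : K} (ha : a ≠ 0) (hb : b ≠ 0)
    (h : a * b ^ n + b + a ^ n = 0) :
    ramification K n (affinePoint a b) ≠ 0 ↔ hessianForm n 1 (b / a ^ n) = 0 := by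
  obtain ⟨t, H⟩ := exists_isRegularPoint_affinePoint hN h
  obtain ⟨U, V, hU, hV, hU', hV'⟩ := exists_partials (n := n) h
  rw [← partialX] at hU
  rw [← partialY] at hV
  set X := AdjoinRoot.root (affineEquation K n) with hX
  set Y := AdjoinRoot.of (affineEquation K n) Polynomial.X with hY
  have eX : evalPoint h X = a := coordLift_root _ _ _
  have eY : evalPoint h Y = b := by rw [hY, coordLift_of, Polynomial.aeval_X]
  have aX : algebraMap _ (FunctionField K n) X = x K n := rfl
  have aY : algebraMap _ (FunctionField K n) Y = y K n := rfl
  set s : CoordinateRing K n := n.choose 2 * X ^ (n - 2) * V ^ 2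
    - n * Y ^ (n - 1) * U * V + n.choose 2 * X * Y ^ (n - 2) * U ^ 2 with hs
  have hs1 : algebraMap _ (FunctionField K n) s = hessian K n := by
    rw [hessian, hs]
    simp only [map_add, map_sub, map_mul, map_pow, map_natCast, aX, aY, hU, hV]
  have hs2 : evalPoint h s * (a ^ 2 * b ^ 2) = hessianForm n (a ^ n) b := by
    rw [← hessianForm_point h, hs]
    simp only [map_add, map_sub, map_mul, map_pow, map_natCast, eX, eY, hU', hV']
  have hab : a ^ 2 * b ^ 2 ≠ 0 := mul_ne_zero (pow_ne_zero _ ha) (pow_ne_zero _ hb)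
  have han : a ^ n ≠ 0 := pow_ne_zero _ ha
  have h2 : hessianForm n (a ^ n) b = (a ^ n) ^ 3 * hessianForm n 1 (b / a ^ n) := by
    rw [← hessianForm_mul, mul_one, mul_div_cancel₀ _ han]
  have h3 : evalPoint h s = 0 ↔ hessianForm n 1 (b / a ^ n) = 0 := by
    rw [← mul_eq_zero_iff_right hab, hs2, h2, mul_eq_zero_iff_left (pow_ne_zero _ han)]
  obtain ⟨k, hk⟩ := exists_hasOrder H hH
  rw [ramification_affinePoint_of_hessian hH hN h hk, ← h3]
  rw [← hs1] at hk
  constructor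
  · intro hk0
    by_contra h1
    exact hk0 (hk.unique H (hasOrder_zero_algebraMap h H h1))
  · intro h1
    exact (hasOrder_algebraMap_pos h H h1 hk).ne'

/-- A lower bound for the order of `hessian`, when `x ^ n` and `y` have orders at least `j`. -/
theorem le_order_hessian {P : Plane K} {t : FunctionField K n} (H : IsRegularPoint P t)
    {w : FunctionField K n} {i j k l : ℤ} (hx : HasOrder P (x K n) i) (hy : HasOrder P (y K n) l)
    (hw : HasOrder P w j) (h1 : x K n ^ n / w ∈ localRing K n P) (h2 : y K n / w ∈ localRing K n P)
    (hk : HasOrder P (hessian K n) k) : 3 * j ≤ k + 2 * i + 2 * l := by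
  have hw0 := hw.ne_zero
  have h3 := (hk.mul H ((hx.pow H 2).mul H (hy.pow H 2))).div H (hw.pow H 3)
  have h4 : hessian K n * (x K n ^ 2 * y K n ^ 2) / w ^ 3
      = hessianForm n (x K n ^ n / w) (y K n / w) := by
    have : hessianForm n (x K n ^ n) (y K n)
        = w ^ 3 * hessianForm n (x K n ^ n / w) (y K n / w) := by
      rw [← hessianForm_mul, mul_div_cancel₀ _ hw0, mul_div_cancel₀ _ hw0]
    rw [hessian_mul, this, mul_div_cancel_left₀ _ (pow_ne_zero _ hw0)]
  have h5 : hessianForm n (x K n ^ n / w) (y K n / w) ∈ localRing K n P := by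
    have := map_hessianForm (localRing K n P).val.toRingHom n ⟨_, h1⟩ ⟨_, h2⟩
    have h6 := (hessianForm n (⟨_, h1⟩ : localRing K n P) ⟨_, h2⟩).2
    have h7 : ((hessianForm n (⟨_, h1⟩ : localRing K n P) ⟨_, h2⟩ : localRing K n P) :
      FunctionField K n) = hessianForm n (x K n ^ n / w) (y K n / w) := this
    rwa [h7] at h6
  have h6 := h3.nonneg H (by rw [h4]; exact h5)
  push_cast at h6
  omega

/-- Orders at the fundamental points are explicit, and the lower bounds for the order of `hessian`
that come from the cubic form leave a positive coefficient. -/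
theorem ramification_fundamentalPoint_pos [IsAlgClosed K] (hH : hessian K n ≠ 0)
    (hN : (n : K) ^ 2 - n + 1 ≠ 0) {P : Plane K} (hP : P ∈ fundamentalPoints K) :
    0 < ramification K n P := by
  have h2 : 2 < n := Fact.out
  rcases mem_fundamentalPoints_iff.1 hP with rfl | rfl | rfl
  · have H := isRegularPoint_pointX (K := K) (n := n)
    obtain ⟨k, hk⟩ := exists_hasOrder H hH
    obtain ⟨m, hm⟩ := exists_hasOrder H (partialY_ne_zero (K := K) (n := n))
    have hxn := (hasOrder_pointX_x (K := K) (n := n)).pow H n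
    have h1 := le_order_hessian H hasOrder_pointX_x hasOrder_pointX_y hxn
      ((hxn.div H hxn).mem_localRing H (by omega))
      ((hasOrder_pointX_y.div H hxn).mem_localRing H (by nlinarith)) hk
    rw [ramification, epsilon_of_hessian hH, order_hasseDeriv_two H hk hm,
      differentialOrder_pointX hm, poleOrder_pointX]
    push_cast
    nlinarith
  · have H := isRegularPoint_pointY (K := K) (n := n)
    obtain ⟨k, hk⟩ := exists_hasOrder H hH
    obtain ⟨m, hm⟩ := exists_hasOrder H (partialY_ne_zero (K := K) (n := n))
    have hxn := (hasOrder_pointY_x (K := K) (n := n)).pow H n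
    have hy := hasOrder_pointY_y (K := K) (n := n)
    have h1 := le_order_hessian H hasOrder_pointY_x hy hy
      ((hxn.div H hy).mem_localRing H (by nlinarith))
      ((hy.div H hy).mem_localRing H (by omega)) hk
    rw [ramification, epsilon_of_hessian hH, order_hasseDeriv_two H hk hm,
      differentialOrder_pointY hm, poleOrder_pointY]
    push_cast
    omega
  · have H := isRegularPoint_origin (K := K) (n := n)
    obtain ⟨k, hk⟩ := exists_hasOrder H hH
    have hxn := (hasOrder_origin_x (K := K) (n := n)).pow H n
    have hy := hasOrder_origin_y (K := K) (n := n)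
    have h1 := le_order_hessian H hasOrder_origin_x hy hy
      ((hxn.div H hy).mem_localRing H (by omega))
      ((hy.div H hy).mem_localRing H (by omega)) hk
    rw [ramification_affinePoint_of_hessian hH hN origin_equation hk]
    omega

end RamificationHessian

/-! ### Contact with the tangent line -/

section TangentOrder

open Polynomial

variable {K : Type*} [Field K] {n : ℕ}

theorem restrictToLine_form (v w : Fin 3 → K) : restrictToLine (form K n) v w
    = (C (v 0) + X * C (w 0)) * (C (v 1) + X * C (w 1)) ^ n
      + (C (v 1) + X * C (w 1)) * (C (v 2) + X * C (w 2)) ^ n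
      + (C (v 0) + X * C (w 0)) ^ n * (C (v 2) + X * C (w 2)) := by
  simp [restrictToLine, form]

theorem mem_tangentLine_form (P : Plane K) (w : Fin 3 → K) :
    w ∈ tangentLine (form K n) P ↔
      (P.rep 1 ^ n + n * P.rep 0 ^ (n - 1) * P.rep 2) * w 0
        + (n * P.rep 0 * P.rep 1 ^ (n - 1) + P.rep 2 ^ n) * w 1
        + (n * P.rep 1 * P.rep 2 ^ (n - 1) + P.rep 0 ^ n) * w 2 = 0 := by
  rw [tangentLine, LinearMap.mem_ker, Fin.sum_univ_three]
  simp only [form, LinearMap.add_apply, LinearMap.smul_apply, LinearMap.proj_apply, smul_eq_mul,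
    map_add, Derivation.leibniz, Derivation.leibniz_pow, MvPolynomial.pderiv_X, Pi.single_apply]
  simp
  ring_nf

/-- The equation of the curve, restricted to the line through the points with projective
coordinates `(a, b, 1)` and `(a ξ, b η, 0)`, divided by `a ^ n`. Here `l = b / a ^ n`. -/
def tangentPolynomial (n : ℕ) (l ξ η : K) : K[X] :=
  - C (l + 1) * (1 + C ξ * X) * (1 + C η * X) ^ n + C l * (1 + C η * X) + (1 + C ξ * X) ^ n

theorem coeff_one_add_C_mul_X_pow (η : K) (k : ℕ) :
    ((1 + C η * X) ^ n).coeff k = n.choose k * η ^ k := by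
  have h : (1 + C η * X : K[X]) ^ n = ((1 + X) ^ n).comp (C η * X) := by simp
  rw [h, comp_C_mul_X_coeff, coeff_one_add_X_pow]

theorem coeff_tangentPolynomial (l ξ η : K) (k : ℕ) :
    (tangentPolynomial n l ξ η).coeff (k + 2)
      = - (l + 1) * (n.choose (k + 2) * η ^ (k + 2) + n.choose (k + 1) * η ^ (k + 1) * ξ)
        + n.choose (k + 2) * ξ ^ (k + 2) := by
  have h : tangentPolynomial n l ξ η = C (-(l + 1)) * (1 + C η * X) ^ n
      + C (-(l + 1) * ξ) * (X * (1 + C η * X) ^ n) + (C l + C (l * η) * X)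
      + (1 + C ξ * X) ^ n := by
    simp only [tangentPolynomial, map_neg, map_mul]; ring
  rw [h]
  simp only [coeff_add, coeff_C_mul, coeff_X_mul, coeff_one_add_C_mul_X_pow, coeff_C, coeff_X]
  simp
  ring

theorem coeff_zero_tangentPolynomial (l ξ η : K) : (tangentPolynomial n l ξ η).coeff 0 = 0 := by
  rw [coeff_zero_eq_eval_zero]
  simp [tangentPolynomial]

theorem coeff_one_tangentPolynomial (l κ : K) :
    (tangentPolynomial n l (κ * (n + (n - 1) * l)) (κ * (n - 1 - l))).coeff 1 = 0 := by
  set ξ := κ * (n + (n - 1) * l) with hξ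
  set η := κ * (n - 1 - l) with hη
  have h : tangentPolynomial n l ξ η = C (-(l + 1)) * (1 + C η * X) ^ n
      + C (-(l + 1) * ξ) * (X * (1 + C η * X) ^ n) + (C l + C (l * η) * X)
      + (1 + C ξ * X) ^ n := by
    simp only [tangentPolynomial, map_neg, map_mul]; ring
  rw [h]
  simp only [coeff_add, coeff_C_mul, coeff_X_mul, coeff_one_add_C_mul_X_pow, coeff_C, coeff_X]
  simp [hξ, hη]
  ring

/-- Away from the fundamental points, the order of contact with the tangent line is the order of
vanishing at `0` of the polynomial `tangentPolynomial`. -/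
theorem tangentOrder_eq_emultiplicity [Fact (2 < n)] (hN : (n : K) ^ 2 - n + 1 ≠ 0) {a b : K}
    (ha : a ≠ 0) (hb : b ≠ 0) (h : a * b ^ n + b + a ^ n = 0) {l κ : K} (hl : l = b / a ^ n)
    (hκ : κ ≠ 0) :
    tangentOrder K n (affinePoint a b) = emultiplicity X
      (tangentPolynomial n l (κ * (n + (n - 1) * l)) (κ * (n - 1 - l))) := by
  have hn : 2 < n := Fact.out
  set ξ := κ * (n + (n - 1) * l) with hξ
  set η := κ * (n - 1 - l) with hη
  have hA : a ^ n ≠ 0 := pow_ne_zero _ ha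
  have hbl : b = a ^ n * l := by rw [hl, mul_div_cancel₀ _ hA]
  have hab : a * b ^ n = - (a ^ n * (l + 1)) := by linear_combination h - hbl
  have ha1 : a * a ^ (n - 1) = a ^ n := mul_pow_sub_one (by omega) _
  have hb1 : b * b ^ (n - 1) = b ^ n := mul_pow_sub_one (by omega) _
  obtain ⟨c, hc⟩ := Projectivization.exists_smul_eq_mk_rep K ![a, b, 1] (affine_ne_zero a b)
  have hc0 : (c : K) ≠ 0 := c.ne_zero
  have hrep : (affinePoint a b).rep = ![c * a, c * b, (c : K)] := by
    rw [affinePoint, ← hc]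
    ext i; fin_cases i <;> simp [Units.smul_def]
  have hr0 : (affinePoint a b).rep 0 = c * a := by rw [hrep]; rfl
  have hr1 : (affinePoint a b).rep 1 = c * b := by rw [hrep]; rfl
  have hr2 : (affinePoint a b).rep 2 = c := by rw [hrep]; rfl
  -- the tangent line in terms of the coordinates `w = w 2 • (a, b, 1) + (a * u, b * v, 0)`
  have htan : ∀ w : Fin 3 → K, w ∈ tangentLine (form K n) (affinePoint a b) ↔
      (n - 1 - l) * (w 0 / a - w 2) = (n + (n - 1) * l) * (w 1 / b - w 2) := by
    intro w
    rw [mem_tangentLine_form, hr0, hr1, hr2]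
    have hcn : (c : K) ^ (n - 1) * c = c ^ n := pow_sub_one_mul (by omega) _
    have hcn0 : (c : K) ^ n ≠ 0 := pow_ne_zero _ hc0
    have e1 : ((c * b) ^ n + n * (c * a) ^ (n - 1) * c) * w 0
        + (n * (c * a) * (c * b) ^ (n - 1) + (c : K) ^ n) * w 1
        + (n * (c * b) * (c : K) ^ (n - 1) + (c * a) ^ n) * w 2
        = c ^ n * ((b ^ n + n * a ^ (n - 1)) * w 0 + (n * a * b ^ (n - 1) + 1) * w 1
          + (n * b + a ^ n) * w 2) := by
      simp only [mul_pow]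
      linear_combination (n * a ^ (n - 1) * w 0 + n * a * b ^ (n - 1) * w 1 + n * b * w 2) * hcn
    have e2 : (b ^ n + n * a ^ (n - 1)) * w 0 + (n * a * b ^ (n - 1) + 1) * w 1
          + (n * b + a ^ n) * w 2
        = a ^ n * ((n - 1 - l) * (w 0 / a - w 2) - (n + (n - 1) * l) * (w 1 / b - w 2)) := by
      have e3 : w 0 = a * (w 0 / a) := by field_simp
      have e4 : w 1 = b * (w 1 / b) := by field_simp
      generalize w 0 / a = u at *
      generalize w 1 / b = v at *
      rw [e3, e4]
      linear_combination (u + n * v) * hab + n * u * ha1 + n * a * v * hb1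
        + (v + n * w 2) * hbl
    rw [e1, e2, mul_eq_zero_iff_left hcn0, mul_eq_zero_iff_left hA, sub_eq_zero]
  apply le_antisymm
  · -- the direction `(a ξ, b η, 0)`, rescaled like the representative
    refine iInf₂_le_of_le ![c * (a * ξ), c * (b * η), 0] ?_ (le_of_eq ?_)
    · rw [htan]
      simp only [Matrix.cons_val_zero, Matrix.cons_val_one, Matrix.cons_val]
      rw [hξ, hη]
      field_simp
      ring
    · have e : restrictToLine (form K n) (affinePoint a b).rep ![c * (a * ξ), c * (b * η), 0]
          = C ((c : K) ^ (n + 1) * a ^ n) * tangentPolynomial n l ξ η := by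
        rw [restrictToLine_form, hr0, hr1, hr2]
        simp only [Matrix.cons_val_zero, Matrix.cons_val_one, Matrix.cons_val]
        have hab' := congrArg (C : K → K[X]) hab
        have hbl' := congrArg (C : K → K[X]) hbl
        have f1 : C ((c : K) * a) + X * C (c * (a * ξ)) = C (c : K) * C a * (1 + C ξ * X) := by
          simp only [map_mul]; ring
        have f2 : C ((c : K) * b) + X * C (c * (b * η)) = C (c : K) * C b * (1 + C η * X) := by
          simp only [map_mul]; ring
        rw [f1, f2, tangentPolynomial]
        simp only [map_mul, map_pow, map_neg, map_zero, mul_zero, add_zero, mul_pow] at *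
        linear_combination C (c : K) ^ (n + 1) * (1 + C ξ * X) * (1 + C η * X) ^ n * hab'
          + C (c : K) ^ (n + 1) * (1 + C η * X) * hbl'
      rw [e]
      refine emultiplicity_eq_of_associated_right (Associated.symm ?_)
      refine associated_unit_mul_right _ _ (isUnit_C.2 ?_)
      exact (mul_ne_zero (pow_ne_zero _ hc0) hA).isUnit
  · refine le_iInf₂ fun w hw => ?_
    rw [htan] at hw
    rw [emultiplicity_le_emultiplicity_iff]
    intro j hj
    obtain ⟨β, hβ1, hβ2⟩ : ∃ β, w 0 / a - w 2 = β * ξ ∧ w 1 / b - w 2 = β * η := by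
      by_cases h0 : (n : K) - 1 - l = 0
      · have hl' : l = n - 1 := by linear_combination -h0
        have h1 : (n : K) + (n - 1) * l ≠ 0 := by
          rw [hl']; intro h2; exact hN (by linear_combination h2)
        refine ⟨(w 0 / a - w 2) / ξ, ?_, ?_⟩
        · rw [div_mul_cancel₀]
          exact mul_ne_zero hκ h1
        · rw [h0, zero_mul, eq_comm, mul_eq_zero_iff_left h1] at hw
          rw [hw, hη, h0]; ring
      · have hη0 : η ≠ 0 := mul_ne_zero hκ h0
        refine ⟨(w 1 / b - w 2) / η, ?_, ?_⟩
        · rw [div_mul_eq_mul_div, eq_div_iff hη0]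
          rw [hξ, hη]
          linear_combination κ * hw
        · rw [div_mul_cancel₀ _ hη0]
    -- dividing by the unit `c + w 2 * X` of the ring of power series
    set α : PowerSeries K := PowerSeries.C (c : K) + PowerSeries.C (w 2) * PowerSeries.X with hα
    have hαu : α * α⁻¹ = 1 := PowerSeries.mul_inv_cancel _ (by simp [hα])
    set Z : PowerSeries K := PowerSeries.C β * PowerSeries.X * α⁻¹ with hZ
    obtain ⟨R, hR⟩ := hj
    have key : ((restrictToLine (form K n) (affinePoint a b).rep w : K[X]) : PowerSeries K)
        = PowerSeries.C (a ^ n) * α ^ (n + 1) * aeval Z (tangentPolynomial n l ξ η) := by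
      have hw0 : w 0 = a * (w 2 + β * ξ) := by rw [← hβ1]; field_simp; ring
      have hw1 : w 1 = b * (w 2 + β * η) := by rw [← hβ2]; field_simp; ring
      rw [restrictToLine_form, hr0, hr1, hr2, hw0, hw1, tangentPolynomial]
      have hZα : α * Z = PowerSeries.C β * PowerSeries.X := by
        rw [hZ]; linear_combination PowerSeries.C β * PowerSeries.X * hαu
      have hab' := congrArg (PowerSeries.C : K → PowerSeries K) hab
      have hbl' := congrArg (PowerSeries.C : K → PowerSeries K) hbl
      simp only [map_mul, map_add, map_neg, map_pow, map_one] at hab' hbl'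
      simp only [coe_add, coe_mul, coe_pow, coe_C, coe_X, map_add, map_mul, map_neg, map_pow,
        map_one, aeval_C, aeval_X, PowerSeries.algebraMap_apply, Algebra.algebraMap_self,
        RingHom.id_apply]
      have f1 : PowerSeries.C (c : K) * PowerSeries.C a + PowerSeries.X *
          (PowerSeries.C a * (PowerSeries.C (w 2) + PowerSeries.C β * PowerSeries.C ξ))
          = PowerSeries.C a * (α * (1 + PowerSeries.C ξ * Z)) := by
        rw [hα] at hZα ⊢
        linear_combination - PowerSeries.C a * PowerSeries.C ξ * hZα
      have f2 : PowerSeries.C (c : K) * PowerSeries.C b + PowerSeries.X *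
          (PowerSeries.C b * (PowerSeries.C (w 2) + PowerSeries.C β * PowerSeries.C η))
          = PowerSeries.C b * (α * (1 + PowerSeries.C η * Z)) := by
        rw [hα] at hZα ⊢
        linear_combination - PowerSeries.C b * PowerSeries.C η * hZα
      have f3 : PowerSeries.C (c : K) + PowerSeries.X * PowerSeries.C (w 2) = α := by
        rw [hα]; ring
      rw [f1, f2, f3]
      simp only [mul_pow]
      linear_combination α ^ (n + 1) * (1 + PowerSeries.C ξ * Z) * (1 + PowerSeries.C η * Z) ^ n
        * hab' + α ^ (n + 1) * (1 + PowerSeries.C η * Z) * hbl'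
    rw [hR, map_mul (aeval Z), map_pow (aeval Z), aeval_X] at key
    have hdvd : PowerSeries.X ^ j ∣
        ((restrictToLine (form K n) (affinePoint a b).rep w : K[X]) : PowerSeries K) := by
      rw [key]
      have hXZ : PowerSeries.X ∣ Z := ⟨PowerSeries.C β * α⁻¹, by rw [hZ]; ring⟩
      exact dvd_mul_of_dvd_right (dvd_mul_of_dvd_left (pow_dvd_pow_of_dvd hXZ j) _) _
    rw [X_pow_dvd_iff]
    rw [PowerSeries.X_pow_dvd_iff] at hdvd
    intro d hd
    simpa using hdvd d hd

theorem emultiplicity_X_eq {q : K[X]} {j : ℕ} (h : ∀ k < j, q.coeff k = 0) (hj : q.coeff j ≠ 0) :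
    emultiplicity X q = j := by
  refine emultiplicity_eq_coe.2 ⟨X_pow_dvd_iff.2 h, fun h1 => hj ?_⟩
  exact X_pow_dvd_iff.1 h1 j (Nat.lt_succ_self j)

end TangentOrder

/-! ### Coefficients of the equation on the tangent line -/

section TangentCoefficients

open Polynomial

variable {K : Type*} [Field K] {n : ℕ}

theorem cast_choose_succ_mul {R : Type*} [CommRing R] (n k : ℕ) :
    (n.choose (k + 1) : R) * (k + 1) = n.choose k * (n - k) := by
  rcases le_or_gt k n with h | h
  · have := congrArg (Nat.cast : ℕ → R) (Nat.choose_succ_right_eq n k)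
    push_cast [h] at this
    exact this
  · rw [Nat.choose_eq_zero_of_lt h, Nat.choose_eq_zero_of_lt (Nat.lt_succ_of_lt h)]
    simp

theorem two_mul_cast_choose_two {R : Type*} [CommRing R] (n : ℕ) :
    2 * (n.choose 2 : R) = n * (n - 1) := by
  have h := cast_choose_succ_mul (R := R) n 1
  have h0 := cast_choose_succ_mul (R := R) n 0
  simp at h h0
  linear_combination h

/-- The coefficient of `s ^ 2` in the restriction of the equation to the tangent line is the form
that computes the Hessian of `y`. -/
theorem coeff_two_tangentPolynomial (l κ : K) :
    (tangentPolynomial n l (κ * (n + (n - 1) * l)) (κ * (n - 1 - l))).coeff 2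
      = κ ^ 2 * hessianForm n 1 l := by
  rw [coeff_tangentPolynomial l _ _ 0, hessianForm]
  simp
  ring

section Dvd

variable {p : ℕ} [CharP K p] [Fact p.Prime] {r m : ℕ}

/-- In characteristic `p`, `(1 + X) ^ (p ^ r * m)` is a polynomial in `X ^ p ^ r`. -/
theorem cast_choose_pow_mul (k : ℕ) : ((p ^ r * m).choose k : K)
    = if p ^ r ∣ k then (m.choose (k / p ^ r) : K) else 0 := by
  have hp : 0 < p ^ r := pow_pos (Fact.out (p := p.Prime)).pos r
  have h : (1 + X : K[X]) ^ (p ^ r * m) = expand K (p ^ r) ((1 + X) ^ m) := by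
    rw [pow_mul, add_pow_char_pow]; simp
  have h2 := congrArg (fun q => q.coeff k) h
  simp only [coeff_expand hp, coeff_one_add_X_pow] at h2
  exact h2

/-- If `p` divides `n`, then the tangent line at a ramification point has contact of order
`p ^ r + 1`. -/
theorem emultiplicity_tangentPolynomial_of_dvd (hr : 1 ≤ r) (hm : ¬ p ∣ m) (hn : n = p ^ r * m)
    {l : K} (hl : l ≠ 0) (hl1 : l + 1 ≠ 0) (h : (l + 1) ^ (p ^ r + 1) = l ^ p ^ r) :
    emultiplicity X (tangentPolynomial n l (-1 * (n + (n - 1) * l)) (-1 * (n - 1 - l)))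
      = (p ^ r + 1 : ℕ) := by
  have hq : 2 ≤ p ^ r := two_le_pow p hr
  have hn0 : (n : K) = 0 := natCast_eq_zero_of_eq hr hn
  have hm0 : (m : K) ≠ 0 := cast_ne_zero_of_not_dvd hm
  have hC : ∀ k, (n.choose k : K) = if p ^ r ∣ k then (m.choose (k / p ^ r) : K) else 0 := by
    rw [hn]; exact cast_choose_pow_mul
  have hCq : (n.choose (p ^ r) : K) = m := by
    rw [hC, if_pos dvd_rfl, Nat.div_self (by omega), Nat.choose_one_right]
  have hCq1 : (n.choose (p ^ r + 1) : K) = 0 := by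
    rw [hC, if_neg]
    intro hd
    have := (Nat.dvd_add_right (dvd_refl (p ^ r))).1 hd
    exact absurd (Nat.le_of_dvd one_pos this) (by omega)
  have hCk : ∀ k, 0 < k → k < p ^ r → (n.choose k : K) = 0 := fun k h0 hk => by
    rw [hC, if_neg (fun hd => absurd (Nat.le_of_dvd h0 hd) (by omega))]
  refine emultiplicity_X_eq (fun k hk => ?_) ?_
  · match k with
    | 0 => exact coeff_zero_tangentPolynomial _ _ _
    | 1 => exact coeff_one_tangentPolynomial _ _
    | k + 2 =>
      rw [coeff_tangentPolynomial, hCk (k + 1) (by omega) (by omega)]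
      rcases lt_or_eq_of_le (show k + 2 ≤ p ^ r by omega) with h1 | h1
      · rw [hCk (k + 2) (by omega) h1]; ring
      · rw [h1, hCq, hn0]
        ring_nf at h ⊢
        linear_combination (-(m : K)) * h
  · obtain ⟨k, hk⟩ : ∃ k, p ^ r = k + 1 := ⟨p ^ r - 1, by omega⟩
    rw [hk, coeff_tangentPolynomial, ← hk, show k + 2 = p ^ r + 1 by omega, hCq1, hCq, hn0]
    have : -(l + 1) * (0 * (-1 * (0 - 1 - l)) ^ (p ^ r + 1)
        + m * (-1 * (0 - 1 - l)) ^ p ^ r * (-1 * (0 + (0 - 1) * l)))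
        + 0 * (-1 * (0 + (0 - 1) * l)) ^ (p ^ r + 1) = - ((l + 1) ^ (p ^ r + 1) * m * l) := by
      ring
    rw [this]
    exact neg_ne_zero.2 (mul_ne_zero (mul_ne_zero (pow_ne_zero _ hl1) hm0) hl)

end Dvd

section CharTwo

variable [CharP K 2]

theorem cast_choose_of_mod_four_eq_three (hn : n % 4 = 3) :
    (n : K) = 1 ∧ (n.choose 2 : K) = 1 ∧ (n.choose 3 : K) = 1 := by
  obtain ⟨s, rfl⟩ : ∃ s, n = 4 * s + 3 := ⟨n / 4, by omega⟩
  have h4 : (4 : K) = 0 := by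
    have := CharP.cast_eq_zero K 2
    linear_combination 2 * this
  have h2 : (2 : K) = 0 := by exact_mod_cast CharP.cast_eq_zero K 2
  have e2 : (4 * s + 3).choose 2 = (4 * s + 3) * (2 * s + 1) := by
    rw [Nat.choose_two_right]
    exact Nat.div_eq_of_eq_mul_left two_pos (by rw [Nat.add_sub_assoc (by norm_num)]; ring)
  have e3 : (4 * s + 3).choose 3 * 3 = (4 * s + 3).choose 2 * (4 * s + 1) :=
    Nat.choose_succ_right_eq (4 * s + 3) 2
  have e3' := congrArg (Nat.cast : ℕ → K) e3
  have h1 : ((4 * s + 3 : ℕ) : K) = 1 := by push_cast; linear_combination (2 * s + 1) * h2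
  have hC2 : ((4 * s + 3).choose 2 : K) = 1 := by
    rw [e2]; push_cast; linear_combination (4 * s ^ 2 + 5 * s + 1) * h2
  refine ⟨h1, hC2, ?_⟩
  push_cast [hC2] at e3'
  linear_combination e3' + (2 * s - ((4 * s + 3).choose 3 : K)) * h2

theorem cast_choose_of_mod_four_eq_one (hn : n % 4 = 1) :
    (n : K) = 1 ∧ (n.choose 2 : K) = 0 := by
  obtain ⟨s, rfl⟩ : ∃ s, n = 4 * s + 1 := ⟨n / 4, by omega⟩
  have h2 : (2 : K) = 0 := by exact_mod_cast CharP.cast_eq_zero K 2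
  have e2 : (4 * s + 1).choose 2 = (4 * s + 1) * (2 * s) := by
    rw [Nat.choose_two_right]
    exact Nat.div_eq_of_eq_mul_left two_pos (by rw [Nat.add_sub_cancel]; ring)
  refine ⟨by push_cast; linear_combination 2 * s * h2, ?_⟩
  rw [e2]; push_cast; linear_combination (4 * s + 1) * s * h2

theorem hessianForm_of_mod_four_eq_three (hn : n % 4 = 3) (l : K) :
    hessianForm n 1 l = l ^ 3 + l + 1 := by
  obtain ⟨h1, hC, -⟩ := cast_choose_of_mod_four_eq_three (K := K) hn
  have h2 : (2 : K) = 0 := by exact_mod_cast CharP.cast_eq_zero K 2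
  rw [hessianForm, h1, hC]
  linear_combination (-l ^ 3) * h2

theorem hessianForm_of_mod_four_eq_one (hn : n % 4 = 1) (l : K) :
    hessianForm n 1 l = l * (l + 1) := by
  obtain ⟨h1, hC⟩ := cast_choose_of_mod_four_eq_one (K := K) hn
  rw [hessianForm, h1, hC]
  ring

/-- In characteristic two, the coefficient of `s ^ 3` is `(l ^ 2 + l + 1) ^ 2`, which has no zero in
common with `l ^ 3 + l + 1`. -/
theorem emultiplicity_tangentPolynomial_of_charTwo (hn : n % 4 = 3) {l : K}
    (h : l ^ 3 + l + 1 = 0) :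
    emultiplicity X (tangentPolynomial n l (1 * (n + (n - 1) * l)) (1 * (n - 1 - l)))
      = (3 : ℕ) := by
  have h2 : (2 : K) = 0 := by exact_mod_cast CharP.cast_eq_zero K 2
  obtain ⟨h1, hC2, hC3⟩ := cast_choose_of_mod_four_eq_three (K := K) hn
  refine emultiplicity_X_eq (fun k hk => ?_) ?_
  · interval_cases k
    · exact coeff_zero_tangentPolynomial _ _ _
    · exact coeff_one_tangentPolynomial _ _
    · rw [coeff_two_tangentPolynomial, hessianForm_of_mod_four_eq_three hn, h, mul_zero]
  · rw [coeff_tangentPolynomial _ _ _ 1]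
    simp only [Nat.reduceAdd, hC2, hC3, h1]
    intro h3
    have h4 : (l ^ 2 + l + 1) ^ 2 = 0 := by
      linear_combination h3 + (l ^ 3 + 2 * l ^ 2 + l) * h2
    have h5 : l ^ 2 + l + 1 = 0 := pow_eq_zero_iff two_ne_zero |>.1 h4
    exact one_ne_zero (α := K) (by
      linear_combination h5 - (l + 1) * (h - (l - 1) * h5 - h2))

end CharTwo

section OddCharacteristic

variable {p : ℕ} [Algebra (ZMod p) K]

theorem aeval_cubic (l : K) : aeval l (cubic (ZMod p) n) = ((n : K) - 1) * l ^ 3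
    + ((n : K) ^ 3 - 3 * n ^ 2 + 6 * n - 2) * l ^ 2 + ((n : K) ^ 3 - 3 * n ^ 2 + 3 * n + 1) * l
    - ((n : K) - 1) := by
  have h (k : ℕ) [k.AtLeastTwo] : algebraMap (ZMod p) K ofNat(k) = ofNat(k) := map_ofNat _ k
  simp [cubic, h]

/-- Up to the factor `n / 2`, the cubic form is the polynomial `cubic`. -/
theorem two_mul_hessianForm (l : K) :
    2 * hessianForm n 1 l = n * aeval l (cubic (ZMod p) n) := by
  rw [aeval_cubic, hessianForm]
  linear_combination (((n - 1) * l + n) ^ 2 - (l + 1) * (n - 1 - l) ^ 2)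
    * two_mul_cast_choose_two (R := K) n

theorem hessianForm_eq_zero_iff (h2 : (2 : K) ≠ 0) (hn : (n : K) ≠ 0) (l : K) :
    hessianForm n 1 l = 0 ↔ aeval l (cubic (ZMod p) n) = 0 := by
  rw [← mul_eq_zero_iff_left h2, two_mul_hessianForm (p := p), mul_eq_zero_iff_left hn]

theorem ne_zero_of_aeval_cubic (hn1 : (n : K) ≠ 1) {l : K}
    (h : aeval l (cubic (ZMod p) n) = 0) : l ≠ 0 ∧ l + 1 ≠ 0 := by
  rw [aeval_cubic] at h
  constructor
  · rintro rfl
    exact hn1 (by linear_combination -h)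
  · intro hl
    obtain rfl : l = -1 := by linear_combination hl
    exact hn1 (by linear_combination h)

/-- If `n ^ 2 - 4 * n + 7` is not zero, then the contact with the tangent line at a zero of the
Hessian has order exactly three. -/
theorem emultiplicity_tangentPolynomial_of_ne (h2 : (2 : K) ≠ 0) (hn : (n : K) ≠ 0)
    (hn1 : (n : K) ≠ 1) (hN : (n : K) ^ 2 - n + 1 ≠ 0) (h7 : (n : K) ^ 2 - 4 * n + 7 ≠ 0) {l : K}
    (hl1 : l + 1 ≠ 0) (hH : hessianForm n 1 l = 0) :
    emultiplicity X (tangentPolynomial n l (1 * (n + (n - 1) * l)) (1 * (n - 1 - l)))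
      = (3 : ℕ) := by
  have hn1' : (n : K) - 1 ≠ 0 := sub_ne_zero.2 hn1
  have hc2 : (tangentPolynomial n l (1 * (n + (n - 1) * l)) (1 * (n - 1 - l))).coeff 2 = 0 := by
    rw [coeff_two_tangentPolynomial, hH, mul_zero]
  have hC2 := two_mul_cast_choose_two (R := K) n
  have hC3 := cast_choose_succ_mul (R := K) n 2
  refine emultiplicity_X_eq (fun k hk => ?_) fun hc3 => ?_
  · interval_cases k
    · exact coeff_zero_tangentPolynomial _ _ _
    · exact coeff_one_tangentPolynomial _ _
    · exact hc2
  have hL : (l + 1) * ((n - 1) * (1 * (n - 1 - l)) + 1 * (n + (n - 1) * l))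
      = n * (1 * (n + (n - 1) * l)) - 1 * (n - 1 - l) := by ring
  have hne : (n - 1) * (1 * (n - 1 - l)) + 1 * (n + (n - 1) * l) ≠ 0 := by
    convert hN using 1; ring
  rw [coeff_tangentPolynomial _ _ _ 0] at hc2
  rw [coeff_tangentPolynomial _ _ _ 1] at hc3
  generalize (1 : K) * (n + (n - 1) * l) = ξ at *
  generalize (1 : K) * (n - 1 - l) = η at *
  generalize l + 1 = L at *
  simp only [zero_add, Nat.choose_one_right, Nat.reduceAdd, pow_one] at hc2 hc3
  push_cast at hC3
  -- the coefficients of `s ^ 2` and `s ^ 3`, multiplied by `2 / n` and `6 / (n * (n - 1))`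
  have e2 : (n - 1) * (ξ ^ 2 - L * η ^ 2) = 2 * L * η * ξ :=
    mul_left_cancel₀ hn (by linear_combination 2 * hc2 - (ξ ^ 2 - L * η ^ 2) * hC2)
  have e3 : (n - 2) * (ξ ^ 3 - L * η ^ 3) = 3 * L * η ^ 2 * ξ :=
    mul_left_cancel₀ (mul_ne_zero hn hn1') (by
      linear_combination 6 * hc3 - 2 * (ξ ^ 3 - L * η ^ 3) * hC3
        - ((n - 2) * (ξ ^ 3 - L * η ^ 3) - 3 * L * η ^ 2 * ξ) * hC2)
  have hη : η ≠ 0 := by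
    rintro rfl
    have : (n - 1) * ξ ^ 2 = 0 := by linear_combination e2
    rw [mul_eq_zero_iff_left hn1', pow_eq_zero_iff two_ne_zero] at this
    rw [this] at hne
    simp at hne
  -- the ratio `z = ξ / η` satisfies two polynomial equations without common zero
  obtain ⟨z, rfl⟩ : ∃ z, ξ = z * η := ⟨ξ / η, by field_simp⟩
  have f1 : L * (n - 1 + z) = n * z - 1 := mul_right_cancel₀ hη (by linear_combination hL)
  have f2 : (n - 1) * z ^ 2 = L * (n - 1 + 2 * z) :=
    mul_right_cancel₀ (pow_ne_zero 2 hη) (by linear_combination e2)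
  have f3 : (n - 2) * z ^ 3 = L * (n - 2 + 3 * z) :=
    mul_right_cancel₀ (pow_ne_zero 3 hη) (by linear_combination e3)
  have hz : z ≠ 0 := by
    rintro rfl
    exact mul_ne_zero hl1 hn1' (by linear_combination -f2)
  have q2 : 2 * (n - 2) * z ^ 2 + (n - 1) * (n - 5) * z - (n - 1) * (n - 2) = 0 :=
    mul_left_cancel₀ hl1 (by linear_combination (n - 1) * f3 - (n - 2) * z * f2)
  have q3 : (n - 1) * z ^ 3 + ((n - 1) ^ 2 - 2 * n) * z ^ 2 - (n - 2) * (n + 1) * z + (n - 1)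
      = 0 := by
    linear_combination (n - 1 + z) * f2 + (n - 1 + 2 * z) * f1
  have hz2 : (n - 1) * z = n := by
    have : ((n : K) ^ 2 - 4 * n + 7) * z * ((n - 1) * z - n) = 0 := by
      linear_combination 2 * (n - 2) * q3 - ((n - 1) * z - 2) * q2
    rw [mul_eq_zero_iff_left (mul_ne_zero h7 hz)] at this
    linear_combination this
  refine mul_ne_zero h2 hN ?_
  linear_combination (2 * (n - 2) * ((n - 1) * z + n) + (n - 1) ^ 2 * (n - 5)) * hz2
    - (n - 1) ^ 2 * q2

/-- If `n ^ 2 - 4 * n + 7 = 0`, then the cubic has a triple zero, which is a primitive cube root of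
unity. -/
theorem root_of_aeval_cubic (hn1 : (n : K) ≠ 1) (h7 : (n : K) ^ 2 - 4 * n + 7 = 0) {l : K}
    (h : aeval l (cubic (ZMod p) n) = 0) : l ^ 2 + l + 1 = 0 ∧ (n : K) = 1 - 2 * l := by
  rw [aeval_cubic] at h
  have h3 : ((n - 1) * l + (n - 3)) ^ 3 = 0 := by
    linear_combination (n - 1) ^ 2 * h + (-(n - 1) ^ 2 * (n + 1) * l ^ 2
      - (n - 1) * (n ^ 2 - 4) * l + 2 * (n - 2)) * h7
  have h1 : (n - 1) * l + (n - 3) = 0 := pow_eq_zero_iff three_ne_zero |>.1 h3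
  have hl : l ^ 2 + l + 1 = 0 := by
    refine (mul_eq_zero_iff_left (pow_ne_zero 2 (sub_ne_zero.2 hn1))).1 ?_
    linear_combination h7 + ((n - 1) * l + 2) * h1
  refine ⟨hl, ?_⟩
  linear_combination -l * h1 + (n - 1) * hl

/-- If `n ^ 2 - 4 * n + 7 = 0`, then the contact with the tangent line at a zero of the Hessian has
order five. -/
theorem emultiplicity_tangentPolynomial_of_eq (h2 : (2 : K) ≠ 0) (hn : (n : K) ≠ 0)
    (hN : (n : K) ^ 2 - n + 1 ≠ 0) {l : K} (hl : l ^ 2 + l + 1 = 0) (hnl : (n : K) = 1 - 2 * l) :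
    emultiplicity X (tangentPolynomial n l (3⁻¹ * (n + (n - 1) * l)) (3⁻¹ * (n - 1 - l)))
      = (5 : ℕ) := by
  have h3 : (3 : K) ≠ 0 := fun h3 => hN (by rw [hnl]; linear_combination 4 * hl - (2 * l + 1) * h3)
  have hl0 : l ≠ 0 := by rintro rfl; simp at hl
  -- with this scaling, the direction of the tangent line is `ξ = 1`, `η = -l`
  have hξ : (3 : K)⁻¹ * (n + (n - 1) * l) = 1 := by
    rw [hnl]; field_simp; linear_combination -2 * hl
  have hη : (3 : K)⁻¹ * (n - 1 - l) = -l := by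
    rw [hnl]; field_simp; ring
  have hC2 : (n.choose 2 : K) = - l * n := mul_left_cancel₀ h2 (by
    rw [two_mul_cast_choose_two]; linear_combination n * hnl)
  have hC3 := cast_choose_succ_mul (R := K) n 2
  have hC4 := cast_choose_succ_mul (R := K) n 3
  have hC5 := cast_choose_succ_mul (R := K) n 4
  simp only [Nat.reduceAdd, hnl] at hC3 hC4 hC5
  push_cast at hC3 hC4 hC5
  refine emultiplicity_X_eq (fun k hk => ?_) ?_
  · interval_cases k
    · exact coeff_zero_tangentPolynomial _ _ _
    · exact coeff_one_tangentPolynomial _ _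
    · rw [coeff_tangentPolynomial _ _ _ 0, hξ, hη]
      simp only [zero_add, Nat.choose_one_right, hC2]
      linear_combination n * l ^ 2 * hl
    · rw [coeff_tangentPolynomial _ _ _ 1, hξ, hη]
      refine (mul_eq_zero_iff_left h3).1 ?_
      simp only [Nat.reduceAdd]
      linear_combination (l ^ 4 + l ^ 3 + 1) * hC3
        - n.choose 2 * (2 * l ^ 3 + l ^ 2 + l + 1) * hl
    · rw [coeff_tangentPolynomial _ _ _ 2, hξ, hη]
      refine (mul_eq_zero_iff_left (mul_ne_zero h2 h2)).1 ?_
      simp only [Nat.reduceAdd]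
      linear_combination (1 - l ^ 5 - l ^ 4) * hC4
        + 2 * n.choose 3 * (l + 1) * (l ^ 3 + l - 1) * hl
  · rw [coeff_tangentPolynomial _ _ _ 3, hξ, hη]
    have hC4' : (n.choose 4 : K) ≠ 0 := by
      intro h4
      have hl1 : (-2 - 2 * l) ≠ 0 := fun h0 =>
        mul_ne_zero h2 (pow_ne_zero 2 hl0) (by linear_combination 2 * hl + h0)
      have hl2 : (-1 - 2 * l) ≠ 0 := fun h0 =>
        h3 (by linear_combination 4 * hl + (2 * l + 1) * h0)
      have h5 : (n.choose 3 : K) * (-2 - 2 * l) = 0 := by linear_combination 4 * h4 - hC4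
      have h6 := (mul_eq_zero_iff_right hl1).1 h5
      have h7 : (n.choose 2 : K) * (-1 - 2 * l) = 0 := by linear_combination 3 * h6 - hC3
      have h8 := (mul_eq_zero_iff_right hl2).1 h7
      rw [hC2] at h8
      exact mul_ne_zero (neg_ne_zero.2 hl0) hn h8
    intro h5
    simp only [Nat.reduceAdd] at h5
    refine mul_ne_zero hl0 hC4' ?_
    linear_combination -5 * h5 + (l ^ 6 + l ^ 5 + 1) * hC5
      - n.choose 4 * (2 * l ^ 5 + 3 * l ^ 4 + 3 * l ^ 3 - l ^ 2 - 2 * l + 3) * hl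

end OddCharacteristic

end TangentCoefficients

/-! ### The support of the ramification divisor -/

section Support

variable {K : Type*} [Field K] {n : ℕ}

/-- The points of the support of the ramification divisor with nonzero coordinates. -/
def torusRamification (K : Type*) [Field K] (n : ℕ) [Fact (2 < n)] : Set (Plane K) :=
  {P | ∃ a b : K, a ≠ 0 ∧ b ≠ 0 ∧ a * b ^ n + b + a ^ n = 0 ∧ P = affinePoint a b ∧
    ramification K n P ≠ 0}

theorem ramificationSupport_eq_union [Fact (2 < n)]
    (h : ∀ P ∈ fundamentalPoints K, ramification K n P ≠ 0) :
    ramificationSupport K n = fundamentalPoints K ∪ torusRamification K n := by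
  ext P
  constructor
  · rintro ⟨hP, hR⟩
    rcases mem_curve_cases hP with h0 | ⟨a, b, ha, hb, hab, rfl⟩
    · exact Or.inl h0
    · exact Or.inr ⟨a, b, ha, hb, hab, rfl, hR⟩
  · rintro (h0 | ⟨a, b, ha, hb, hab, rfl, hR⟩)
    · exact ⟨fundamentalPoints_subset_curve h0, h P h0⟩
    · exact ⟨affinePoint_mem_curve_iff.2 hab, hR⟩

theorem ramificationSupport_eq_torusRamification [Fact (2 < n)]
    (h : ∀ P ∈ fundamentalPoints K, ramification K n P = 0) :
    ramificationSupport K n = torusRamification K n := by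
  ext P
  constructor
  · rintro ⟨hP, hR⟩
    rcases mem_curve_cases hP with h0 | ⟨a, b, ha, hb, hab, rfl⟩
    · exact absurd (h P h0) hR
    · exact ⟨a, b, ha, hb, hab, rfl, hR⟩
  · rintro ⟨a, b, ha, hb, hab, rfl, hR⟩
    exact ⟨affinePoint_mem_curve_iff.2 hab, hR⟩

/-- The points `(l : t ^ n : t ^ (n - 1))`, in terms of the affine coordinates `a` and `b`:
here `l = a * b ^ (n - 1)` and `t = b`. -/
theorem exists_mk_pow_iff (hn : n ≠ 0) {P : Plane K} {C : K → K → Prop}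
    (hC : ∀ l t, C l t → l ≠ 0 ∧ t ≠ 0) :
    (∃ (l t : K) (h : ![l, t ^ n, t ^ (n - 1)] ≠ 0), P = Projectivization.mk K _ h ∧ C l t) ↔
      ∃ a b : K, a ≠ 0 ∧ b ≠ 0 ∧ P = affinePoint a b ∧ C (a * b ^ (n - 1)) b := by
  constructor
  · rintro ⟨l, t, h, rfl, hlt⟩
    obtain ⟨hl, ht⟩ := hC l t hlt
    have ht1 : t ^ (n - 1) ≠ 0 := pow_ne_zero _ ht
    refine ⟨l / t ^ (n - 1), t, div_ne_zero hl ht1, ht, ?_, by rwa [div_mul_cancel₀ _ ht1]⟩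
    rw [affinePoint, Projectivization.mk_eq_mk_iff']
    refine ⟨t ^ (n - 1), ?_⟩
    rw [← pow_sub_one_mul hn t]
    ext i; fin_cases i <;> simp [mul_div_cancel₀ _ ht1]
  · rintro ⟨a, b, ha, hb, rfl, hab⟩
    have hb1 : b ^ (n - 1) ≠ 0 := pow_ne_zero _ hb
    refine ⟨a * b ^ (n - 1), b, fun h => hb1 (by simpa using congrFun h 2), ?_, hab⟩
    rw [affinePoint, eq_comm, Projectivization.mk_eq_mk_iff']
    refine ⟨b ^ (n - 1), ?_⟩
    rw [← pow_sub_one_mul hn b]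
    ext i; fin_cases i <;> simp [mul_comm]

/-- The points `(t : l * t ^ n : 1)`, in terms of the affine coordinates `a` and `b`: here
`l = b / a ^ n` and `t = a`. -/
theorem exists_mk_mul_pow_iff {P : Plane K} {C : K → K → Prop}
    (hC : ∀ l t, C l t → l ≠ 0 ∧ t ≠ 0) :
    (∃ (l t : K) (h : ![t, l * t ^ n, 1] ≠ 0), P = Projectivization.mk K _ h ∧ C l t) ↔
      ∃ a b : K, a ≠ 0 ∧ b ≠ 0 ∧ P = affinePoint a b ∧ C (b / a ^ n) a := by
  constructor
  · rintro ⟨l, t, h, rfl, hlt⟩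
    obtain ⟨hl, ht⟩ := hC l t hlt
    have ht1 : t ^ n ≠ 0 := pow_ne_zero _ ht
    exact ⟨t, l * t ^ n, ht, mul_ne_zero hl ht1, rfl, by rwa [mul_div_cancel_right₀ _ ht1]⟩
  · rintro ⟨a, b, ha, hb, rfl, hab⟩
    have e : b / a ^ n * a ^ n = b := div_mul_cancel₀ _ (pow_ne_zero _ ha)
    refine ⟨b / a ^ n, a, fun h => one_ne_zero (α := K) (by simpa using congrFun h 2), ?_, hab⟩
    simp only [e, affinePoint]

theorem curve_exponent [Fact (2 < n)] :
    n * (n - 1) + 1 = n ^ 2 - n + 1 ∧ n ^ 2 = (n - 1) + (n ^ 2 - n + 1) := by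
  obtain ⟨k, rfl⟩ : ∃ k, n = k + 1 := ⟨n - 1, by have : 2 < n := Fact.out; omega⟩
  have : (k + 1) ^ 2 - (k + 1) = (k + 1) * k := by
    rw [show (k + 1) ^ 2 = (k + 1) * k + (k + 1) by ring, Nat.add_sub_cancel]
  rw [this, Nat.add_sub_cancel]
  exact ⟨rfl, by ring⟩

/-- The equation of the curve in terms of `l = a * b ^ (n - 1)` and `t = b`. -/
theorem curve_equation_iff_left [Fact (2 < n)] {a b : K} (hb : b ≠ 0) :
    a * b ^ n + b + a ^ n = 0 ↔
      b ^ (n ^ 2 - n + 1) * (a * b ^ (n - 1) + 1) + (a * b ^ (n - 1)) ^ n = 0 := by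
  have hn : n ≠ 0 := by have : 2 < n := Fact.out; omega
  rw [← mul_eq_zero_iff_left (pow_ne_zero (n * (n - 1)) hb), ← curve_exponent.1, mul_pow,
    ← pow_sub_one_mul hn b, ← pow_mul, mul_comm (n - 1) n, pow_succ]
  ring_nf

/-- The equation of the curve in terms of `l = b / a ^ n` and `t = a`. -/
theorem curve_equation_iff_right [Fact (2 < n)] {a b : K} (ha : a ≠ 0) :
    a * b ^ n + b + a ^ n = 0 ↔
      a ^ (n ^ 2 - n + 1) * (b / a ^ n) ^ n + b / a ^ n + 1 = 0 := by
  have hn : 2 < n := Fact.out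
  have ha1 := pow_ne_zero n ha
  obtain ⟨l, rfl⟩ : ∃ l, b = l * a ^ n := ⟨b / a ^ n, (div_mul_cancel₀ _ ha1).symm⟩
  rw [mul_div_cancel_right₀ _ ha1, ← mul_eq_zero_iff_left ha1 (b := _ + _ + 1)]
  have e : a * (a ^ n) ^ n = a ^ n * a ^ (n ^ 2 - n + 1) := by
    rw [← pow_mul, ← pow_two, curve_exponent.2, ← pow_succ', ← pow_add]
    congr 1; omega
  rw [mul_pow]
  refine Eq.congr_left ?_
  linear_combination l ^ n * e

/-- The relation between the two coordinates `b / a ^ n` and `a * b ^ (n - 1)` of a point of the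
curve. -/
theorem mul_pow_mul_div [Fact (2 < n)] {a b : K} (ha : a ≠ 0)
    (h : a * b ^ n + b + a ^ n = 0) : a * b ^ (n - 1) * (b / a ^ n) = - (b / a ^ n + 1) := by
  have hn : n ≠ 0 := by have : 2 < n := Fact.out; omega
  rw [← pow_sub_one_mul hn b] at h
  field_simp
  linear_combination h

theorem div_add_one_ne_zero [Fact (2 < n)] {a b : K} (ha : a ≠ 0) (hb : b ≠ 0)
    (h : a * b ^ n + b + a ^ n = 0) : b / a ^ n + 1 ≠ 0 := by
  have := mul_ne_zero (mul_ne_zero ha (pow_ne_zero (n - 1) hb)) (div_ne_zero hb (pow_ne_zero n ha))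
  rw [mul_pow_mul_div ha h] at this
  exact neg_ne_zero.1 this

theorem pow_eq_zpow_iff {p r : ℕ} (hq : p ^ r ≤ n) {l t : K} (hl : l ≠ 0) :
    t ^ (n ^ 2 - n + 1) = l ^ ((n : ℤ) - (p : ℤ) ^ r - 1) ↔
      t ^ (n ^ 2 - n + 1) * l = l ^ (n - p ^ r) := by
  have e : l ^ ((n : ℤ) - (p : ℤ) ^ r - 1) * l = l ^ (n - p ^ r) := by
    rw [← zpow_add_one₀ hl, ← zpow_natCast]
    congr 1
    push_cast [hq]
    ring
  rw [← e, mul_left_inj' hl]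

theorem ne_zero_of_pow_eq_zpow {l t : K} {z : ℤ}
    (h : t ^ (n ^ 2 - n + 1) = l ^ z) (hl : l ≠ 0) : t ≠ 0 := by
  rintro rfl
  rw [zero_pow (by omega)] at h
  exact zpow_ne_zero _ hl h.symm

/-- For a primitive cube root of unity `l`, the two forms of the condition on `t` agree, because
`-(l + 1) = l ^ 2` and `l ^ 3 = 1`. -/
theorem neg_add_one_mul_zpow {l : K} (hl : l ^ 2 + l + 1 = 0) :
    -(l + 1) * l ^ (-(n : ℤ)) = l ^ (2 * (n + 1)) := by
  have hl0 : l ≠ 0 := by rintro rfl; simp at hl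
  have h3 : l ^ 3 = 1 := by linear_combination (l - 1) * hl
  rw [zpow_neg, zpow_natCast, ← div_eq_mul_inv, div_eq_iff (pow_ne_zero n hl0), ← pow_add,
    show 2 * (n + 1) + n = 3 * n + 2 by ring, pow_add, pow_mul, h3, one_pow]
  linear_combination -hl

theorem smooth_of_charTwo [CharP K 2] (hn : n % 4 = 3) : (n : K) ^ 2 - n + 1 ≠ 0 := by
  rw [(cast_choose_of_mod_four_eq_three (K := K) hn).1]; simp

theorem setOf_eq_of_eq {p : ℕ} [Algebra (ZMod p) K] (hn1 : (n : K) ≠ 1)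
    (h7 : (n : K) ^ 2 - 4 * n + 7 = 0) :
    {P : Plane K | ∃ (l t : K) (h : ![t, l * t ^ n, 1] ≠ 0),
      P = Projectivization.mk K _ h ∧ t ^ (n ^ 2 - n + 1) = -(l + 1) * l ^ (-(n : ℤ)) ∧
      Polynomial.aeval l (cubic (ZMod p) n) = 0}
    = {P | ∃ (l t : K) (h : ![t, l * t ^ n, 1] ≠ 0),
      P = Projectivization.mk K _ h ∧ t ^ (n ^ 2 - n + 1) = l ^ (2 * (n + 1)) ∧
      Polynomial.aeval l (cubic (ZMod p) n) = 0} := by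
  ext P
  refine exists_congr fun l => exists_congr fun t => exists_congr fun h => ?_
  refine and_congr_right fun _ => and_congr_left fun h0 => ?_
  rw [neg_add_one_mul_zpow (root_of_aeval_cubic hn1 h7 h0).1]

section Dvd

variable {p : ℕ} [Fact (2 < n)] {r m : ℕ}

/-- The equations of the ramification points when `p` divides `n`. -/
theorem equations_iff_of_dvd (hn : n = p ^ r * m) {a b : K} (ha : a ≠ 0)
    (hb : b ≠ 0) :
    (a * b ^ n + b + a ^ n = 0 ∧ a * b ^ (n - p ^ r + n * p ^ r) - a ^ (n - p ^ r) = 0) ↔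
      b ^ (n ^ 2 - n + 1) = (a * b ^ (n - 1)) ^ ((n : ℤ) - (p : ℤ) ^ r - 1) ∧
        (a * b ^ (n - 1)) ^ (p ^ r + 1) + a * b ^ (n - 1) + 1 = 0 := by
  have hn2 : 2 < n := Fact.out
  have hB : b ^ (n - 1) ≠ 0 := pow_ne_zero _ hb
  have hq := pow_le_of_eq hn
  rw [curve_equation_iff_left hb, pow_eq_zpow_iff hq (mul_ne_zero ha hB)]
  obtain ⟨s, hs⟩ : ∃ s, n - p ^ r = s := ⟨_, rfl⟩
  have hsn : s + p ^ r = n := by omega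
  rw [hs]
  have e1 : a * b ^ (s + n * p ^ r) - a ^ s = 0 ↔
      b ^ (n ^ 2 - n + 1) * (a * b ^ (n - 1)) = (a * b ^ (n - 1)) ^ s := by
    rw [sub_eq_zero, ← mul_left_inj' (pow_ne_zero s hB)]
    have e2 : b ^ (s + n * p ^ r) * (b ^ (n - 1)) ^ s = b ^ (n ^ 2 - n + 1) * b ^ (n - 1) := by
      rw [← pow_mul, ← pow_add, ← pow_add]
      congr 1
      have := (curve_exponent (n := n)).2
      obtain ⟨k, rfl⟩ : ∃ k, n = k + 1 := ⟨n - 1, by omega⟩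
      rw [Nat.add_sub_cancel] at this ⊢
      rw [add_comm, add_comm (_ + 1), ← this]
      nlinarith
    rw [mul_assoc, e2, mul_pow]
    refine Eq.congr_left ?_
    ring
  rw [e1]
  have hl := mul_ne_zero ha hB
  generalize a * b ^ (n - 1) = l at *
  rw [and_comm, and_congr_right_iff]
  intro h1
  have hnl : l ^ n * l = l ^ s * l ^ (p ^ r + 1) := by
    rw [← pow_succ, ← pow_add]; congr 1; omega
  have key : l * (b ^ (n ^ 2 - n + 1) * (l + 1) + l ^ n) = l ^ s * (l ^ (p ^ r + 1) + l + 1) := by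
    linear_combination (l + 1) * h1 + hnl
  rw [← mul_eq_zero_iff_left hl (b := b ^ (n ^ 2 - n + 1) * (l + 1) + l ^ n), key,
    mul_eq_zero_iff_left (pow_ne_zero s hl)]

variable [CharP K p] [Fact p.Prime]

theorem torusRamification_of_dvd (hr : 1 ≤ r) (hm : ¬ p ∣ m) (hn : n = p ^ r * m) :
    torusRamification K n = {P | ∃ (l t : K) (h : ![l, t ^ n, t ^ (n - 1)] ≠ 0),
      P = Projectivization.mk K _ h ∧
      t ^ (n ^ 2 - n + 1) = l ^ ((n : ℤ) - (p : ℤ) ^ r - 1) ∧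
      l ^ (p ^ r + 1) + l + 1 = 0} := by
  have hn2 : 2 < n := Fact.out
  ext P
  rw [Set.mem_ofPred_eq, exists_mk_pow_iff (by omega)
    (C := fun l t => t ^ (n ^ 2 - n + 1) = l ^ ((n : ℤ) - (p : ℤ) ^ r - 1) ∧
      l ^ (p ^ r + 1) + l + 1 = 0)]
  · refine exists_congr fun a => exists_congr fun b => ?_
    refine and_congr_right fun ha => and_congr_right fun hb => ?_
    rw [← equations_iff_of_dvd hn ha hb]
    constructor
    · rintro ⟨h, rfl, hR⟩
      exact ⟨rfl, h, (ramification_affinePoint_ne_zero_iff_of_dvd hr hm hn h).1 hR⟩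
    · rintro ⟨rfl, h, hR⟩
      exact ⟨h, rfl, (ramification_affinePoint_ne_zero_iff_of_dvd hr hm hn h).2 hR⟩
  · rintro l t ⟨h1, h2⟩
    have hl : l ≠ 0 := by
      rintro rfl
      simp at h2
    exact ⟨hl, ne_zero_of_pow_eq_zpow h1 hl⟩

theorem tangentOrder_of_dvd (hr : 1 ≤ r) (hm : ¬ p ∣ m) (hn : n = p ^ r * m) {P : Plane K}
    (hP : P ∈ torusRamification K n) : tangentOrder K n P = (p ^ r + 1 : ℕ) := by
  obtain ⟨a, b, ha, hb, h, rfl, hR⟩ := hP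
  have hn0 : (n : K) = 0 := natCast_eq_zero_of_eq hr hn
  have hN : (n : K) ^ 2 - n + 1 ≠ 0 := by rw [hn0]; simp
  rw [ramification_affinePoint_ne_zero_iff_of_dvd hr hm hn h] at hR
  have h1 := ((equations_iff_of_dvd hn ha hb).1 ⟨h, hR⟩).2
  have h2 := mul_pow_mul_div ha h
  have hl0 : b / a ^ n ≠ 0 := div_ne_zero hb (pow_ne_zero n ha)
  rw [tangentOrder_eq_emultiplicity hN ha hb h rfl (neg_ne_zero.2 one_ne_zero)]
  refine emultiplicity_tangentPolynomial_of_dvd hr hm hn hl0 (div_add_one_ne_zero ha hb h) ?_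
  generalize b / a ^ n = l at *
  generalize a * b ^ (n - 1) = w at *
  have h3 : w ^ (p ^ r + 1) * l ^ (p ^ r + 1) = (l + 1) ^ (p ^ r + 1) := by
    rw [← mul_pow, h2, neg_pow, pow_succ (-1 : K), neg_one_pow_char_pow]; ring
  linear_combination l ^ (p ^ r + 1) * h1 - h3 - l ^ p ^ r * h2

end Dvd

section Hessian

variable [Fact (2 < n)]

theorem mem_torusRamification_iff (hH : hessian K n ≠ 0) (hN : (n : K) ^ 2 - n + 1 ≠ 0)
    {P : Plane K} : P ∈ torusRamification K n ↔ ∃ a b : K, a ≠ 0 ∧ b ≠ 0 ∧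
      P = affinePoint a b ∧ a * b ^ n + b + a ^ n = 0 ∧ hessianForm n 1 (b / a ^ n) = 0 := by
  refine exists_congr fun a => exists_congr fun b => ?_
  refine and_congr_right fun ha => and_congr_right fun hb => ?_
  constructor
  · rintro ⟨h, rfl, hR⟩
    exact ⟨rfl, h, (ramification_affinePoint_ne_zero_iff hH hN ha hb h).1 hR⟩
  · rintro ⟨rfl, h, hR⟩
    exact ⟨h, rfl, (ramification_affinePoint_ne_zero_iff hH hN ha hb h).2 hR⟩

variable [IsAlgClosed K]

theorem ramificationSupport_of_hessian (hH : hessian K n ≠ 0) (hN : (n : K) ^ 2 - n + 1 ≠ 0) :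
    ramificationSupport K n = fundamentalPoints K ∪ torusRamification K n :=
  ramificationSupport_eq_union fun _ hP => (ramification_fundamentalPoint_pos hH hN hP).ne'

/-- If the only zeros of the cubic form are the values `0` and `-1`, which `b / a ^ n` does not take on
the curve, then only the fundamental points ramify. -/
theorem ramificationSupport_eq_fundamentalPoints (hH : hessian K n ≠ 0)
    (hN : (n : K) ^ 2 - n + 1 ≠ 0)
    (h : ∀ l : K, hessianForm n 1 l = 0 → l = 0 ∨ l + 1 = 0) :
    ramificationSupport K n = fundamentalPoints K := by
  rw [ramificationSupport_of_hessian hH hN, Set.union_eq_left]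
  intro P hP
  obtain ⟨a, b, ha, hb, -, hab, h0⟩ := (mem_torusRamification_iff hH hN).1 hP
  rcases h _ h0 with h1 | h1
  · exact absurd h1 (div_ne_zero hb (pow_ne_zero n ha))
  · exact absurd h1 (div_add_one_ne_zero ha hb hab)

section CharTwo

variable [CharP K 2]

theorem hessian_ne_zero_of_mod_four_eq_three (hn : n % 4 = 3) : hessian K n ≠ 0 :=
  hessian_ne_zero 0 (by rw [hessianForm_of_mod_four_eq_three hn]; simp)

theorem hessian_ne_zero_of_mod_four_eq_one (hn : n % 4 = 1) : hessian K n ≠ 0 := by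
  have := IsAlgClosed.instInfinite (K := K)
  classical
  obtain ⟨c, hc⟩ := Infinite.exists_notMem_finset ({0, -1} : Finset K)
  simp only [Finset.mem_insert, Finset.mem_singleton, not_or] at hc
  refine hessian_ne_zero c ?_
  rw [hessianForm_of_mod_four_eq_one hn]
  exact mul_ne_zero hc.1 fun h => hc.2 (eq_neg_of_add_eq_zero_left h)

theorem torusRamification_of_charTwo (hn : n % 4 = 3) :
    torusRamification K n = {P | ∃ (l t : K) (h : ![l, t ^ n, t ^ (n - 1)] ≠ 0),
      P = Projectivization.mk K _ h ∧
      t ^ (n ^ 2 - n + 1) = l ^ (n - 3) ∧ l ^ 3 + l + 1 = 0} := by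
  have hn2 : 2 < n := Fact.out
  have h2 : (2 : K) = 0 := by exact_mod_cast CharP.cast_eq_zero K 2
  ext P
  rw [mem_torusRamification_iff (hessian_ne_zero_of_mod_four_eq_three hn) (smooth_of_charTwo hn),
    Set.mem_ofPred_eq, exists_mk_pow_iff (by omega)
    (C := fun l t => t ^ (n ^ 2 - n + 1) = l ^ (n - 3) ∧ l ^ 3 + l + 1 = 0)]
  · refine exists_congr fun a => exists_congr fun b => ?_
    refine and_congr_right fun ha => and_congr_right fun hb => and_congr_right fun _ => ?_
    have e1 (h : a * b ^ n + b + a ^ n = 0) : hessianForm n 1 (b / a ^ n) = 0 ↔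
        (a * b ^ (n - 1)) ^ 3 + a * b ^ (n - 1) + 1 = 0 := by
      have h3 := mul_pow_mul_div ha h
      have h4 : b / a ^ n ≠ 0 := div_ne_zero hb (pow_ne_zero n ha)
      rw [hessianForm_of_mod_four_eq_three hn]
      generalize b / a ^ n = l at *
      generalize a * b ^ (n - 1) = w at *
      have h5 : (w * l) ^ 3 = - (l + 1) ^ 3 := by rw [h3]; ring
      have key : l ^ 3 + l + 1 = l ^ 3 * (w ^ 3 + w + 1) := by
        linear_combination -h5 - l ^ 2 * h3 + (l ^ 3 + 2 * l ^ 2 + 2 * l + 1) * h2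
      rw [key, mul_eq_zero_iff_left (pow_ne_zero 3 h4)]
    have e2 (h : (a * b ^ (n - 1)) ^ 3 + a * b ^ (n - 1) + 1 = 0) :
        a * b ^ n + b + a ^ n = 0 ↔ b ^ (n ^ 2 - n + 1) = (a * b ^ (n - 1)) ^ (n - 3) := by
      have hw := mul_ne_zero ha (pow_ne_zero (n - 1) hb)
      rw [curve_equation_iff_left hb]
      have h5 : (a * b ^ (n - 1)) ^ (n - 3) * (a * b ^ (n - 1)) ^ 3 = (a * b ^ (n - 1)) ^ n :=
        pow_sub_mul_pow _ (by omega)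
      generalize a * b ^ (n - 1) = w at *
      constructor
      · intro h'
        apply mul_right_cancel₀ (pow_ne_zero 3 hw)
        linear_combination -h' + b ^ (n ^ 2 - n + 1) * h - h5
      · intro h'
        linear_combination -w ^ 3 * h' + b ^ (n ^ 2 - n + 1) * h - h5
    constructor
    · rintro ⟨h, h'⟩
      have h3 := (e1 h).1 h'
      exact ⟨(e2 h3).1 h, h3⟩
    · rintro ⟨h, h'⟩
      have h3 := (e2 h').2 h
      exact ⟨h3, (e1 h3).2 h'⟩
  · rintro l t ⟨h1, h3⟩
    have hl : l ≠ 0 := by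
      rintro rfl
      simp at h3
    refine ⟨hl, ne_zero_of_pow_eq_zpow (z := (n - 3 : ℕ)) (n := n) ?_ hl⟩
    rw [zpow_natCast, h1]

theorem tangentOrder_of_charTwo (hn : n % 4 = 3) {P : Plane K}
    (hP : P ∈ torusRamification K n) : tangentOrder K n P = 3 := by
  have hN := smooth_of_charTwo (K := K) hn
  obtain ⟨a, b, ha, hb, rfl, h, h0⟩ :=
    (mem_torusRamification_iff (hessian_ne_zero_of_mod_four_eq_three hn) hN).1 hP
  rw [tangentOrder_eq_emultiplicity hN ha hb h rfl one_ne_zero]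
  rw [hessianForm_of_mod_four_eq_three hn] at h0
  exact emultiplicity_tangentPolynomial_of_charTwo hn h0

end CharTwo

section OddCharacteristic

variable {p : ℕ} [Algebra (ZMod p) K]

open Polynomial

theorem hessian_ne_zero_of_ne_one (hn : (n : K) ≠ 0) (hn1 : (n : K) ≠ 1) :
    hessian K n ≠ 0 := by
  -- the constant coefficient of the cubic form is `-n * (n - 1) / 2`
  refine hessian_ne_zero 0 fun h => mul_ne_zero hn (sub_ne_zero.2 hn1) ?_
  rw [hessianForm] at h
  linear_combination -2 * h + (n ^ 2 - (n - 1) ^ 2) * two_mul_cast_choose_two (R := K) n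

theorem ramificationSupport_of_eq_one (h2 : (2 : K) ≠ 0) (hn1 : (n : K) = 1) :
    ramificationSupport K n = fundamentalPoints K := by
  have e (l : K) : hessianForm n 1 l = l * (l + 1) := by
    have h := two_mul_cast_choose_two (R := K) n
    rw [hn1, sub_self, mul_zero, mul_eq_zero_iff_left h2] at h
    rw [hessianForm, h, hn1]; ring
  refine ramificationSupport_eq_fundamentalPoints (hessian_ne_zero 1 ?_) ?_ fun l hl => ?_
  · rw [e, one_mul, one_add_one_eq_two]; exact h2
  · rw [hn1]; simp
  · rw [e] at hl; exact mul_eq_zero.1 hl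

theorem torusRamification_of_ne_one (h2 : (2 : K) ≠ 0) (hn : (n : K) ≠ 0) (hn1 : (n : K) ≠ 1)
    (hN : (n : K) ^ 2 - n + 1 ≠ 0) :
    torusRamification K n = {P | ∃ (l t : K) (h : ![t, l * t ^ n, 1] ≠ 0),
      P = Projectivization.mk K _ h ∧ t ^ (n ^ 2 - n + 1) = -(l + 1) * l ^ (-(n : ℤ)) ∧
      aeval l (cubic (ZMod p) n) = 0} := by
  ext P
  rw [mem_torusRamification_iff (hessian_ne_zero_of_ne_one hn hn1) hN, Set.mem_ofPred_eq,
    exists_mk_mul_pow_iff (C := fun l t => t ^ (n ^ 2 - n + 1) = -(l + 1) * l ^ (-(n : ℤ)) ∧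
      aeval l (cubic (ZMod p) n) = 0)]
  · refine exists_congr fun a => exists_congr fun b => ?_
    refine and_congr_right fun ha => and_congr_right fun hb => and_congr_right fun _ => ?_
    rw [hessianForm_eq_zero_iff (p := p) h2 hn, curve_equation_iff_right ha]
    refine and_congr_left fun _ => ?_
    have h4 : b / a ^ n ≠ 0 := div_ne_zero hb (pow_ne_zero n ha)
    rw [zpow_neg, zpow_natCast, ← div_eq_mul_inv, eq_div_iff (pow_ne_zero n h4)]
    constructor <;> intro h <;> linear_combination h
  · rintro l t ⟨h1, h3⟩
    obtain ⟨hl, hl1⟩ := ne_zero_of_aeval_cubic hn1 h3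
    refine ⟨hl, ?_⟩
    rintro rfl
    rw [zero_pow (by omega)] at h1
    exact mul_ne_zero (neg_ne_zero.2 hl1) (zpow_ne_zero _ hl) h1.symm

theorem tangentOrder_of_ne (h2 : (2 : K) ≠ 0) (hn : (n : K) ≠ 0) (hn1 : (n : K) ≠ 1)
    (hN : (n : K) ^ 2 - n + 1 ≠ 0) (h7 : (n : K) ^ 2 - 4 * n + 7 ≠ 0) {P : Plane K}
    (hP : P ∈ torusRamification K n) : tangentOrder K n P = 3 := by
  obtain ⟨a, b, ha, hb, rfl, h, h0⟩ :=
    (mem_torusRamification_iff (hessian_ne_zero_of_ne_one hn hn1) hN).1 hP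
  rw [tangentOrder_eq_emultiplicity hN ha hb h rfl one_ne_zero]
  exact emultiplicity_tangentPolynomial_of_ne h2 hn hn1 hN h7 (div_add_one_ne_zero ha hb h) h0

theorem tangentOrder_of_eq (p : ℕ) [Algebra (ZMod p) K] (h2 : (2 : K) ≠ 0) (hn : (n : K) ≠ 0)
    (hn1 : (n : K) ≠ 1) (hN : (n : K) ^ 2 - n + 1 ≠ 0) (h7 : (n : K) ^ 2 - 4 * n + 7 = 0)
    {P : Plane K} (hP : P ∈ torusRamification K n) : tangentOrder K n P = 5 := by
  obtain ⟨a, b, ha, hb, rfl, h, h0⟩ :=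
    (mem_torusRamification_iff (hessian_ne_zero_of_ne_one hn hn1) hN).1 hP
  rw [hessianForm_eq_zero_iff (p := p) h2 hn] at h0
  obtain ⟨hl, hnl⟩ := root_of_aeval_cubic hn1 h7 h0
  have h3 : (3 : K) ≠ 0 := fun h3 => hN (by linear_combination h7 + (n - 2) * h3)
  rw [tangentOrder_eq_emultiplicity hN ha hb h rfl (inv_ne_zero h3)]
  exact emultiplicity_tangentPolynomial_of_eq h2 hn hN hl hnl

end OddCharacteristic

end Hessian

end Support

end Hurwitz

end

theorem theorem3p5 (p n : ℕ) [Fact p.Prime] [Fact (2 < n)]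
    (hsmooth : ¬ (p : ℤ) ∣ (n : ℤ) ^ 2 - n + 1)
    (K : Type*) [Field K] [Algebra (ZMod p) K] [IsAlgClosure (ZMod p) K] :
    -- the case `p ∣ n`, with `n = p ^ r * m`, `1 ≤ r` and `p ∤ m`
    (∀ r m : ℕ, 1 ≤ r → ¬ p ∣ m → n = p ^ r * m → ∃ W : Set (Hurwitz.Plane K),
      W = {P | ∃ (l t : K) (h : ![l, t ^ n, t ^ (n - 1)] ≠ 0),
        P = Projectivization.mk K _ h ∧
        t ^ (n ^ 2 - n + 1) = l ^ ((n : ℤ) - (p : ℤ) ^ r - 1) ∧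
        l ^ (p ^ r + 1) + l + 1 = 0} ∧
      (m ≠ 1 → Hurwitz.ramificationSupport K n = Hurwitz.fundamentalPoints K ∪ W) ∧
      (m = 1 → Hurwitz.ramificationSupport K n = W) ∧
      ∀ P ∈ W, Hurwitz.tangentOrder K n P = (p ^ r + 1 : ℕ)) ∧
    -- the case `p ∤ n`, `p = 2`
    (¬ p ∣ n → p = 2 →
      (n % 4 = 1 → Hurwitz.ramificationSupport K n = Hurwitz.fundamentalPoints K) ∧
      (n % 4 ≠ 1 → ∃ W : Set (Hurwitz.Plane K),
        W = {P | ∃ (l t : K) (h : ![l, t ^ n, t ^ (n - 1)] ≠ 0),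
          P = Projectivization.mk K _ h ∧
          t ^ (n ^ 2 - n + 1) = l ^ (n - 3) ∧ l ^ 3 + l + 1 = 0} ∧
        Hurwitz.ramificationSupport K n = Hurwitz.fundamentalPoints K ∪ W ∧
        ∀ P ∈ W, Hurwitz.tangentOrder K n P = 3)) ∧
    -- the case `p ∤ n`, `p > 2`
    (¬ p ∣ n → 2 < p →
      (p ∣ n - 1 → Hurwitz.ramificationSupport K n = Hurwitz.fundamentalPoints K) ∧
      (¬ p ∣ n - 1 →
        ((p : ℤ) ∣ (n : ℤ) ^ 2 - 4 * n + 7 → ∃ W : Set (Hurwitz.Plane K),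
          W = {P | ∃ (l t : K) (h : ![t, l * t ^ n, 1] ≠ 0),
            P = Projectivization.mk K _ h ∧
            t ^ (n ^ 2 - n + 1) = l ^ (2 * (n + 1)) ∧
            Polynomial.aeval l (Hurwitz.cubic (ZMod p) n) = 0} ∧
          Hurwitz.ramificationSupport K n = Hurwitz.fundamentalPoints K ∪ W ∧
          ∀ P ∈ W, Hurwitz.tangentOrder K n P = 5) ∧
        (¬ (p : ℤ) ∣ (n : ℤ) ^ 2 - 4 * n + 7 → ∃ W : Set (Hurwitz.Plane K),
          W = {P | ∃ (l t : K) (h : ![t, l * t ^ n, 1] ≠ 0),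
            P = Projectivization.mk K _ h ∧
            t ^ (n ^ 2 - n + 1) = -(l + 1) * l ^ (-(n : ℤ)) ∧
            Polynomial.aeval l (Hurwitz.cubic (ZMod p) n) = 0} ∧
          Hurwitz.ramificationSupport K n = Hurwitz.fundamentalPoints K ∪ W ∧
          ∀ P ∈ W, Hurwitz.tangentOrder K n P = 3))) := by
  have hn2 : 2 < n := Fact.out
  have : CharP K p := charP_of_injective_algebraMap' (ZMod p) p
  have : IsAlgClosed K := IsAlgClosure.isAlgClosed (ZMod p)
  have hN : (n : K) ^ 2 - n + 1 ≠ 0 := by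
    intro h
    refine hsmooth ((CharP.intCast_eq_zero_iff K p _).1 ?_)
    push_cast
    exact h
  have h7 : (n : K) ^ 2 - 4 * n + 7 = 0 ↔ (p : ℤ) ∣ (n : ℤ) ^ 2 - 4 * n + 7 := by
    rw [← CharP.intCast_eq_zero_iff K p]
    push_cast
    rfl
  refine ⟨fun r m hr hm hn => ?_, fun hpn hp2 => ?_, fun hpn hp2 => ?_⟩
  · have hR : ∀ P ∈ Hurwitz.fundamentalPoints K, Hurwitz.ramification K n P = n - p ^ r :=
      fun P hP => Hurwitz.ramification_fundamentalPoint_of_dvd hr hm hn hP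
    refine ⟨_, Hurwitz.torusRamification_of_dvd hr hm hn, fun hm1 => ?_, fun hm1 => ?_,
      fun P hP => Hurwitz.tangentOrder_of_dvd hr hm hn hP⟩
    · refine Hurwitz.ramificationSupport_eq_union fun P hP => ?_
      rw [hR P hP, sub_ne_zero]
      intro h
      have h' : n = p ^ r := by exact_mod_cast h
      refine hm1 (Nat.eq_of_mul_eq_mul_left (pow_pos (Fact.out (p := p.Prime)).pos r) ?_)
      rw [← hn, h', mul_one]
    · refine Hurwitz.ramificationSupport_eq_torusRamification fun P hP => ?_
      rw [hR P hP, hn, hm1]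
      push_cast; ring
  · subst hp2
    refine ⟨fun hn => ?_, fun hn => ?_⟩
    · refine Hurwitz.ramificationSupport_eq_fundamentalPoints
        (Hurwitz.hessian_ne_zero_of_mod_four_eq_one hn) hN fun l hl => ?_
      rw [Hurwitz.hessianForm_of_mod_four_eq_one hn] at hl
      exact mul_eq_zero.1 hl
    · have hn3 : n % 4 = 3 := by omega
      exact ⟨_, Hurwitz.torusRamification_of_charTwo hn3, Hurwitz.ramificationSupport_of_hessian
        (Hurwitz.hessian_ne_zero_of_mod_four_eq_three hn3) hN,
        fun P hP => Hurwitz.tangentOrder_of_charTwo hn3 hP⟩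
  · have h2 : (2 : K) ≠ 0 := by
      intro h
      have h' : ((2 : ℕ) : K) = 0 := by exact_mod_cast h
      rw [CharP.cast_eq_zero_iff K p] at h'
      exact absurd (Nat.le_of_dvd two_pos h') (by omega)
    have hn0 : (n : K) ≠ 0 := by rwa [Ne, CharP.cast_eq_zero_iff K p]
    have hn1 : (n : K) = 1 ↔ p ∣ n - 1 := by
      rw [← CharP.cast_eq_zero_iff K p, Nat.cast_sub (by omega), Nat.cast_one, sub_eq_zero]
    refine ⟨fun h1 => Hurwitz.ramificationSupport_of_eq_one h2 (hn1.2 h1), fun h1 => ?_⟩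
    have hn1' : (n : K) ≠ 1 := fun h => h1 (hn1.1 h)
    have hsupp := Hurwitz.ramificationSupport_of_hessian
      (Hurwitz.hessian_ne_zero_of_ne_one hn0 hn1') hN
    have hW := Hurwitz.torusRamification_of_ne_one (p := p) h2 hn0 hn1' hN
    refine ⟨fun h => ⟨_, hW.trans (Hurwitz.setOf_eq_of_eq hn1' (h7.2 h)), hsupp, fun P hP =>
      Hurwitz.tangentOrder_of_eq p h2 hn0 hn1' hN (h7.2 h) hP⟩, fun h => ⟨_, hW, hsupp,
      fun P hP => Hurwitz.tangentOrder_of_ne h2 hn0 hn1' hN (fun h' => h (h7.1 h')) hP⟩⟩
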